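/- **Conventions.** Let $K$ be a field of characteristic $0$, let $X$, $Y$ be smooth $K$-schemes and let $f:X\to Y$ be a $K$-morphism. For an $\mathcal O_Y$-module $\mathcal M$ put $f^*\mathcal M=\mathcal O_X\otimes_{f^{-1}\mathcal O_Y}f^{-1}\mathcal M$. Let $\Omega^1_X$ be the sheaf of differentials, $\mathcal D_X$ the sheaf of $K$-linear differential operators, and $\mathcal P^1_X$ the sheaf of principal parts of order one, with its left structure $a\mapsto a\otimes 1$ and right structure $a\mapsto 1\otimes a$. We regard $\Omega^1_X$ as a subsheaf of $\mathcal P^1_X$ through $da\mapsto a\otimes 1-1\otimes a$. In $\mathcal P^1_X\otimes\mathcal E$ the tensor product uses the right structure of $\mathcal P^1_X$, and the $\mathcal O_X$-module structure is the left one. Let $c_X:\mathcal E\to\mathcal P^1_X\otimes\mathcal E$, $e\mapsto 1\otimes e$. A connection on an $\mathcal O_X$-module $\mathcal E$ is a morphism of abelian sheaves $\nabla:\mathcal E\to\Omega^1_X\otimes\mathcal E$ with $\nabla(ae)=a\nabla(e)+da\otimes e$; then $\delta=c_X+\nabla:\mathcal E\to\mathcal P^1_X\otimes\mathcal E$ is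 $\mathcal O_X$-linear. For a local derivation $\partial$ put $\Delta_\partial(e)=\langle\partial,\nabla(e)\rangle$; the connection is integrable if $\Delta_{[\partial,\partial']}=[\Delta_\partial,\Delta_{\partial'}]$ for all local derivations. A left $\mathcal D_X$-module structure on $\mathcal E$ (extending its $\mathcal O_X$-module structure) corresponds to $\nabla$ if $\partial\cdot e=\Delta_\partial(e)$ for all local derivations $\partial$. The same conventions apply to $Y$. Local coordinates on an open $V\subseteq Y$ are functions $y_1,\dots,y_n$ on $V$ such that the $dy_i$ form a basis of $\Omega^1_Y$ on $V$, and $\eta_1,\dots,\eta_n$ denotes the dual basis of derivations. The *inverse image* of a connection $\nabla$ on $\mathcal M$, with associated $\delta=c_Y+\nabla$, is the connection $f^*\nabla=f^*\delta-c_X$ on $f^*\mathcal M$, where $f^*\delta$ is the composite $f^*\mathcal M\to f^*(\mathcal P^1_Y\otimes\mathcal M)\to\mathcal P^1_X\otimes f^*\mathcal M$. The *inverse image* of a left $\mathcal D_Y$-module $\mathcal M$ is $f^*\mathcal M$ with the $\mathcal D_X$-module structure such that, in all local coordinates on $Y$, $$\alpha'(\alpha\otimes m)=\alpha'\alpha\otimes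 m,\qquad \partial(\alpha\otimes m)=\partial(\alpha)\otimes m+\alpha\sum_i\partial(y_i)\otimes\eta_i m .\tag{1}$$ **Theorem.** Let $\mathcal M$ be an $\mathcal O_Y$-module. (a) Every left $\mathcal D_Y$-module structure on $\mathcal M$ corresponds to exactly one integrable connection on $\mathcal M$, and every integrable connection on $\mathcal M$ corresponds to exactly one left $\mathcal D_Y$-module structure. Now let $\mathcal M$ be a left $\mathcal D_Y$-module and $\nabla$ the corresponding integrable connection. (b) There is exactly one connection $f^*\nabla$ on $f^*\mathcal M$ with $c_X+f^*\nabla=f^*\delta$. It is integrable, and for local sections $\alpha$ of $\mathcal O_X$ and $m$ of $\mathcal M$ $$(f^*\nabla)(\alpha\otimes m)=\alpha\,f^*(\nabla(m))+d\alpha\otimes(1\otimes m),$$ where $f^*(\omega\otimes m)=f^*\omega\otimes(1\otimes m)$. In local coordinates $y_i$ on $Y$ and for a local derivation $\partial$ on $X$, $$\langle\partial,(f^*\nabla)(\alpha\otimes m)\rangle=\alpha\sum_i\partial(y_i)\otimes\Delta_{\eta_i}(m)+\partial(\alpha)\otimes m .$$ (c) There is exactly one left $\mathcal D_X$-module structure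 on $f^*\mathcal M$ corresponding to $f^*\nabla$; there is exactly one satisfying (1); and these two structures coincide. (d) Let $\mathcal D_{X\to Y}=f^*\mathcal D_Y$ be the inverse image of the left $\mathcal D_Y$-module $\mathcal D_Y$, with the unique left $\mathcal D_X$-module structure satisfying (1). It commutes with the right multiplication by sections of $f^{-1}\mathcal D_Y$. There is exactly one left $\mathcal D_X$-module structure on the sheaf $\mathcal D_{X\to Y}\otimes_{f^{-1}\mathcal D_Y}f^{-1}\mathcal M$ with $P(n\otimes m)=Pn\otimes m$ for all local sections $P$ of $\mathcal D_X$, $n$ of $\mathcal D_{X\to Y}$ and $m$ of $\mathcal M$, and there is an isomorphism $$f^*\mathcal M\;\cong\;\mathcal D_{X\to Y}\otimes_{f^{-1}\mathcal D_Y}f^{-1}\mathcal M,\qquad \alpha\otimes m\mapsto(\alpha\otimes 1)\otimes m,$$ which is $\mathcal D_X$-linear for the structure of (c) on the left-hand side. -/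

import Mathlib

open CategoryTheory AlgebraicGeometry TopologicalSpace Opposite
open scoped TensorProduct

universe u

set_option linter.unusedSectionVars false

noncomputable section

namespace DConn

/-! ### Differentials and first order principal parts of algebras -/

section Algebra

variable {K A B C : Type u} [CommRing K] [CommRing A] [CommRing B] [CommRing C]
  [Algebra K A] [Algebra K B] [Algebra K C]

/-- The additive map `Ω_{A/K} → Ω_{B/K}`, `a db ↦ φ(a) dφ(b)`. -/
def kaehlerMap (φ : A →ₐ[K] B) : Ω[A⁄K] →+ Ω[B⁄K] :=
  letI : Algebra A B := φ.toRingHom.toAlgebra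
  haveI : IsScalarTower K A B := IsScalarTower.of_algebraMap_eq fun x => (φ.commutes x).symm
  (KaehlerDifferential.map K K A B).toAddMonoidHom

lemma kaehlerMap_D (φ : A →ₐ[K] B) (a : A) :
    kaehlerMap φ (KaehlerDifferential.D K A a) = KaehlerDifferential.D K B (φ a) := by
  let _ : Algebra A B := φ.toRingHom.toAlgebra
  have : IsScalarTower K A B := IsScalarTower.of_algebraMap_eq fun x => (φ.commutes x).symm
  exact KaehlerDifferential.map_D K K A B a

lemma kaehlerMap_smul (φ : A →ₐ[K] B) (a : A) (w : Ω[A⁄K]) :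
    kaehlerMap φ (a • w) = φ a • kaehlerMap φ w := by
  let _ : Algebra A B := φ.toRingHom.toAlgebra
  have : IsScalarTower K A B := IsScalarTower.of_algebraMap_eq fun x => (φ.commutes x).symm
  exact (KaehlerDifferential.map K K A B).map_smul a w

lemma kaehler_induction {P : Ω[A⁄K] → Prop} (w : Ω[A⁄K])
    (hd : ∀ b : A, P (KaehlerDifferential.D K A b))
    (hadd : ∀ x y, P x → P y → P (x + y)) (hsmul : ∀ (a : A) x, P x → P (a • x)) : P w := by
  have hw : w ∈ Submodule.span A (Set.range (KaehlerDifferential.D K A)) := by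
    rw [KaehlerDifferential.span_range_derivation]; trivial
  refine Submodule.span_induction (p := fun x _ => P x) ?_ ?_ ?_ ?_ hw
  · rintro _ ⟨b, rfl⟩; exact hd b
  · simpa using hsmul 0 _ (hd 0)
  · intro x y _ _ hx hy; exact hadd x y hx hy
  · intro a x _ hx; exact hsmul a x hx

lemma kaehlerMap_id (w : Ω[A⁄K]) : kaehlerMap (AlgHom.id K A) w = w := by
  induction w using kaehler_induction with
  | hd b => rw [kaehlerMap_D]; rfl
  | hadd x y hx hy => rw [map_add, hx, hy]
  | hsmul a x hx => rw [kaehlerMap_smul, hx]; rfl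

lemma kaehlerMap_comp (φ : A →ₐ[K] B) (ψ : B →ₐ[K] C) (w : Ω[A⁄K]) :
    kaehlerMap ψ (kaehlerMap φ w) = kaehlerMap (ψ.comp φ) w := by
  induction w using kaehler_induction with
  | hd b => simp only [kaehlerMap_D]; rfl
  | hadd x y hx hy => simp only [map_add, hx, hy]
  | hsmul a x hx => simp only [kaehlerMap_smul, hx]; rfl

variable (K A) in
/-- The ring `P¹_{A/K} = (A ⊗_K A) / I²` of principal parts of order one, where `I` is the kernel
of the multiplication map. -/
def PP : Type u := (A ⊗[K] A) ⧸ (KaehlerDifferential.ideal K A) ^ 2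

instance : CommRing (PP K A) :=
  inferInstanceAs (CommRing ((A ⊗[K] A) ⧸ (KaehlerDifferential.ideal K A) ^ 2))

variable (K A) in
/-- The projection `A ⊗_K A → P¹_{A/K}`. -/
def PP.mk : A ⊗[K] A →+* PP K A := Ideal.Quotient.mk _

variable (K A) in
/-- The left structure `a ↦ a ⊗ 1`. -/
def PP.left : A →+* PP K A :=
  (PP.mk K A).comp
    (Algebra.TensorProduct.includeLeft (R := K) (S := K) (A := A) (B := A)).toRingHom

variable (K A) in
/-- The right structure `a ↦ 1 ⊗ a`. -/
def PP.right : A →+* PP K A :=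
  (PP.mk K A).comp (Algebra.TensorProduct.includeRight (R := K) (A := A) (B := A)).toRingHom

lemma PP.ringHom_ext {S : Type*} [CommRing S] {f g : PP K A →+* S}
    (hl : ∀ a, f (PP.left K A a) = g (PP.left K A a))
    (hr : ∀ a, f (PP.right K A a) = g (PP.right K A a)) : f = g := by
  apply Ideal.Quotient.ringHom_ext
  refine RingHom.ext fun x => ?_
  change f (PP.mk K A x) = g (PP.mk K A x)
  induction x with
  | zero => simp
  | add x y hx hy => simp only [map_add, hx, hy]
  | tmul a b =>
    have : PP.mk K A (a ⊗ₜ b) = PP.left K A a * PP.right K A b := by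
      change _ = PP.mk K A (a ⊗ₜ 1) * PP.mk K A (1 ⊗ₜ b)
      rw [← map_mul]; simp
    rw [this, map_mul, map_mul, hl, hr]

/-- The functoriality of principal parts, `a ⊗ b ↦ φ(a) ⊗ φ(b)`. -/
def PP.map (φ : A →ₐ[K] B) : PP K A →+* PP K B :=
  Ideal.quotientMap _ (Algebra.TensorProduct.map φ φ).toRingHom (by
    rw [← Ideal.map_le_iff_le_comap, Ideal.map_pow]
    refine Ideal.pow_right_mono ?_ 2
    rw [Ideal.map_le_iff_le_comap]
    intro x hx
    have key : ∀ x : A ⊗[K] A, Algebra.TensorProduct.lmul' K (S := B)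
        (Algebra.TensorProduct.map φ φ x) = φ (Algebra.TensorProduct.lmul' K (S := A) x) := by
      intro x
      induction x with
      | zero => simp
      | add x y hx hy => simp only [map_add, hx, hy]
      | tmul a b => simp
    change Algebra.TensorProduct.lmul' K (S := A) x = 0 at hx
    change Algebra.TensorProduct.lmul' K (S := B) (Algebra.TensorProduct.map φ φ x) = 0
    rw [key, hx, map_zero])

lemma PP.map_left (φ : A →ₐ[K] B) (a : A) : PP.map φ (PP.left K A a) = PP.left K B (φ a) := by
  change PP.mk K B (Algebra.TensorProduct.map φ φ (a ⊗ₜ 1)) = PP.mk K B (φ a ⊗ₜ 1)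
  simp

lemma PP.map_right (φ : A →ₐ[K] B) (a : A) :
    PP.map φ (PP.right K A a) = PP.right K B (φ a) := by
  change PP.mk K B (Algebra.TensorProduct.map φ φ (1 ⊗ₜ a)) = PP.mk K B (1 ⊗ₜ φ a)
  simp

lemma PP.map_id (p : PP K A) : PP.map (AlgHom.id K A) p = p := by
  have : PP.map (AlgHom.id K A) = RingHom.id _ :=
    PP.ringHom_ext (fun a => PP.map_left _ a) (fun a => PP.map_right _ a)
  rw [this]; rfl

lemma PP.map_comp (φ : A →ₐ[K] B) (ψ : B →ₐ[K] C) (p : PP K A) :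
    PP.map ψ (PP.map φ p) = PP.map (ψ.comp φ) p := by
  have : (PP.map ψ).comp (PP.map φ) = PP.map (ψ.comp φ) :=
    PP.ringHom_ext (fun a => by simp [PP.map_left]) (fun a => by simp [PP.map_right])
  rw [← this]; rfl

/-- `P¹_{A/K}` as an `A`-module through its right structure. -/
instance PP.rightModule : Module A (PP K A) := Module.compHom _ (PP.right K A)

lemma PP.right_smul (a : A) (p : PP K A) : a • p = PP.right K A a * p := rfl

/-- The inclusion `Ω_{A/K} = I / I² → P¹_{A/K}` with `da ↦ a ⊗ 1 - 1 ⊗ a`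
(the opposite of the inclusion for which `da` corresponds to `1 ⊗ a - a ⊗ 1`). -/
def PP.ofKaehler : Ω[A⁄K] →+ PP K A :=
  -(KaehlerDifferential.ideal K A).cotangentToQuotientSquare.toAddMonoidHom

lemma PP.ofKaehler_D (a : A) :
    PP.ofKaehler (KaehlerDifferential.D K A a) = PP.left K A a - PP.right K A a := by
  change -(PP.mk K A ((1 : A) ⊗ₜ[K] a - a ⊗ₜ[K] (1 : A))) =
    PP.mk K A (a ⊗ₜ[K] (1 : A)) - PP.mk K A ((1 : A) ⊗ₜ[K] a)
  rw [map_sub, neg_sub]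

lemma PP.ofKaehler_smul (a : A) (w : Ω[A⁄K]) :
    PP.ofKaehler (a • w) = PP.left K A a * PP.ofKaehler w := by
  obtain ⟨x, rfl⟩ := Ideal.toCotangent_surjective _ w
  change -(PP.mk K A (a • x.1)) = PP.mk K A (a ⊗ₜ[K] (1 : A)) * -(PP.mk K A x.1)
  rw [Algebra.smul_def, map_mul, mul_neg]
  rfl

lemma PP.ofKaehler_smul_right (a : A) (w : Ω[A⁄K]) :
    PP.ofKaehler (a • w) = a • PP.ofKaehler w := by
  rw [PP.ofKaehler_smul, PP.right_smul, ← sub_eq_zero, ← sub_mul]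
  obtain ⟨x, rfl⟩ := Ideal.toCotangent_surjective _ w
  change (PP.mk K A (a ⊗ₜ[K] (1 : A)) - PP.mk K A ((1 : A) ⊗ₜ[K] a)) * -(PP.mk K A x.1) = 0
  rw [← map_sub, mul_neg, ← map_mul, neg_eq_zero]
  refine Ideal.Quotient.eq_zero_iff_mem.mpr ?_
  rw [pow_two]
  refine Ideal.mul_mem_mul ?_ x.2
  change Algebra.TensorProduct.lmul' K (S := A) _ = 0
  simp

variable (K A) in
/-- `P¹_{A/K} ⊗_A E`, where the tensor product uses the right structure of `P¹_{A/K}`. It is an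
`A`-module through the left structure of `P¹_{A/K}`. -/
def PPT (E : Type u) [AddCommGroup E] [Module A E] : Type u := PP K A ⊗[A] E

variable {E F G : Type u} [AddCommGroup E] [Module A E] [AddCommGroup F] [Module B F]

instance : AddCommGroup (PPT K A E) := inferInstanceAs (AddCommGroup (PP K A ⊗[A] E))

/-- The pure tensor `p ⊗ e`. -/
def PPT.tmul (p : PP K A) (e : E) : PPT K A E := p ⊗ₜ[A] e

lemma PPT.add_tmul (p q : PP K A) (e : E) :
    PPT.tmul (p + q) e = PPT.tmul p e + PPT.tmul q e := TensorProduct.add_tmul p q e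

lemma PPT.sub_tmul (p q : PP K A) (e : E) :
    PPT.tmul (p - q) e = PPT.tmul p e - PPT.tmul q e := TensorProduct.sub_tmul p q e

lemma PPT.tmul_add (p : PP K A) (e e' : E) :
    PPT.tmul p (e + e') = PPT.tmul p e + PPT.tmul p e' := TensorProduct.tmul_add p e e'

lemma PPT.tmul_smul (p : PP K A) (a : A) (e : E) :
    PPT.tmul p (a • e) = PPT.tmul (PP.right K A a * p) e :=
  (TensorProduct.smul_tmul (R := A) a p e).symm

/-- Additive maps out of `P¹_{A/K} ⊗_A E`. -/
def PPT.lift {G : Type u} [AddCommGroup G] (f : PP K A →+ E →+ G)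
    (hf : ∀ (a : A) p e, f (PP.right K A a * p) e = f p (a • e)) : PPT K A E →+ G :=
  TensorProduct.liftAddHom f hf

@[simp] lemma PPT.lift_tmul {G : Type u} [AddCommGroup G] (f : PP K A →+ E →+ G)
    (hf : ∀ (a : A) p e, f (PP.right K A a * p) e = f p (a • e)) (p : PP K A) (e : E) :
    PPT.lift f hf (PPT.tmul p e) = f p e := TensorProduct.liftAddHom_tmul f hf p e

lemma PPT.induction {P : PPT K A E → Prop} (x : PPT K A E)
    (htmul : ∀ p e, P (PPT.tmul p e)) (hadd : ∀ x y, P x → P y → P (x + y)) : P x := by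
  induction x using TensorProduct.induction_on with
  | zero => simpa [PPT.tmul] using htmul 0 0
  | tmul p e => exact htmul p e
  | add x y hx hy => exact hadd x y hx hy

/-- Biadditive maps from functions of two variables. -/
def biadd {M N G : Type*} [AddCommGroup M] [AddCommGroup N] [AddCommGroup G] (f : M → N → G)
    (h₁ : ∀ x y z, f (x + y) z = f x z + f y z) (h₂ : ∀ x y z, f x (y + z) = f x y + f x z) :
    M →+ N →+ G :=
  AddMonoidHom.mk' (fun x => AddMonoidHom.mk' (f x) (h₂ x))
    (fun x y => AddMonoidHom.ext fun z => h₁ x y z)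

@[simp] lemma biadd_apply {M N G : Type*} [AddCommGroup M] [AddCommGroup N] [AddCommGroup G]
    (f : M → N → G) (h₁ : ∀ x y z, f (x + y) z = f x z + f y z)
    (h₂ : ∀ x y z, f x (y + z) = f x y + f x z) (x : M) (y : N) : biadd f h₁ h₂ x y = f x y := rfl

/-- Multiplication by `a` on `P¹_{A/K} ⊗_A E` through the left structure. -/
def PPT.leftMul (a : A) : PPT K A E →+ PPT K A E :=
  PPT.lift (biadd (fun p e => PPT.tmul (PP.left K A a * p) e)
    (fun p q e => by rw [mul_add, PPT.add_tmul]) (fun p e e' => PPT.tmul_add _ e e'))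
    (fun b p e => by simp only [biadd_apply]; rw [PPT.tmul_smul, mul_left_comm])

@[simp] lemma PPT.leftMul_tmul (a : A) (p : PP K A) (e : E) :
    PPT.leftMul a (PPT.tmul p e) = PPT.tmul (PP.left K A a * p) e := by
  simp [PPT.leftMul]

instance : Module A (PPT K A E) where
  smul a x := PPT.leftMul a x
  one_smul x := by
    change PPT.leftMul 1 x = x
    induction x using PPT.induction with
    | htmul p e => simp
    | hadd x y hx hy => rw [map_add, hx, hy]
  mul_smul a b x := by
    change PPT.leftMul (a * b) x = PPT.leftMul a (PPT.leftMul b x)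
    induction x using PPT.induction with
    | htmul p e => simp [mul_assoc]
    | hadd x y hx hy => simp only [map_add, hx, hy]
  smul_zero a := map_zero _
  smul_add a := map_add _
  add_smul a b x := by
    change PPT.leftMul (a + b) x = PPT.leftMul a x + PPT.leftMul b x
    induction x using PPT.induction with
    | htmul p e => simp [add_mul, PPT.add_tmul]
    | hadd x y hx hy => simp only [map_add, hx, hy]; abel
  zero_smul x := by
    change PPT.leftMul 0 x = 0
    induction x using PPT.induction with
    | htmul p e =>
      rw [PPT.leftMul_tmul, map_zero, zero_mul]
      exact TensorProduct.zero_tmul _ _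
    | hadd x y hx hy => simp only [map_add, hx, hy, add_zero]

lemma PPT.smul_tmul' (a : A) (p : PP K A) (e : E) :
    a • PPT.tmul p e = PPT.tmul (PP.left K A a * p) e := PPT.leftMul_tmul a p e

/-- The map `P¹_{A/K} ⊗_A E → P¹_{B/K} ⊗_B F` induced by a homomorphism `φ : A → B` and a
`φ`-semilinear map `E → F`. -/
def PPT.map (φ : A →ₐ[K] B) (g : E →+ F) (hg : ∀ (a : A) e, g (a • e) = φ a • g e) :
    PPT K A E →+ PPT K B F :=
  PPT.lift (biadd (fun p e => PPT.tmul (PP.map φ p) (g e))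
    (fun p q e => by rw [map_add, PPT.add_tmul]) (fun p e e' => by rw [map_add, PPT.tmul_add]))
    (fun a p e => by
      simp only [biadd_apply]; rw [hg, PPT.tmul_smul, map_mul, PP.map_right])

@[simp] lemma PPT.map_tmul (φ : A →ₐ[K] B) (g : E →+ F)
    (hg : ∀ (a : A) e, g (a • e) = φ a • g e) (p : PP K A) (e : E) :
    PPT.map φ g hg (PPT.tmul p e) = PPT.tmul (PP.map φ p) (g e) := by
  simp [PPT.map]

lemma PPT.map_smul (φ : A →ₐ[K] B) (g : E →+ F)
    (hg : ∀ (a : A) e, g (a • e) = φ a • g e) (a : A) (x : PPT K A E) :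
    PPT.map φ g hg (a • x) = φ a • PPT.map φ g hg x := by
  induction x using PPT.induction with
  | htmul p e => rw [PPT.smul_tmul', PPT.map_tmul, PPT.map_tmul, PPT.smul_tmul', map_mul,
      PP.map_left]
  | hadd x y hx hy => simp only [smul_add, map_add, hx, hy]

/-- The map `Ω_{A/K} ⊗_A E → Ω_{B/K} ⊗_B F` induced by a homomorphism `φ : A → B` and a
`φ`-semilinear map `E → F`. -/
def kaehlerTensorMap (φ : A →ₐ[K] B) (g : E →+ F) (hg : ∀ (a : A) e, g (a • e) = φ a • g e) :
    Ω[A⁄K] ⊗[A] E →+ Ω[B⁄K] ⊗[B] F :=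
  TensorProduct.liftAddHom (biadd (fun w e => kaehlerMap φ w ⊗ₜ[B] g e)
    (fun p q e => by rw [map_add, TensorProduct.add_tmul])
    (fun p e e' => by rw [map_add, TensorProduct.tmul_add]))
    (fun a w e => by
      simp only [biadd_apply]; rw [hg, kaehlerMap_smul, TensorProduct.smul_tmul])

@[simp] lemma kaehlerTensorMap_tmul (φ : A →ₐ[K] B) (g : E →+ F)
    (hg : ∀ (a : A) e, g (a • e) = φ a • g e) (w : Ω[A⁄K]) (e : E) :
    kaehlerTensorMap φ g hg (w ⊗ₜ[A] e) = kaehlerMap φ w ⊗ₜ[B] g e := by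
  simp [kaehlerTensorMap]

lemma kaehlerTensorMap_smul (φ : A →ₐ[K] B) (g : E →+ F)
    (hg : ∀ (a : A) e, g (a • e) = φ a • g e) (a : A) (x : Ω[A⁄K] ⊗[A] E) :
    kaehlerTensorMap φ g hg (a • x) = φ a • kaehlerTensorMap φ g hg x := by
  induction x using TensorProduct.induction_on with
  | zero => simp
  | tmul w e => rw [TensorProduct.smul_tmul', kaehlerTensorMap_tmul, kaehlerTensorMap_tmul,
      kaehlerMap_smul, TensorProduct.smul_tmul']
  | add x y hx hy => simp only [smul_add, map_add, hx, hy]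

/-- The inclusion `Ω_{A/K} ⊗_A E → P¹_{A/K} ⊗_A E`. -/
def PPT.ofKaehler : Ω[A⁄K] ⊗[A] E →ₗ[A] PPT K A E where
  toFun := TensorProduct.liftAddHom (biadd (fun w e => PPT.tmul (PP.ofKaehler w) e)
    (fun p q e => by rw [map_add, PPT.add_tmul]) (fun p e e' => PPT.tmul_add _ e e'))
    (fun a w e => by
      simp only [biadd_apply]; rw [PP.ofKaehler_smul_right, PPT.tmul_smul, PP.right_smul])
  map_add' := map_add _
  map_smul' a x := by
    induction x using TensorProduct.induction_on with
    | zero => simp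
    | tmul w e => simp [TensorProduct.smul_tmul', PP.ofKaehler_smul, PPT.smul_tmul']
    | add x y hx hy => simp only [smul_add, map_add, hx, hy]

@[simp] lemma PPT.ofKaehler_tmul (w : Ω[A⁄K]) (e : E) :
    PPT.ofKaehler (w ⊗ₜ[A] e) = PPT.tmul (PP.ofKaehler w) e := by
  simp [PPT.ofKaehler]

/-- The contraction `Ω_{A/K} ⊗_A E → E`, `a db ⊗ e ↦ a ∂(b) e`, with a derivation `∂`. -/
def contractAlg (d : Derivation K A A) : Ω[A⁄K] ⊗[A] E →ₗ[A] E :=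
  TensorProduct.lift ((LinearMap.lsmul A E).comp d.liftKaehlerDifferential)

end Algebra
/-! ### Sections of schemes over a field and of their modules -/

section Sections

variable {K : Type u} [Field K]

/-- The structure of `K`-algebra on the sections of a `K`-scheme. -/
instance algebraSections (X : Scheme.{u}) [X.Over (Spec (CommRingCat.of K))] (U : X.Opens) :
    Algebra K Γ(X, U) :=
  ((X.presheaf.map (homOfLE (le_top : U ≤ ⊤)).op).hom.comp
    ((X ↘ Spec (CommRingCat.of K)).appTop.hom.comp
      (Scheme.ΓSpecIso (CommRingCat.of K)).inv.hom)).toAlgebra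

variable {X Y : Scheme.{u}}

variable (K) in
/-- Restriction of functions. -/
def resO [X.Over (Spec (CommRingCat.of K))] {U V : X.Opens} (h : V ≤ U) :
    Γ(X, U) →ₐ[K] Γ(X, V) where
  toRingHom := (X.presheaf.map (homOfLE h).op).hom
  commutes' k := by
    change (X.presheaf.map _ ≫ X.presheaf.map _) _ = X.presheaf.map _ _
    rw [← Functor.map_comp]
    rfl

variable (K) in
/-- Pullback of functions, `f^♯ : O_Y(V) → O_X(U)` for `U ⊆ f⁻¹(V)`. -/
def pullO [X.Over (Spec (CommRingCat.of K))] [Y.Over (Spec (CommRingCat.of K))]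
    (f : X ⟶ Y) [f.IsOver (Spec (CommRingCat.of K))] {V : Y.Opens} {U : X.Opens}
    (h : U ≤ f ⁻¹ᵁ V) : Γ(Y, V) →ₐ[K] Γ(X, U) where
  toRingHom := (f.appLE V U h).hom
  commutes' k := by
    have h1 : f ≫ (Y ↘ Spec (CommRingCat.of K)) = X ↘ Spec (CommRingCat.of K) :=
      comp_over f _
    have h2 : Y.presheaf.map (homOfLE (le_top : V ≤ ⊤)).op ≫ f.appLE V U h =
        f.appTop ≫ X.presheaf.map (homOfLE (le_top : U ≤ ⊤)).op := by
      rw [Scheme.Hom.map_appLE]; rfl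
    change (Y.presheaf.map (homOfLE (le_top : V ≤ ⊤)).op ≫ f.appLE V U h)
        ((Y ↘ Spec (CommRingCat.of K)).appTop _) =
      X.presheaf.map _ ((X ↘ Spec (CommRingCat.of K)).appTop _)
    rw [h2, ← h1, Scheme.Hom.comp_appTop]
    rfl

/-- Restriction of sections of a sheaf of modules. -/
def res (E : X.Modules) {U V : X.Opens} (h : V ≤ U) : Γ(E, U) →+ Γ(E, V) :=
  (E.presheaf.map (homOfLE h).op).hom

lemma res_self (E : X.Modules) {U : X.Opens} (h : U ≤ U) (e : Γ(E, U)) : res E h e = e := by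
  change E.presheaf.map (𝟙 _) e = e
  rw [E.presheaf.map_id]; rfl

lemma res_res (E : X.Modules) {U V W : X.Opens} (h : V ≤ U) (h' : W ≤ V) (e : Γ(E, U)) :
    res E h' (res E h e) = res E (h'.trans h) e := by
  change (E.presheaf.map _ ≫ E.presheaf.map _) e = _
  rw [← E.presheaf.map_comp]; rfl

lemma resO_self [X.Over (Spec (CommRingCat.of K))] {U : X.Opens} (h : U ≤ U) :
    resO K h = AlgHom.id K Γ(X, U) := by
  ext a
  change X.presheaf.map (𝟙 _) a = a
  rw [X.presheaf.map_id]; rfl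

lemma resO_resO [X.Over (Spec (CommRingCat.of K))] {U V W : X.Opens} (h : V ≤ U) (h' : W ≤ V)
    (a : Γ(X, U)) : resO K h' (resO K h a) = resO K (h'.trans h) a := by
  change (X.presheaf.map _ ≫ X.presheaf.map _) a = _
  rw [← X.presheaf.map_comp]; rfl

lemma res_smul [X.Over (Spec (CommRingCat.of K))] (E : X.Modules) {U V : X.Opens} (h : V ≤ U)
    (a : Γ(X, U)) (e : Γ(E, U)) : res E h (a • e) = resO K h a • res E h e :=
  Scheme.Modules.map_smul E (homOfLE h) a e

/-- A morphism of sheaves of modules from its components. -/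
def homOfApp {E F : X.Modules} (φ : ∀ U : X.Opens, Γ(E, U) →+ Γ(F, U))
    (hres : ∀ (U V : X.Opens) (h : V ≤ U) e, φ V (res E h e) = res F h (φ U e))
    (hsmul : ∀ (U : X.Opens) (a : Γ(X, U)) e, φ U (a • e) = a • φ U e) : E ⟶ F :=
  ⟨PresheafOfModules.homMk
    { app := fun U => AddCommGrpCat.ofHom (φ U.unop)
      naturality := fun U V i => by
        ext e
        exact hres U.unop V.unop i.unop.le e }
    (fun U a e => hsmul U.unop a e)⟩

lemma homOfApp_app {E F : X.Modules} (φ : ∀ U : X.Opens, Γ(E, U) →+ Γ(F, U))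
    (hres : ∀ (U V : X.Opens) (h : V ≤ U) e, φ V (res E h e) = res F h (φ U e))
    (hsmul : ∀ (U : X.Opens) (a : Γ(X, U)) e, φ U (a • e) = a • φ U e) (U : X.Opens) (e : Γ(E, U)) :
    (homOfApp φ hres hsmul).app U e = φ U e := rfl

lemma app_res {E F : X.Modules} (φ : E ⟶ F) {U V : X.Opens} (h : V ≤ U) (e : Γ(E, U)) :
    φ.app V (res E h e) = res F h (φ.app U e) :=
  CategoryTheory.congr_fun (φ.mapPresheaf.naturality (homOfLE h).op) e

/-! ### Presheaves of modules and their associated sheaves -/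

/-- A presheaf of modules over the structure sheaf of a scheme, in elementary terms. -/
structure PreMod (X : Scheme.{u}) where
  /-- the sections -/
  obj : X.Opens → Type u
  [grp : ∀ U, AddCommGroup (obj U)]
  [mod : ∀ U, Module Γ(X, U) (obj U)]
  /-- the restriction maps -/
  res : ∀ {U V : X.Opens}, V ≤ U → (obj U →+ obj V)
  res_self : ∀ {U : X.Opens} (h : U ≤ U) x, res h x = x
  res_res : ∀ {U V W : X.Opens} (h : V ≤ U) (h' : W ≤ V) x, res h' (res h x) = res (h'.trans h) x
  res_smul : ∀ {U V : X.Opens} (h : V ≤ U) (a : Γ(X, U)) x,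
    res h (a • x) = X.presheaf.map (homOfLE h).op a • res h x

attribute [instance] PreMod.grp PreMod.mod

/-- The underlying presheaf of abelian groups. -/
def PreMod.ab (P : PreMod X) : TopCat.Presheaf Ab X where
  obj U := AddCommGrpCat.of (P.obj U.unop)
  map i := AddCommGrpCat.ofHom (P.res i.unop.le)
  map_id U := by ext x; exact P.res_self _ x
  map_comp i j := by ext x; exact (P.res_res _ _ x).symm

instance (P : PreMod X) (U : X.Opensᵒᵖ) : Module (X.ringCatSheaf.obj.obj U) (P.ab.obj U) :=
  P.mod U.unop

/-- The associated object of Mathlib's category of presheaves of modules. -/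
def PreMod.presheafOfModules (P : PreMod X) : X.PresheafOfModules :=
  PresheafOfModules.ofPresheaf P.ab (fun _ _ i a x => P.res_smul i.unop.le a x)

/-- The sheaf of modules associated with a presheaf of modules. -/
def PreMod.sheaf (P : PreMod X) : X.Modules :=
  (PresheafOfModules.sheafification (𝟙 X.ringCatSheaf.obj)).obj P.presheafOfModules

/-- The canonical map from a presheaf to its associated sheaf. -/
def PreMod.toSheaf (P : PreMod X) (U : X.Opens) : P.obj U →ₗ[Γ(X, U)] Γ(P.sheaf, U) :=
  (((PresheafOfModules.sheafificationAdjunction (𝟙 X.ringCatSheaf.obj)).unit.app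
    P.presheafOfModules).app (op U)).hom

lemma PreMod.toSheaf_res (P : PreMod X) {U V : X.Opens} (h : V ≤ U) (x : P.obj U) :
    P.toSheaf V (P.res h x) = DConn.res P.sheaf h (P.toSheaf U x) :=
  PresheafOfModules.naturality_apply
    ((PresheafOfModules.sheafificationAdjunction (𝟙 X.ringCatSheaf.obj)).unit.app
    P.presheafOfModules) (homOfLE h).op x

/-- Morphisms from the associated sheaf to a sheaf, by the universal property. -/
def PreMod.lift (P : PreMod X) (F : X.Modules) (φ : ∀ U : X.Opens, P.obj U →+ Γ(F, U))
    (hres : ∀ (U V : X.Opens) (h : V ≤ U) x, φ V (P.res h x) = DConn.res F h (φ U x))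
    (hsmul : ∀ (U : X.Opens) (a : Γ(X, U)) x, φ U (a • x) = a • φ U x) : P.sheaf ⟶ F :=
  ((PresheafOfModules.sheafificationAdjunction (𝟙 X.ringCatSheaf.obj)).homEquiv
    P.presheafOfModules F).symm (PresheafOfModules.homMk
    { app := fun U => AddCommGrpCat.ofHom (φ U.unop)
      naturality := fun U V i => by
        ext e
        exact hres U.unop V.unop i.unop.le e }
    (fun U a e => hsmul U.unop a e))

lemma PreMod.lift_toSheaf (P : PreMod X) (F : X.Modules) (φ : ∀ U : X.Opens, P.obj U →+ Γ(F, U))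
    (hres : ∀ (U V : X.Opens) (h : V ≤ U) x, φ V (P.res h x) = DConn.res F h (φ U x))
    (hsmul : ∀ (U : X.Opens) (a : Γ(X, U)) x, φ U (a • x) = a • φ U x) (U : X.Opens) (x : P.obj U) :
    (P.lift F φ hres hsmul).app U (P.toSheaf U x) = φ U x := by
  let ψ : P.presheafOfModules ⟶ (PresheafOfModules.restrictScalars (𝟙 X.ringCatSheaf.obj)).obj
      ((SheafOfModules.forget _).obj F) := PresheafOfModules.homMk
    { app := fun U => AddCommGrpCat.ofHom (φ U.unop)
      naturality := fun U V i => by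
        ext e
        exact hres U.unop V.unop i.unop.le e }
    (fun U a e => hsmul U.unop a e)
  have := ((PresheafOfModules.sheafificationAdjunction (𝟙 X.ringCatSheaf.obj)).homEquiv
    P.presheafOfModules F).apply_symm_apply ψ
  have h2 := ((PresheafOfModules.sheafificationAdjunction
    (𝟙 X.ringCatSheaf.obj)).homEquiv_unit (f := P.lift F φ hres hsmul)).symm.trans this
  exact CategoryTheory.congr_fun (congrArg (fun α => PresheafOfModules.Hom.app α (op U)) h2) x

end Sections

/-! ### Differential operators and vector fields -/

section DiffOps

variable (K : Type u) [Field K] (X : Scheme.{u}) [X.Over (Spec (CommRingCat.of K))]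

/-- Families of `K`-linear endomorphisms of `O_X(V)`, for all open `V ⊆ U`. -/
abbrev OpFam (U : X.Opens) : Type u :=
  ∀ V : {V : X.Opens // V ≤ U}, Module.End K Γ(X, V.1)

variable {K X}

/-- Restriction of a family of endomorphisms to a smaller open subset. -/
def OpFam.restrict {U U' : X.Opens} (h : U' ≤ U) : OpFam K X U →+* OpFam K X U' where
  toFun P V := P ⟨V.1, V.2.trans h⟩
  map_one' := rfl
  map_mul' _ _ := rfl
  map_zero' := rfl
  map_add' _ _ := rfl

/-- Multiplication by a function. -/
def OpFam.ofFun {U : X.Opens} : Γ(X, U) →+* OpFam K X U where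
  toFun a V := LinearMap.mulLeft K (resO K V.2 a)
  map_one' := by ext V b; simp
  map_mul' a b := by ext V c; simp
  map_zero' := by ext V b; simp
  map_add' a b := by ext V c; simp [add_mul]

/-- Compatibility with restriction: the family is an endomorphism of the sheaf `O_U`. -/
def OpFam.Compatible {U : X.Opens} (P : OpFam K X U) : Prop :=
  ∀ (V W : X.Opens) (hV : V ≤ U) (h : W ≤ V) (a : Γ(X, V)),
    resO K h (P ⟨V, hV⟩ a) = P ⟨W, h.trans hV⟩ (resO K h a)

/-- Differential operators of order `< n`: only `0` is of order `< 0`, and `P` is of order `< n + 1`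
if all the commutators of `P` with functions (on smaller open subsets) are of order `< n`. -/
def OpFam.OrderLT : ℕ → ∀ {U : X.Opens}, OpFam K X U → Prop
  | 0, _, P => P = 0
  | n + 1, U, P => ∀ (V : X.Opens) (h : V ≤ U) (a : Γ(X, V)),
      OpFam.OrderLT n
        (OpFam.restrict h P * OpFam.ofFun a - OpFam.ofFun a * OpFam.restrict h P)

lemma OpFam.OrderLT.zero (n : ℕ) (U : X.Opens) : OpFam.OrderLT n (0 : OpFam K X U) := by
  induction n generalizing U with
  | zero => rfl
  | succ n ih => intro V h a; simpa using ih V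

lemma OpFam.OrderLT.restrict {n : ℕ} {U V : X.Opens} (h : V ≤ U) {P : OpFam K X U}
    (hP : OpFam.OrderLT n P) : OpFam.OrderLT n (OpFam.restrict h P) := by
  cases n with
  | zero => exact (congrArg _ hP).trans (map_zero _)
  | succ n => exact fun W hW a => hP W (hW.trans h) a

lemma OpFam.OrderLT.succ {n : ℕ} {U : X.Opens} {P : OpFam K X U}
    (hP : OpFam.OrderLT n P) : OpFam.OrderLT (n + 1) P := by
  induction n generalizing U with
  | zero =>
    rw [show P = 0 from hP]
    exact OpFam.OrderLT.zero _ _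
  | succ n ih => exact fun V h a => ih (hP V h a)

lemma OpFam.OrderLT.mono {n m : ℕ} (hnm : n ≤ m) {U : X.Opens} {P : OpFam K X U}
    (hP : OpFam.OrderLT n P) : OpFam.OrderLT m P := by
  induction hnm with
  | refl => exact hP
  | step _ ih => exact ih.succ

lemma OpFam.OrderLT.add {n : ℕ} {U : X.Opens} {P Q : OpFam K X U}
    (hP : OpFam.OrderLT n P) (hQ : OpFam.OrderLT n Q) : OpFam.OrderLT n (P + Q) := by
  induction n generalizing U with
  | zero => rw [show P = 0 from hP, show Q = 0 from hQ]; exact add_zero _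
  | succ n ih =>
    intro V h a
    have := ih (hP V h a) (hQ V h a)
    rw [map_add]
    convert! this using 1
    noncomm_ring

lemma OpFam.OrderLT.mul {m n : ℕ} {U : X.Opens} {P Q : OpFam K X U}
    (hP : OpFam.OrderLT m P) (hQ : OpFam.OrderLT n Q) : OpFam.OrderLT (m + n) (P * Q) := by
  induction hk : m + n generalizing m n U with
  | zero =>
    obtain rfl : m = 0 := by omega
    rw [show P = 0 from hP]; exact zero_mul _
  | succ k ih =>
    cases m with
    | zero => rw [show P = 0 from hP, zero_mul]; exact OpFam.OrderLT.zero _ _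
    | succ m =>
      cases n with
      | zero => rw [show Q = 0 from hQ, mul_zero]; exact OpFam.OrderLT.zero _ _
      | succ n =>
        intro V h a
        have h1 := ih (hP.restrict h) (hQ V h a) (by omega)
        have h2 := ih (hP V h a) (hQ.restrict h) (by omega)
        rw [map_mul]
        convert! h1.add h2 using 1
        simp only [mul_sub, sub_mul, mul_assoc]
        abel

lemma OpFam.orderLT_ofFun {U : X.Opens} (a : Γ(X, U)) :
    OpFam.OrderLT 1 (OpFam.ofFun a : OpFam K X U) := by
  intro V h b
  change _ = _
  ext W c
  simp [OpFam.restrict, OpFam.ofFun, mul_left_comm]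

variable (K) in
/-- The ring `D_X(U)` of differential operators on `U`: the `K`-linear endomorphisms of the sheaf
`O_U` that are locally of finite order. -/
def D (U : X.Opens) : Subring (OpFam K X U) where
  carrier := {P | P.Compatible ∧ ∀ x ∈ U, ∃ (V : X.Opens) (h : V ≤ U), x ∈ V ∧
    ∃ n, OpFam.OrderLT n (OpFam.restrict h P)}
  zero_mem' := ⟨fun V W hV h a => map_zero _,
    fun x hx => ⟨U, le_rfl, hx, 0, map_zero _⟩⟩
  one_mem' := ⟨fun V W hV h a => rfl,
    fun x hx => ⟨U, le_rfl, hx, 1, by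
      have h1 := OpFam.orderLT_ofFun (K := K) (1 : Γ(X, U))
      rwa [map_one] at h1 ⊢⟩⟩
  add_mem' := by
    rintro P Q ⟨hP, hP'⟩ ⟨hQ, hQ'⟩
    refine ⟨fun V W hV h a => ?_, fun x hx => ?_⟩
    · simp only [Pi.add_apply, LinearMap.add_apply, map_add, hP V W hV h a, hQ V W hV h a]
    · obtain ⟨V, hV, hxV, m, hm⟩ := hP' x hx
      obtain ⟨W, hW, hxW, n, hn⟩ := hQ' x hx
      refine ⟨V ⊓ W, inf_le_left.trans hV, ⟨hxV, hxW⟩, max m n, ?_⟩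
      rw [map_add]
      exact ((hm.restrict inf_le_left).mono (le_max_left _ _)).add
        ((hn.restrict inf_le_right).mono (le_max_right _ _))
  neg_mem' := by
    rintro P ⟨hP, hP'⟩
    refine ⟨fun V W hV h a => ?_, fun x hx => ?_⟩
    · simp only [Pi.neg_apply, LinearMap.neg_apply, map_neg, hP V W hV h a]
    · obtain ⟨V, hV, hxV, m, hm⟩ := hP' x hx
      refine ⟨V, hV, hxV, 1 + m, ?_⟩
      have key : OpFam.restrict hV (-P) = OpFam.ofFun (-1 : Γ(X, V)) * OpFam.restrict hV P := by
        ext W c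
        change -(P ⟨W.1, W.2.trans hV⟩ c) =
          resO K W.2 (-1 : Γ(X, V)) * P ⟨W.1, W.2.trans hV⟩ c
        rw [map_neg, map_one, neg_one_mul]
      rw [key]
      exact (OpFam.orderLT_ofFun _).mul hm
  mul_mem' := by
    rintro P Q ⟨hP, hP'⟩ ⟨hQ, hQ'⟩
    refine ⟨fun V W hV h a => ?_, fun x hx => ?_⟩
    · simp only [Pi.mul_apply, Module.End.mul_apply, hP V W hV h _, hQ V W hV h a]
    · obtain ⟨V, hV, hxV, m, hm⟩ := hP' x hx
      obtain ⟨W, hW, hxW, n, hn⟩ := hQ' x hx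
      refine ⟨V ⊓ W, inf_le_left.trans hV, ⟨hxV, hxW⟩, m + n, ?_⟩
      rw [map_mul]
      exact (hm.restrict (V := V ⊓ W) inf_le_left).mul (hn.restrict (V := V ⊓ W) inf_le_right)

/-- Restriction of differential operators. -/
def D.res {U V : X.Opens} (h : V ≤ U) : D K U →+* D K V :=
  ((OpFam.restrict h).comp (D K U).subtype).codRestrict (D K V) (by
    rintro ⟨P, hP, hP'⟩
    refine ⟨fun W W' hW h' a => hP W W' (hW.trans h) h' a, fun x hx => ?_⟩
    obtain ⟨W, hW, hxW, n, hn⟩ := hP' x (h hx)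
    exact ⟨W ⊓ V, inf_le_right, ⟨hxW, hx⟩, n, hn.restrict (V := W ⊓ V) inf_le_left⟩)

/-- Functions as differential operators of order zero. -/
def D.ofFun {U : X.Opens} : Γ(X, U) →+* D K U :=
  OpFam.ofFun.codRestrict (D K U) (by
    intro a
    refine ⟨fun V W hV h b => ?_, fun x hx => ⟨U, le_rfl, hx, 1, ?_⟩⟩
    · simp [OpFam.ofFun, resO_resO]
    · exact (OpFam.orderLT_ofFun a).restrict le_rfl)

lemma D.res_ofFun_mul {U V : X.Opens} (h : V ≤ U) (a : Γ(X, U)) (P : D K U) :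
    D.res h (D.ofFun a * P) = D.ofFun (resO K h a) * D.res h P := by
  apply Subtype.ext
  ext W b
  change resO K _ a * _ = resO K _ (resO K h a) * _
  rw [resO_resO]
  rfl

lemma D.res_ofFun {U V : X.Opens} (h : V ≤ U) (a : Γ(X, U)) :
    D.res h (D.ofFun a : D K U) = D.ofFun (resO K h a) := by
  apply Subtype.ext
  ext W b
  change resO K _ a * b = resO K _ (resO K h a) * b
  rw [resO_resO]

variable (K) in
/-- Sections over `U` of the sheaf of derivations: families of `K`-derivations of `O_X(V)`, for all
open `V ⊆ U`, compatible with restriction. -/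
@[ext]
structure VectorField (U : X.Opens) where
  /-- the derivation of `O_X(V)` -/
  der : ∀ V : X.Opens, V ≤ U → Derivation K Γ(X, V) Γ(X, V)
  compat : ∀ (V W : X.Opens) (hV : V ≤ U) (h : W ≤ V) (a : Γ(X, V)),
    resO K h (der V hV a) = der W (h.trans hV) (resO K h a)

/-- The Lie bracket of derivations. -/
def VectorField.bracket {U : X.Opens} (d d' : VectorField K U) : VectorField K U where
  der V hV := ⁅d.der V hV, d'.der V hV⁆
  compat V W hV h a := by
    simp only [Derivation.commutator_apply, map_sub, d.compat V W hV h, d'.compat V W hV h]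

/-- Restriction of derivations. -/
def VectorField.res {U V : X.Opens} (h : V ≤ U) (d : VectorField K U) : VectorField K V where
  der W hW := d.der W (hW.trans h)
  compat W W' hW h' a := d.compat W W' (hW.trans h) h' a

/-- The function `∂(a)`. -/
def VectorField.apply {U : X.Opens} (d : VectorField K U) (a : Γ(X, U)) : Γ(X, U) :=
  d.der U le_rfl a

/-- Derivations as differential operators. -/
def VectorField.toD {U : X.Opens} (d : VectorField K U) : D K U :=
  ⟨fun V => (d.der V.1 V.2).toLinearMap, fun V W hV h a => d.compat V W hV h a,
    fun x hx => ⟨U, le_rfl, hx, 2, by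
      intro V hV a
      convert! OpFam.orderLT_ofFun (K := K) (d.der V hV a) using 1
      ext W b
      have := d.compat V W.1 hV W.2 a
      simp [OpFam.restrict, OpFam.ofFun, this, mul_comm]⟩⟩

end DiffOps

/-! ### The sheaf of differential operators -/

section DSheaf

variable (K : Type u) [Field K] (X : Scheme.{u}) [X.Over (Spec (CommRingCat.of K))]

/-- The presheaf of abelian groups underlying `D_X`. -/
def DAb : TopCat.Presheaf Ab X where
  obj U := AddCommGrpCat.of (D (X := X) K U.unop)
  map i := AddCommGrpCat.ofHom (D.res i.unop.le).toAddMonoidHom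

lemma DAb_isSheaf : (DAb K X).IsSheaf := by
  rw [TopCat.Presheaf.isSheaf_iff_isSheafUniqueGluing]
  intro ι U sf hsf
  change ∀ i, D (X := X) K (U i) at sf
  -- the members of the family agree on the opens on which two of them are defined
  have hcompat : ∀ i j (V : X.Opens) (hi : V ≤ U i) (hj : V ≤ U j),
      (sf i).1 ⟨V, hi⟩ = (sf j).1 ⟨V, hj⟩ := by
    intro i j V hi hj
    have h1 := congrArg (fun P : D (X := X) K (U i ⊓ U j) => P.1 ⟨V, le_inf hi hj⟩) (hsf i j)
    exact h1
  -- a function is determined by its restrictions to the `V ⊓ U i`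
  have hloc : ∀ (V : X.Opens) (hV : V ≤ iSup U) (b b' : Γ(X, V)),
      (∀ i, resO K (inf_le_left : V ⊓ U i ≤ V) b = resO K inf_le_left b') → b = b' := by
    intro V hV b b' h
    refine TopCat.Sheaf.eq_of_locally_eq' X.sheaf (fun i => V ⊓ U i) V
      (fun i => homOfLE inf_le_left) ?_ b b' h
    rw [← inf_iSup_eq]
    exact le_inf le_rfl hV
  -- gluing the values
  have hglue : ∀ (V : X.Opens) (hV : V ≤ iSup U) (a : Γ(X, V)), ∃ b : Γ(X, V),
      ∀ i, resO K (inf_le_left : V ⊓ U i ≤ V) b =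
        (sf i).1 ⟨V ⊓ U i, inf_le_right⟩ (resO K inf_le_left a) := by
    intro V hV a
    have := TopCat.Sheaf.existsUnique_gluing' X.sheaf (fun i => V ⊓ U i) V
      (fun i => homOfLE inf_le_left) (by
        rw [← inf_iSup_eq]
        exact le_inf le_rfl hV)
      (fun i => (sf i).1 ⟨V ⊓ U i, inf_le_right⟩ (resO K inf_le_left a)) (by
        intro i j
        change resO K (inf_le_left : (V ⊓ U i) ⊓ (V ⊓ U j) ≤ V ⊓ U i)
            ((sf i).1 ⟨V ⊓ U i, inf_le_right⟩ (resO K inf_le_left a)) =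
          resO K (inf_le_right : (V ⊓ U i) ⊓ (V ⊓ U j) ≤ V ⊓ U j)
            ((sf j).1 ⟨V ⊓ U j, inf_le_right⟩ (resO K inf_le_left a))
        rw [(sf i).2.1 _ _ _ inf_le_left, (sf j).2.1 _ _ _ inf_le_right, resO_resO, resO_resO,
          hcompat i j])
    exact this.exists
  choose g hg using hglue
  let P : OpFam K X (iSup U) := fun V =>
    { toFun := g V.1 V.2
      map_add' := fun a b => hloc V.1 V.2 _ _ fun i => by
        rw [map_add, hg, hg, hg, map_add, map_add]
      map_smul' := fun c a => hloc V.1 V.2 _ _ fun i => by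
        change resO K _ (g V.1 V.2 (c • a)) = resO K _ (c • g V.1 V.2 a)
        rw [hg, map_smul, map_smul, map_smul, hg] }
  have hP : ∀ i (V : X.Opens) (hV : V ≤ iSup U) (hi : V ≤ U i), P ⟨V, hV⟩ = (sf i).1 ⟨V, hi⟩ := by
    intro i V hV hi
    ext a
    refine hloc V hV _ _ fun j => ?_
    change resO K inf_le_left (g V hV a) = _
    rw [hg, (sf i).2.1 V _ hi inf_le_left, hcompat i j]
  have hPD : P ∈ D (X := X) K (iSup U) := by
    refine ⟨fun V W hV h a => hloc W (h.trans hV) _ _ fun i => ?_, fun x hx => ?_⟩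
    · change resO K _ (resO K _ (g V hV a)) = resO K _ (g W _ (resO K h a))
      have h2 : W ⊓ U i ≤ V ⊓ U i := inf_le_inf_right _ h
      rw [hg, resO_resO, resO_resO, ← resO_resO (inf_le_left : V ⊓ U i ≤ V) h2, hg,
        (sf i).2.1 _ _ _ h2, resO_resO]
    · obtain ⟨i, hi⟩ := Opens.mem_iSup.mp hx
      obtain ⟨V, hV, hxV, n, hn⟩ := (sf i).2.2 x hi
      refine ⟨V, hV.trans (le_iSup U i), hxV, n, ?_⟩
      convert! hn using 1
      funext W
      exact hP i W.1 _ _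
  refine ⟨⟨P, hPD⟩, fun i => ?_, ?_⟩
  · apply Subtype.ext
    funext V
    exact hP i V.1 _ V.2
  · intro Q hQ
    apply Subtype.ext
    funext V
    ext a
    change D (X := X) K (iSup U) at Q
    refine hloc V.1 V.2 _ _ fun i => ?_
    change resO K _ (Q.1 V a) = resO K _ (g V.1 V.2 a)
    have h3 := congrArg (fun R : D (X := X) K (U i) => R.1 ⟨V.1 ⊓ U i, inf_le_right⟩) (hQ i)
    change Q.1 ⟨V.1 ⊓ U i, _⟩ = (sf i).1 ⟨V.1 ⊓ U i, inf_le_right⟩ at h3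
    rw [hg, ← h3]
    exact Q.2.1 V.1 _ V.2 _ a

instance (U : X.Opensᵒᵖ) : Module (X.ringCatSheaf.obj.obj U) ((DAb K X).obj U) :=
  Module.compHom (D (X := X) K U.unop) (D.ofFun : Γ(X, U.unop) →+* D K U.unop)

/-- The sheaf `D_X`, as an `O_X`-module through multiplication on the left. -/
def DMod : X.Modules where
  val := PresheafOfModules.ofPresheaf (DAb K X)
    (fun U V i a P => D.res_ofFun_mul (U := U.unop) (V := V.unop) i.unop.le a P)
  isSheaf := DAb_isSheaf K X

end DSheaf

section Pullback
variable {X Y : Scheme.{u}} (f : X ⟶ Y)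

/-- The map `E(V) → (f^*E)(f⁻¹(V))`, `e ↦ 1 ⊗ e`. -/
def pull (E : Y.Modules) (V : Y.Opens) : Γ(E, V) →+ Γ((Scheme.Modules.pullback f).obj E, f ⁻¹ᵁ V) :=
  (((Scheme.Modules.pullbackPushforwardAdjunction f).unit.app E).app V).hom

/-- The section `α ⊗ e` of `f^*E = O_X ⊗_{f⁻¹O_Y} f⁻¹E` over `U`, for `α ∈ O_X(U)`, `e ∈ E(V)` and
`U ⊆ f⁻¹(V)`. -/
def tmul (E : Y.Modules) {U : X.Opens} {V : Y.Opens} (h : U ≤ f ⁻¹ᵁ V) (a : Γ(X, U)) (e : Γ(E, V)) :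
    Γ((Scheme.Modules.pullback f).obj E, U) :=
  a • res _ h (pull f E V e)

/-- The morphism `f^*E → F` corresponding to a morphism `E → f_*F`. -/
def pullLift {E : Y.Modules} {F : X.Modules} (φ : E ⟶ (Scheme.Modules.pushforward f).obj F) :
    (Scheme.Modules.pullback f).obj E ⟶ F :=
  ((Scheme.Modules.pullbackPushforwardAdjunction f).homEquiv E F).symm φ

/-- The extension `j_* j^* E` for the inclusion `j : W → X` of an open subset; its sections over `U`
are the sections of `E` over `U ∩ W`. -/
def openExt (E : X.Modules) (W : X.Opens) : X.Modules :=
  (Scheme.Modules.pushforward W.ι).obj ((Scheme.Modules.restrictFunctor W.ι).obj E)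

/-- `U ∩ W`, in the form that appears in `j_* j^*`. -/
abbrev cap (W U : X.Opens) : X.Opens := W.ι ''ᵁ W.ι ⁻¹ᵁ U

lemma cap_le_left (W U : X.Opens) : cap W U ≤ W := Scheme.Opens.ι_image_le _ _

lemma cap_le_right (W U : X.Opens) : cap W U ≤ U := Set.image_preimage_subset _ _

lemma cap_mono (W : X.Opens) {U V : X.Opens} (h : V ≤ U) : cap W V ≤ cap W U :=
  Set.image_mono (fun _ hx => h hx)

lemma le_cap {W U V : X.Opens} (h : V ≤ W) (h' : V ≤ U) : V ≤ cap W U :=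
  fun x hx => ⟨⟨x, h hx⟩, h' hx, rfl⟩

/-- Sections of `j_* j^* E` over `U` as sections of `E` over `U ∩ W`. -/
def openExtSections (E : X.Modules) (W U : X.Opens) : Γ(openExt E W, U) ≃+ Γ(E, cap W U) :=
  AddEquiv.refl _

lemma openExtSections_res (E : X.Modules) (W : X.Opens) {U V : X.Opens} (h : V ≤ U)
    (e : Γ(openExt E W, U)) : openExtSections E W V (res (openExt E W) h e) =
      res E (cap_mono W h) (openExtSections E W U e) := rfl

lemma openExtSections_smul (K : Type u) [Field K] [X.Over (Spec (CommRingCat.of K))] (E : X.Modules)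
    (W : X.Opens) {U : X.Opens} (a : Γ(X, U)) (e : Γ(openExt E W, U)) :
    openExtSections E W U (a • e) = resO K (cap_le_right W U) a • openExtSections E W U e := by
  change (W.ι.appIso _).inv (W.ι.app U a) • openExtSections E W U e = _
  rw [Scheme.Opens.ι_app, Scheme.Opens.ι_appIso]
  rfl

lemma pull_smul (E : Y.Modules) (V : Y.Opens) (a : Γ(Y, V)) (e : Γ(E, V)) :
    pull f E V (a • e) = (f.app V a) • pull f E V e :=
  Scheme.Modules.Hom.app_smul ((Scheme.Modules.pullbackPushforwardAdjunction f).unit.app E) a e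

lemma pull_res (E : Y.Modules) {V W : Y.Opens} (h : W ≤ V) (e : Γ(E, V)) :
    pull f E W (res E h e) =
      res ((Scheme.Modules.pullback f).obj E) (U := f ⁻¹ᵁ V) (V := f ⁻¹ᵁ W) (fun _ hx => h hx)
        (pull f E V e) :=
  app_res ((Scheme.Modules.pullbackPushforwardAdjunction f).unit.app E) h e

lemma pullLift_pull {E : Y.Modules} {F : X.Modules}
    (φ : E ⟶ (Scheme.Modules.pushforward f).obj F) (V : Y.Opens) (e : Γ(E, V)) :
    (pullLift f φ).app (f ⁻¹ᵁ V) (pull f E V e) = φ.app V e := by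
  have h1 := ((Scheme.Modules.pullbackPushforwardAdjunction f).homEquiv E F).apply_symm_apply φ
  rw [Adjunction.homEquiv_unit] at h1
  exact CategoryTheory.congr_fun (congrArg (fun α => Scheme.Modules.Hom.app α V) h1) e

end Pullback

/-! ### The sheaves `Ω¹ ⊗ E` and `P¹ ⊗ E` -/

section Connections

variable (K : Type u) [Field K] {X Y : Scheme.{u}} [X.Over (Spec (CommRingCat.of K))]
  [Y.Over (Spec (CommRingCat.of K))]

/-- The presheaf `U ↦ Ω_{O_X(U)/K} ⊗_{O_X(U)} E(U)`. -/
def omegaPre (E : X.Modules) : PreMod X where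
  obj U := Ω[Γ(X, U)⁄K] ⊗[Γ(X, U)] Γ(E, U)
  res h := kaehlerTensorMap (resO K h) (res E h) (res_smul E h)
  res_self h x := by
    induction x using TensorProduct.induction_on with
    | zero => simp
    | tmul w e => rw [kaehlerTensorMap_tmul, resO_self, kaehlerMap_id, res_self]
    | add x y hx hy => rw [map_add, hx, hy]
  res_res h h' x := by
    induction x using TensorProduct.induction_on with
    | zero => simp
    | tmul w e =>
      simp only [kaehlerTensorMap_tmul, res_res, kaehlerMap_comp]
      congr 2
      exact congrArg _ (AlgHom.ext fun a => resO_resO h h' a)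
    | add x y hx hy => simp only [map_add, hx, hy]
  res_smul h a x := kaehlerTensorMap_smul _ _ _ a x

/-- The presheaf `U ↦ P¹_{O_X(U)/K} ⊗_{O_X(U)} E(U)` (tensor product for the right structure of
`P¹`), with its left `O_X`-module structure. -/
def partsPre (E : X.Modules) : PreMod X where
  obj U := PPT K Γ(X, U) Γ(E, U)
  res h := PPT.map (resO K h) (res E h) (res_smul E h)
  res_self h x := by
    induction x using PPT.induction with
    | htmul w e => rw [PPT.map_tmul, resO_self, PP.map_id, res_self]
    | hadd x y hx hy => rw [map_add, hx, hy]
  res_res h h' x := by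
    induction x using PPT.induction with
    | htmul w e =>
      simp only [PPT.map_tmul, res_res, PP.map_comp]
      congr 2
      exact congrArg _ (AlgHom.ext fun a => resO_resO h h' a)
    | hadd x y hx hy => simp only [map_add, hx, hy]
  res_smul h a x := PPT.map_smul _ _ _ a x

/-- The sheaf `Ω¹_X ⊗ E`. -/
def Omega (E : X.Modules) : X.Modules := (omegaPre K E).sheaf

/-- The sheaf `P¹_X ⊗ E`. -/
def Parts (E : X.Modules) : X.Modules := (partsPre K E).sheaf

variable {K}

/-- The section `ω ⊗ e` of `Ω¹_X ⊗ E`. -/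
def omegaTmul {E : X.Modules} {U : X.Opens} (w : Ω[Γ(X, U)⁄K]) (e : Γ(E, U)) :
    Γ(Omega K E, U) :=
  (omegaPre K E).toSheaf U (w ⊗ₜ[Γ(X, U)] e)

/-- The section `da ⊗ e` of `Ω¹_X ⊗ E`. -/
def dTmul {E : X.Modules} {U : X.Opens} (a : Γ(X, U)) (e : Γ(E, U)) : Γ(Omega K E, U) :=
  omegaTmul (KaehlerDifferential.D K Γ(X, U) a) e

/-- The section `p ⊗ e` of `P¹_X ⊗ E`. -/
def partsTmul {E : X.Modules} {U : X.Opens} (p : PP K Γ(X, U)) (e : Γ(E, U)) :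
    Γ(Parts K E, U) :=
  (partsPre K E).toSheaf U (PPT.tmul p e)

lemma omegaTmul_res {E : X.Modules} {U V : X.Opens} (h : V ≤ U) (w : Ω[Γ(X, U)⁄K]) (e : Γ(E, U)) :
    res (Omega K E) h (omegaTmul w e) = omegaTmul (kaehlerMap (resO K h) w) (res E h e) := by
  have h1 := (omegaPre K E).toSheaf_res h (w ⊗ₜ[Γ(X, U)] e)
  exact h1.symm.trans (congrArg _ (kaehlerTensorMap_tmul _ _ (res_smul E h) w e))

lemma partsTmul_res {E : X.Modules} {U V : X.Opens} (h : V ≤ U) (p : PP K Γ(X, U)) (e : Γ(E, U)) :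
    res (Parts K E) h (partsTmul p e) = partsTmul (PP.map (resO K h) p) (res E h e) := by
  have h1 := (partsPre K E).toSheaf_res h (PPT.tmul p e)
  exact h1.symm.trans (congrArg _ (PPT.map_tmul _ _ (res_smul E h) p e))

lemma kaehlerTensorMap_square {A B C R E F G H : Type u} [CommRing A] [CommRing B] [CommRing C]
    [CommRing R] [Algebra K A] [Algebra K B] [Algebra K C] [Algebra K R]
    [AddCommGroup E] [Module A E] [AddCommGroup F] [Module B F] [AddCommGroup G] [Module C G]
    [AddCommGroup H] [Module R H]
    (φ : A →ₐ[K] B) (ψ : B →ₐ[K] R) (φ' : A →ₐ[K] C) (ψ' : C →ₐ[K] R)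
    (g : E →+ F) (h : F →+ H) (hg : ∀ (a : A) e, g (a • e) = φ a • g e)
    (hh : ∀ (a : B) e, h (a • e) = ψ a • h e) {g' : E →+ G} {h' : G →+ H}
    (hg' : ∀ (a : A) e, g' (a • e) = φ' a • g' e) (hh' : ∀ (a : C) e, h' (a • e) = ψ' a • h' e)
    (hφ : ψ.comp φ = ψ'.comp φ') (hgh : ∀ e, h (g e) = h' (g' e)) (x : Ω[A⁄K] ⊗[A] E) :
    kaehlerTensorMap ψ h hh (kaehlerTensorMap φ g hg x) =
      kaehlerTensorMap ψ' h' hh' (kaehlerTensorMap φ' g' hg' x) := by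
  induction x using TensorProduct.induction_on with
  | zero => simp
  | tmul w e => simp only [kaehlerTensorMap_tmul, kaehlerMap_comp, hφ, hgh]
  | add x y hx hy => simp only [map_add, hx, hy]

lemma PPT.map_square {A B C R E F G H : Type u} [CommRing A] [CommRing B] [CommRing C]
    [CommRing R] [Algebra K A] [Algebra K B] [Algebra K C] [Algebra K R]
    [AddCommGroup E] [Module A E] [AddCommGroup F] [Module B F] [AddCommGroup G] [Module C G]
    [AddCommGroup H] [Module R H]
    (φ : A →ₐ[K] B) (ψ : B →ₐ[K] R) (φ' : A →ₐ[K] C) (ψ' : C →ₐ[K] R)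
    (g : E →+ F) (h : F →+ H) (hg : ∀ (a : A) e, g (a • e) = φ a • g e)
    (hh : ∀ (a : B) e, h (a • e) = ψ a • h e) {g' : E →+ G} {h' : G →+ H}
    (hg' : ∀ (a : A) e, g' (a • e) = φ' a • g' e) (hh' : ∀ (a : C) e, h' (a • e) = ψ' a • h' e)
    (hφ : ψ.comp φ = ψ'.comp φ') (hgh : ∀ e, h (g e) = h' (g' e)) (x : PPT K A E) :
    PPT.map ψ h hh (PPT.map φ g hg x) = PPT.map ψ' h' hh' (PPT.map φ' g' hg' x) := by
  induction x using PPT.induction with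
  | htmul w e => simp only [PPT.map_tmul, PP.map_comp, hφ, hgh]
  | hadd x y hx hy => simp only [map_add, hx, hy]

lemma PPT.map_ofKaehler {A B E F : Type u} [CommRing A] [CommRing B] [Algebra K A] [Algebra K B]
    [AddCommGroup E] [Module A E] [AddCommGroup F] [Module B F]
    (φ : A →ₐ[K] B) (g : E →+ F) (hg : ∀ (a : A) e, g (a • e) = φ a • g e) (x : Ω[A⁄K] ⊗[A] E) :
    PPT.map φ g hg (PPT.ofKaehler x) = PPT.ofKaehler (kaehlerTensorMap φ g hg x) := by
  have key : ∀ w : Ω[A⁄K], PP.map φ (PP.ofKaehler w) = PP.ofKaehler (kaehlerMap φ w) := by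
    intro w
    induction w using kaehler_induction with
    | hd b => simp only [PP.ofKaehler_D, kaehlerMap_D, map_sub, PP.map_left, PP.map_right]
    | hadd x y hx hy => simp only [map_add, hx, hy]
    | hsmul a x hx => simp only [PP.ofKaehler_smul, kaehlerMap_smul, map_mul, PP.map_left, hx]
  induction x using TensorProduct.induction_on with
  | zero => simp
  | tmul w e => simp [key]
  | add x y hx hy => simp only [map_add, hx, hy]

variable (K) in
/-- The inclusion `Ω¹_X ⊗ E → P¹_X ⊗ E`, `da ⊗ e ↦ (a ⊗ 1 - 1 ⊗ a) ⊗ e`. -/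
def omegaToParts (E : X.Modules) : Omega K E ⟶ Parts K E :=
  (omegaPre K E).lift _
    (fun U => ((partsPre K E).toSheaf U).toAddMonoidHom.comp PPT.ofKaehler.toAddMonoidHom)
    (fun U V h x => by
      refine Eq.trans ?_ ((partsPre K E).toSheaf_res h (PPT.ofKaehler x))
      exact congrArg ((partsPre K E).toSheaf V) (PPT.map_ofKaehler _ _ (res_smul E h) x).symm)
    (fun U a x =>
      (congrArg ((partsPre K E).toSheaf U) (PPT.ofKaehler.map_smul a x)).trans
        (((partsPre K E).toSheaf U).map_smul a _))

lemma omegaToParts_omegaTmul {E : X.Modules} {U : X.Opens} (w : Ω[Γ(X, U)⁄K]) (e : Γ(E, U)) :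
    (omegaToParts K E).app U (omegaTmul w e) = partsTmul (PP.ofKaehler w) e := by
  refine ((omegaPre K E).lift_toSheaf _ _ _ _ U (w ⊗ₜ[Γ(X, U)] e)).trans ?_
  exact congrArg ((partsPre K E).toSheaf U) (PPT.ofKaehler_tmul w e)

/-- The canonical inclusion `c : E → P¹_X ⊗ E`, `e ↦ 1 ⊗ e` (which is linear for the right
structure). -/
def canon {E : X.Modules} {U : X.Opens} (e : Γ(E, U)) : Γ(Parts K E, U) := partsTmul 1 e

variable (K) in
/-- A connection `∇ : E → Ω¹_X ⊗ E`: a morphism of abelian sheaves satisfying the Leibniz rule. -/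
@[ext]
structure Connection (E : X.Modules) where
  /-- the morphism of abelian sheaves -/
  nabla : E.presheaf ⟶ (Omega K E).presheaf
  leibniz : ∀ (U : X.Opens) (a : Γ(X, U)) (e : Γ(E, U)),
    nabla.app (op U) (a • e) =
      a • (show Γ(Omega K E, U) from nabla.app (op U) e) + dTmul a e

/-- The section `∇(e)`. -/
def Connection.apply {E : X.Modules} (c : Connection K E) {U : X.Opens} :
    Γ(E, U) →+ Γ(Omega K E, U) :=
  (c.nabla.app (op U)).hom

lemma Connection.apply_smul {E : X.Modules} (c : Connection K E) {U : X.Opens} (a : Γ(X, U))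
    (e : Γ(E, U)) : c.apply (a • e) = a • c.apply e + dTmul a e := c.leibniz U a e

lemma Connection.apply_res {E : X.Modules} (c : Connection K E) {U V : X.Opens} (h : V ≤ U)
    (e : Γ(E, U)) : c.apply (res E h e) = res _ h (c.apply e) :=
  CategoryTheory.congr_fun (c.nabla.naturality (homOfLE h).op) e

/-- The `O_X`-linear map `δ = c + ∇ : E → P¹_X ⊗ E`. -/
def Connection.delta {E : X.Modules} (c : Connection K E) : E ⟶ Parts K E :=
  homOfApp
    (fun U => AddMonoidHom.mk' (fun e => canon e + (omegaToParts K E).app U (c.apply e))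
      (fun e e' => by
        have h1 : canon (K := K) (e + e') = canon e + canon e' :=
          (congrArg ((partsPre K E).toSheaf U) (PPT.tmul_add 1 e e')).trans (map_add _ _ _)
        rw [h1, map_add, map_add]
        abel))
    (fun U V h e => by
      have h1 : canon (K := K) (res E h e) = res _ h (canon e) := by
        rw [canon, canon, partsTmul_res, map_one]
      simp only [AddMonoidHom.mk'_apply]
      rw [h1, c.apply_res, app_res, map_add])
    (fun U a e => by
      have h1 : canon (K := K) (a • e) = partsTmul (PP.right K _ a) e := by
        refine congrArg ((partsPre K E).toSheaf U) ?_
        rw [PPT.tmul_smul, mul_one]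
      have h2 : a • canon (K := K) e = partsTmul (PP.left K _ a) e := by
        refine (((partsPre K E).toSheaf U).map_smul a _).symm.trans ?_
        refine congrArg ((partsPre K E).toSheaf U) ((PPT.smul_tmul' a 1 e).trans ?_)
        rw [mul_one]
      have h3 : (omegaToParts K E).app U (dTmul a e) =
          partsTmul (PP.left K _ a) e - partsTmul (PP.right K _ a) e := by
        rw [dTmul, omegaToParts_omegaTmul, PP.ofKaehler_D]
        exact (congrArg ((partsPre K E).toSheaf U) (PPT.sub_tmul _ _ e)).trans (map_sub _ _ _)
      simp only [AddMonoidHom.mk'_apply]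
      rw [h1, c.apply_smul, map_add, h3, smul_add, h2, Scheme.Modules.Hom.app_smul]
      abel)

lemma Connection.delta_app {E : X.Modules} (c : Connection K E) (U : X.Opens) (e : Γ(E, U)) :
    c.delta.app U e = canon e + (omegaToParts K E).app U (c.apply e) := rfl

lemma contractAlg_kaehlerTensorMap {A B E F : Type u} [CommRing A] [CommRing B] [Algebra K A]
    [Algebra K B] [AddCommGroup E] [Module A E] [AddCommGroup F] [Module B F]
    (φ : A →ₐ[K] B) (g : E →+ F) (hg : ∀ (a : A) e, g (a • e) = φ a • g e)
    (d : Derivation K A A) (d' : Derivation K B B) (hd : ∀ a, φ (d a) = d' (φ a))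
    (x : Ω[A⁄K] ⊗[A] E) :
    contractAlg d' (kaehlerTensorMap φ g hg x) = g (contractAlg d x) := by
  have key : ∀ w : Ω[A⁄K], d'.liftKaehlerDifferential (kaehlerMap φ w) =
      φ (d.liftKaehlerDifferential w) := by
    intro w
    induction w using kaehler_induction with
    | hd b => simp [kaehlerMap_D, hd]
    | hadd x y hx hy => simp only [map_add, hx, hy]
    | hsmul a x hx => simp [kaehlerMap_smul, hx]
  induction x using TensorProduct.induction_on with
  | zero => simp
  | tmul w e => simp [contractAlg, key, hg]
  | add x y hx hy => simp only [map_add, hx, hy]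

/-- The contraction `Ω_{O(U)/K} ⊗ E(U) → E(U ∩ W)` with a derivation on `W`. -/
def contractPre {W : X.Opens} (d : VectorField K W) (E : X.Modules) (U : X.Opens) :
    (omegaPre K E).obj U →+ Γ(openExt E W, U) :=
  (openExtSections E W U).symm.toAddMonoidHom.comp
    ((contractAlg (d.der (cap W U) (cap_le_left W U))).toAddMonoidHom.comp
      ((omegaPre K E).res (cap_le_right W U)))

lemma contractPre_res {W : X.Opens} (d : VectorField K W) (E : X.Modules) (U V : X.Opens)
    (h : V ≤ U) (x : (omegaPre K E).obj U) :
    contractPre d E V ((omegaPre K E).res h x) = res (openExt E W) h (contractPre d E U x) := by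
  apply (openExtSections E W V).injective
  rw [openExtSections_res]
  change contractAlg _ ((omegaPre K E).res _ ((omegaPre K E).res _ x)) =
    res E _ (contractAlg _ ((omegaPre K E).res _ x))
  rw [(omegaPre K E).res_res,
    ← (omegaPre K E).res_res (cap_le_right W U) (cap_mono W h)]
  exact contractAlg_kaehlerTensorMap (resO K (cap_mono W h))
    (res E (cap_mono W h)) (res_smul E (cap_mono W h)) _ _ (d.compat _ _ _ _) _

lemma contractPre_smul {W : X.Opens} (d : VectorField K W) (E : X.Modules) (U : X.Opens)
    (a : Γ(X, U)) (x : (omegaPre K E).obj U) :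
    contractPre d E U (a • x) = a • contractPre d E U x := by
  apply (openExtSections E W U).injective
  rw [openExtSections_smul K]
  change contractAlg _ ((omegaPre K E).res _ (a • x)) =
    _ • contractAlg _ ((omegaPre K E).res _ x)
  rw [(omegaPre K E).res_smul]
  exact map_smul _ _ _

/-- The contraction of sections of `Ω¹_X ⊗ E` on `U` with a derivation on `W`; the result is a
section of `E` on `U ∩ W`. -/
def contractExt {W : X.Opens} (d : VectorField K W) (E : X.Modules) : Omega K E ⟶ openExt E W :=
  (omegaPre K E).lift _ (contractPre d E) (contractPre_res d E) (contractPre_smul d E)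

/-- The contraction `⟨∂, s⟩`, for a derivation `∂` and a section `s` of `Ω¹_X ⊗ E` on `U`. -/
def contract {U : X.Opens} (d : VectorField K U) {E : X.Modules} (s : Γ(Omega K E, U)) : Γ(E, U) :=
  res E (le_cap le_rfl le_rfl) (openExtSections E U U ((contractExt d E).app U s))

lemma contract_omegaTmul {U : X.Opens} (d : VectorField K U) {E : X.Modules} (a b : Γ(X, U))
    (e : Γ(E, U)) : contract d (omegaTmul (b • KaehlerDifferential.D K Γ(X, U) a) e) =
      (b * d.apply a) • e := by
  have h0 : (contractExt d E).app U (omegaTmul (b • KaehlerDifferential.D K Γ(X, U) a) e) = _ :=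
    (omegaPre K E).lift_toSheaf (openExt E U) (contractPre d E) (contractPre_res d E)
      (contractPre_smul d E) U ((b • KaehlerDifferential.D K Γ(X, U) a) ⊗ₜ[Γ(X, U)] e)
  have h1 : contractPre d E U ((b • KaehlerDifferential.D K Γ(X, U) a) ⊗ₜ[Γ(X, U)] e) =
      (openExtSections E U U).symm (contractAlg (d.der (cap U U) (cap_le_left U U))
        (kaehlerMap (resO K (cap_le_right U U)) (b • KaehlerDifferential.D K Γ(X, U) a)
          ⊗ₜ[Γ(X, cap U U)] res E (cap_le_right U U) e)) :=
    congrArg (fun z => (openExtSections E U U).symm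
      (contractAlg (d.der (cap U U) (cap_le_left U U)) z))
      (kaehlerTensorMap_tmul _ _ (res_smul E (cap_le_right U U)) _ e)
  have h2 : contractAlg (d.der (cap U U) (cap_le_left U U))
      ((resO K (cap_le_right U U) b • KaehlerDifferential.D K _ (resO K (cap_le_right U U) a))
        ⊗ₜ[Γ(X, cap U U)] res E (cap_le_right U U) e) =
      (resO K (cap_le_right U U) b * resO K (cap_le_right U U) (d.apply a)) •
        res E (cap_le_right U U) e := by
    simp [contractAlg, VectorField.apply, d.compat, mul_smul]
  rw [kaehlerMap_smul, kaehlerMap_D, h2] at h1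
  rw [contract, h0, h1, AddEquiv.apply_symm_apply, ← map_mul, ← res_smul, res_res, res_self]

/-- The operator `Δ_∂ = ⟨∂, ∇(-)⟩`. -/
def Connection.along {E : X.Modules} (c : Connection K E) {U : X.Opens} (d : VectorField K U)
    (e : Γ(E, U)) : Γ(E, U) := contract d (c.apply e)

/-- Integrability: `∂ ↦ Δ_∂` is a homomorphism of Lie algebras, i.e. the curvature of `∇`
vanishes. -/
def Connection.Integrable {E : X.Modules} (c : Connection K E) : Prop :=
  ∀ (U : X.Opens) (d d' : VectorField K U) (e : Γ(E, U)),
    c.along (d.bracket d') e = c.along d (c.along d' e) - c.along d' (c.along d e)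

end Connections

/-! ### Inverse images -/

section InverseImage

variable {K : Type u} [Field K] {X Y : Scheme.{u}} [X.Over (Spec (CommRingCat.of K))]
  [Y.Over (Spec (CommRingCat.of K))] (f : X ⟶ Y) [f.IsOver (Spec (CommRingCat.of K))]

lemma pull_smul' (E : Y.Modules) (V : Y.Opens) (a : Γ(Y, V)) (e : Γ(E, V)) :
    pull f E V (a • e) = pullO K f (le_refl (f ⁻¹ᵁ V)) a • pull f E V e := by
  rw [pull_smul]
  congr 1
  change _ = f.appLE V (f ⁻¹ᵁ V) _ a
  rw [Scheme.Hom.appLE_eq_app]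

lemma app_eq_pullO (V : Y.Opens) (a : Γ(Y, V)) :
    f.app V a = pullO K f (le_refl (f ⁻¹ᵁ V)) a := by
  change _ = f.appLE V (f ⁻¹ᵁ V) _ a
  rw [Scheme.Hom.appLE_eq_app]

lemma pullO_comp_resO {V W : Y.Opens} (h : W ≤ V) :
    (pullO K f (le_refl (f ⁻¹ᵁ W))).comp (resO K h) =
      (resO K (U := f ⁻¹ᵁ V) (V := f ⁻¹ᵁ W) (fun _ hx => h hx)).comp
        (pullO K f (le_refl (f ⁻¹ᵁ V))) := by
  ext a
  change (Y.presheaf.map _ ≫ f.appLE _ _ _) a = (f.appLE _ _ _ ≫ X.presheaf.map _) a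
  rw [Scheme.Hom.map_appLE, Scheme.Hom.appLE_map]

/-- The map `Ω_{O(V)/K} ⊗ E(V) → (Ω¹_X ⊗ f^*E)(f⁻¹V)`, `da ⊗ e ↦ d(f^♯a) ⊗ (1 ⊗ e)`. -/
def omegaPullPre (E : Y.Modules) (V : Y.Opens) : (omegaPre K E).obj V →+
    Γ((Scheme.Modules.pushforward f).obj (Omega K ((Scheme.Modules.pullback f).obj E)), V) :=
  ((omegaPre K ((Scheme.Modules.pullback f).obj E)).toSheaf (f ⁻¹ᵁ V)).toAddMonoidHom.comp
    (kaehlerTensorMap (pullO K f (le_refl (f ⁻¹ᵁ V))) (pull f E V) (pull_smul' f E V))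

/-- The morphism `Ω¹_Y ⊗ E → f_*(Ω¹_X ⊗ f^*E)`. -/
def omegaPull (E : Y.Modules) : Omega K E ⟶
    (Scheme.Modules.pushforward f).obj (Omega K ((Scheme.Modules.pullback f).obj E)) :=
  (omegaPre K E).lift _ (omegaPullPre f E)
    (fun U V h x => by
      refine Eq.trans ?_ ((omegaPre K _).toSheaf_res (U := f ⁻¹ᵁ U) (V := f ⁻¹ᵁ V)
        (fun _ hx => h hx) (kaehlerTensorMap _ _ (pull_smul' f E U) x))
      refine congrArg ((omegaPre K _).toSheaf (f ⁻¹ᵁ V)) ?_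
      exact kaehlerTensorMap_square _ _ _ _ _ _ (res_smul E h) _ (pull_smul' f E U) (res_smul _ _)
        (pullO_comp_resO f h) (pull_res f E h) x)
    (fun U a x => by
      have h1 : kaehlerTensorMap _ _ (pull_smul' f E U) (a • x) = _ := kaehlerTensorMap_smul _ _ _ a x
      refine (congrArg ((omegaPre K _).toSheaf (f ⁻¹ᵁ U)) h1).trans ?_
      rw [← app_eq_pullO]
      exact ((omegaPre K _).toSheaf (f ⁻¹ᵁ U)).map_smul _ _)

/-- The map `P¹_{O(V)/K} ⊗ E(V) → (P¹_X ⊗ f^*E)(f⁻¹V)`, `a ⊗ b ⊗ e ↦ f^♯a ⊗ f^♯b ⊗ (1 ⊗ e)`. -/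
def partsPullPre (E : Y.Modules) (V : Y.Opens) : (partsPre K E).obj V →+
    Γ((Scheme.Modules.pushforward f).obj (Parts K ((Scheme.Modules.pullback f).obj E)), V) :=
  ((partsPre K ((Scheme.Modules.pullback f).obj E)).toSheaf (f ⁻¹ᵁ V)).toAddMonoidHom.comp
    (PPT.map (pullO K f (le_refl (f ⁻¹ᵁ V))) (pull f E V) (pull_smul' f E V))

/-- The morphism `P¹_Y ⊗ E → f_*(P¹_X ⊗ f^*E)`. -/
def partsPull (E : Y.Modules) : Parts K E ⟶
    (Scheme.Modules.pushforward f).obj (Parts K ((Scheme.Modules.pullback f).obj E)) :=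
  (partsPre K E).lift _ (partsPullPre f E)
    (fun U V h x => by
      refine Eq.trans ?_ ((partsPre K _).toSheaf_res (U := f ⁻¹ᵁ U) (V := f ⁻¹ᵁ V)
        (fun _ hx => h hx) (PPT.map _ _ (pull_smul' f E U) x))
      refine congrArg ((partsPre K _).toSheaf (f ⁻¹ᵁ V)) ?_
      exact PPT.map_square _ _ _ _ _ _ (res_smul E h) _ (pull_smul' f E U) (res_smul _ _)
        (pullO_comp_resO f h) (pull_res f E h) x)
    (fun U a x => by
      have h1 : PPT.map _ _ (pull_smul' f E U) (a • x) = _ := PPT.map_smul _ _ _ a x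
      refine (congrArg ((partsPre K _).toSheaf (f ⁻¹ᵁ U)) h1).trans ?_
      rw [← app_eq_pullO]
      exact ((partsPre K _).toSheaf (f ⁻¹ᵁ U)).map_smul _ _)

/-- For a connection on `E` with associated `δ : E → P¹_Y ⊗ E`, the morphism
`f^*δ : f^*E → f^*(P¹_Y ⊗ E) → P¹_X ⊗ f^*E`. -/
def pullDelta {E : Y.Modules} (c : Connection K E) :
    (Scheme.Modules.pullback f).obj E ⟶ Parts K ((Scheme.Modules.pullback f).obj E) :=
  (Scheme.Modules.pullback f).map c.delta ≫ pullLift f (partsPull f E)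

/-- `c'` is the inverse image `f^*∇` of the connection `c = ∇`: the section `c_X + f^*∇` of
`P¹_X ⊗ f^*E → f^*E` corresponding to `c'` is `f^*δ`, i.e. `f^*∇ = f^*δ - c_X`. -/
def Connection.IsInverseImage {E : Y.Modules} (c : Connection K E)
    (c' : Connection K ((Scheme.Modules.pullback f).obj E)) : Prop :=
  c'.delta = pullDelta f c

/-! ### Modules over the sheaf of differential operators -/

variable (K) in
/-- A structure of left `D_X`-module on a sheaf of abelian groups. -/
@[ext]
structure DAction (F : TopCat.Presheaf Ab.{u} X) where
  /-- the action of the differential operators on `U` on the sections over `U` -/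
  act : ∀ U : X.Opens, D (X := X) K U →+* AddMonoid.End (F.obj (op U))
  act_res : ∀ (U V : X.Opens) (h : V ≤ U) (P : D (X := X) K U) (s : F.obj (op U)),
    F.map (homOfLE h).op (act U P s) = act V (D.res h P) (F.map (homOfLE h).op s)

variable (K) in
/-- A structure of left `D_X`-module on an `O_X`-module `E`, extending the structure of
`O_X`-module. -/
@[ext]
structure DModuleStructure (E : X.Modules) extends DAction K E.presheaf where
  act_ofFun : ∀ (U : X.Opens) (a : Γ(X, U)) (e : Γ(E, U)), act U (D.ofFun a) e = a • e

/-- The connection `∇` and the `D_X`-module structure correspond to each other: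
`∂ · e = Δ_∂(e) = ⟨∂, ∇(e)⟩` for all local derivations `∂`. -/
def Connection.Corresponds {E : X.Modules} (c : Connection K E) (ρ : DModuleStructure K E) : Prop :=
  ∀ (U : X.Opens) (d : VectorField K U) (e : Γ(E, U)), ρ.act U d.toD e = c.along d e

variable (K X) in
/-- `D_X` as a left module over itself. -/
def regular : DModuleStructure K (DMod K X) where
  act U := Module.toAddMonoidEnd (D (X := X) K U) (D (X := X) K U)
  act_res _ _ h P s := map_mul (D.res (K := K) h) P s
  act_ofFun _ _ _ := rfl

/-- `y_1, …, y_n` are local coordinates on the open subset `V` of `Y`, i.e. the `dy_i` form a basis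
of the sheaf `Ω¹` on `V`, and `η_1, …, η_n` is the dual basis of derivations. -/
structure IsCoordinates {V : Y.Opens} {n : ℕ} (y : Fin n → Γ(Y, V))
    (η : Fin n → VectorField K V) : Prop where
  linearIndependent : ∀ (W : Y.Opens) (h : W ≤ V), IsAffineOpen W →
    LinearIndependent Γ(Y, W) (fun i => KaehlerDifferential.D K Γ(Y, W) (resO K h (y i)))
  span_eq_top : ∀ (W : Y.Opens) (h : W ≤ V), IsAffineOpen W →
    Submodule.span Γ(Y, W)
      (Set.range fun i => KaehlerDifferential.D K Γ(Y, W) (resO K h (y i))) = ⊤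
  dual : ∀ i j, (η i).apply (y j) = if i = j then 1 else 0

/-- `σ` is the structure of `D_X`-module on the inverse image `f^*M` of a `D_Y`-module `M`, given by
`α' (α ⊗ m) = α' α ⊗ m` and
`∂ (α ⊗ m) = ∂(α) ⊗ m + α ∑ᵢ ∂(yᵢ) ⊗ ηᵢ m`
in all local coordinates `yᵢ` on `Y`, with dual derivations `ηᵢ`. -/
structure DModuleStructure.IsInverseImage {M : Y.Modules} (ρ : DModuleStructure K M)
    (σ : DModuleStructure K ((Scheme.Modules.pullback f).obj M)) : Prop where
  function_tmul : ∀ (U : X.Opens) (V : Y.Opens) (h : U ≤ f ⁻¹ᵁ V) (b a : Γ(X, U)) (m : Γ(M, V)),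
    σ.act U (D.ofFun b) (tmul f M h a m) = tmul f M h (b * a) m
  derivation_tmul : ∀ (U : X.Opens) (V : Y.Opens) (h : U ≤ f ⁻¹ᵁ V) (n : ℕ)
    (y : Fin n → Γ(Y, V)) (η : Fin n → VectorField K V), IsCoordinates y η →
    ∀ (d : VectorField K U) (a : Γ(X, U)) (m : Γ(M, V)),
      σ.act U d.toD (tmul f M h a m) = tmul f M h (d.apply a) m +
        a • ∑ i, tmul f M h (d.apply (pullO K f h (y i))) (ρ.act V (η i).toD m)

/-! ### The transfer bimodule and the inverse image of `D`-modules -/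

variable (K) in
/-- `D_{X → Y} = f^* D_Y = O_X ⊗_{f⁻¹O_Y} f⁻¹D_Y`, as an `O_X`-module. -/
def Transfer : X.Modules := (Scheme.Modules.pullback f).obj (DMod K Y)

/-- The section `1 ⊗ P` of `D_{X → Y}`. -/
def Transfer.pull (V : Y.Opens) : D (X := Y) K V →+ Γ(Transfer K f, f ⁻¹ᵁ V) :=
  DConn.pull f (DMod K Y) V

variable (K) in
/-- The section `α ⊗ P` of `D_{X → Y}`. -/
def Transfer.tmul {U : X.Opens} {V : Y.Opens} (h : U ≤ f ⁻¹ᵁ V) (a : Γ(X, U)) (P : D (X := Y) K V) :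
    Γ(Transfer K f, U) :=
  DConn.tmul f (DMod K Y) h a P

lemma preimage_inf_le (V W : Y.Opens) : cap (f ⁻¹ᵁ V) (f ⁻¹ᵁ W) ≤ f ⁻¹ᵁ (V ⊓ W) :=
  fun _ hx => ⟨(cap_le_left (f ⁻¹ᵁ V) (f ⁻¹ᵁ W) hx :), (cap_le_right (f ⁻¹ᵁ V) (f ⁻¹ᵁ W) hx :)⟩

lemma preimage_le {V W : Y.Opens} (h : W ≤ V) : f ⁻¹ᵁ W ≤ f ⁻¹ᵁ V := fun _ hx => h hx

lemma Transfer.pull_res {V W : Y.Opens} (h : W ≤ V) (Q : D (X := Y) K V) :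
    Transfer.pull f W (D.res h Q) =
      res (Transfer K f) (preimage_le f h) (Transfer.pull f V Q) :=
  DConn.pull_res f (DMod K Y) h Q

lemma Transfer.pull_ofFun_mul {V : Y.Opens} (a : Γ(Y, V)) (Q : D (X := Y) K V) :
    Transfer.pull f V (D.ofFun a * Q) = pullO K f (le_refl (f ⁻¹ᵁ V)) a • Transfer.pull f V Q :=
  pull_smul' f (DMod K Y) V a Q

lemma Transfer.one_tmul {U : X.Opens} {V : Y.Opens} (h : U ≤ f ⁻¹ᵁ V) (Q : D (X := Y) K V) :
    Transfer.tmul K f h 1 Q = res (Transfer K f) h (Transfer.pull f V Q) :=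
  one_smul _ _

/-- The map `D_Y(W) → D_{X → Y}(f⁻¹(V) ∩ f⁻¹(W))`, `Q ↦ 1 ⊗ Q P`, for `P ∈ D_Y(V)`. -/
def mulRightAux {V : Y.Opens} (P : D (X := Y) K V) (W : Y.Opens) :
    D (X := Y) K W →+ Γ(Transfer K f, cap (f ⁻¹ᵁ V) (f ⁻¹ᵁ W)) :=
  ((res (Transfer K f) (preimage_inf_le f V W)).comp (Transfer.pull f (V ⊓ W))).comp
    ((AddMonoidHom.mulRight (D.res inf_le_left P : D (X := Y) K (V ⊓ W))).comp
      (D.res (inf_le_right : V ⊓ W ≤ W)).toAddMonoidHom)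

lemma mulRightAux_apply {V : Y.Opens} (P : D (X := Y) K V) (W : Y.Opens) (Q : D (X := Y) K W) :
    mulRightAux f P W Q = Transfer.tmul K f (preimage_inf_le f V W) 1
      (D.res inf_le_right Q * D.res inf_le_left P) :=
  (Transfer.one_tmul f _ _).symm

lemma mulRightAux_res {V : Y.Opens} (P : D (X := Y) K V) {W W' : Y.Opens} (h : W' ≤ W)
    (Q : D (X := Y) K W) : mulRightAux f P W' (D.res h Q) =
      res (Transfer K f) (cap_mono _ (preimage_le f h)) (mulRightAux f P W Q) := by
  have h1 : (D.res inf_le_right (D.res h Q) * D.res inf_le_left P : D (X := Y) K (V ⊓ W')) =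
      D.res (inf_le_inf_left V h) (D.res inf_le_right Q * D.res inf_le_left P) := rfl
  rw [mulRightAux_apply, mulRightAux_apply, h1, Transfer.one_tmul, Transfer.one_tmul,
    Transfer.pull_res, res_res, res_res]

lemma mulRightAux_ofFun_mul {V : Y.Opens} (P : D (X := Y) K V) (W : Y.Opens) (a : Γ(Y, W))
    (Q : D (X := Y) K W) : mulRightAux f P W (D.ofFun a * Q) =
      resO K (cap_le_right (f ⁻¹ᵁ V) (f ⁻¹ᵁ W)) (pullO K f (le_refl (f ⁻¹ᵁ W)) a) • mulRightAux f P W Q := by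
  rw [mulRightAux_apply, mulRightAux_apply, Transfer.one_tmul, Transfer.one_tmul,
    D.res_ofFun_mul, mul_assoc, Transfer.pull_ofFun_mul, res_smul (K := K) (Transfer K f)]
  congr 1
  change (f.appLE _ _ _ ≫ X.presheaf.map _) ((Y.presheaf.map _) a) =
    (f.appLE _ _ _ ≫ X.presheaf.map _) a
  rw [Scheme.Hom.appLE_map, Scheme.Hom.appLE_map]
  change (Y.presheaf.map _ ≫ f.appLE _ _ _) a = _
  rw [Scheme.Hom.map_appLE]

/-- The morphism `D_Y → f_* j_* j^* D_{X → Y}`, `Q ↦ 1 ⊗ Q P`, for `P ∈ D_Y(V)` and the inclusion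
`j : f⁻¹(V) → X`. -/
def mulRightPre {V : Y.Opens} (P : D (X := Y) K V) :
    DMod K Y ⟶ (Scheme.Modules.pushforward f).obj (openExt (Transfer K f) (f ⁻¹ᵁ V)) :=
  homOfApp
    (fun W => (openExtSections (Transfer K f) (f ⁻¹ᵁ V) (f ⁻¹ᵁ W)).symm.toAddMonoidHom.comp
      (mulRightAux f P W))
    (fun _ _ h Q => mulRightAux_res f P h Q)
    (fun W a Q => by
      refine (mulRightAux_ofFun_mul f P W a Q).trans ?_
      rw [← app_eq_pullO]
      exact (openExtSections_smul K (Transfer K f) (f ⁻¹ᵁ V) (f.app W a) _).symm)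

/-- Multiplication on the right by `P ∈ D_Y(V)` on the sections of `D_{X → Y}` over an open subset
of `f⁻¹(V)`. -/
def rightMul {U : X.Opens} {V : Y.Opens} (h : U ≤ f ⁻¹ᵁ V) (P : D (X := Y) K V) :
    Γ(Transfer K f, U) →+ Γ(Transfer K f, U) :=
  (res (Transfer K f) (le_cap h le_rfl)).comp
    ((openExtSections (Transfer K f) (f ⁻¹ᵁ V) U).toAddMonoidHom.comp
      ((pullLift f (mulRightPre f P)).app U).hom)

lemma rightMul_tmul {U : X.Opens} {V : Y.Opens} (h : U ≤ f ⁻¹ᵁ V) (P : D (X := Y) K V)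
    (a : Γ(X, U)) (Q : D (X := Y) K V) :
    rightMul f h P (Transfer.tmul K f h a Q) = Transfer.tmul K f h a (Q * P) := by
  have h1 : (pullLift f (mulRightPre f P)).app U (Transfer.tmul K f h a Q) =
      a • res (openExt (Transfer K f) (f ⁻¹ᵁ V)) h ((mulRightPre f P).app V Q) := by
    rw [← pullLift_pull f (mulRightPre f P) V Q, ← app_res]
    exact Scheme.Modules.Hom.app_smul _ _ _
  change res _ _ (openExtSections _ _ _ ((pullLift f (mulRightPre f P)).app U _)) = _
  rw [h1, openExtSections_smul K, res_smul (K := K), resO_resO, resO_self]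
  change a • res (Transfer K f) _ (res (Transfer K f) (cap_mono _ h) (mulRightAux f P V Q)) = _
  have h2 : (D.res inf_le_right Q * D.res inf_le_left P : D (X := Y) K (V ⊓ V)) =
    D.res inf_le_left (Q * P) := rfl
  rw [mulRightAux_apply, Transfer.one_tmul, h2, Transfer.pull_res, res_res, res_res, res_res]
  rfl

lemma rightMul_res {U U' : X.Opens} {V : Y.Opens} (h : U ≤ f ⁻¹ᵁ V) (h' : U' ≤ U)
    (P : D (X := Y) K V) (n : Γ(Transfer K f, U)) :
    res (Transfer K f) h' (rightMul f h P n) = rightMul f (h'.trans h) P (res _ h' n) := by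
  change res _ _ (res _ _ (openExtSections _ _ _ ((pullLift f (mulRightPre f P)).app U n))) =
    res _ _ (openExtSections _ _ _ ((pullLift f (mulRightPre f P)).app U' (res _ h' n)))
  refine Eq.trans ?_ (congrArg (fun z => res (Transfer K f) (le_cap (h'.trans h) le_rfl)
    (openExtSections (Transfer K f) (f ⁻¹ᵁ V) U' z))
    (app_res (E := Transfer K f) (pullLift f (mulRightPre f P)) h' n)).symm
  simp only [openExtSections_res, res_res]
  rfl

/-- The generators of `D_{X → Y}(U) ⊗ (f⁻¹M)(U)`: the symbols `n ⊗ m`, where `n` is a section of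
`D_{X → Y}` over `U` and `m` is a section of `M` over some open subset `V` with `U ⊆ f⁻¹(V)`. -/
abbrev InvGen (M : Y.Modules) (U : X.Opens) : Type u :=
  Σ V : {V : Y.Opens // U ≤ f ⁻¹ᵁ V}, Γ(Transfer K f, U) × Γ(M, V.1)

/-- The symbol `n ⊗ m`. -/
def InvGen.mk {M : Y.Modules} {U : X.Opens} {V : Y.Opens} (h : U ≤ f ⁻¹ᵁ V)
    (n : Γ(Transfer K f, U)) (m : Γ(M, V)) : FreeAbelianGroup (InvGen (K := K) f M U) :=
  FreeAbelianGroup.of ⟨⟨V, h⟩, n, m⟩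

/-- The relations between the symbols `n ⊗ m`: additivity in both variables, independence of the
representative of a section of `f⁻¹M`, and `n P ⊗ m = n ⊗ P m` for `P` in `D_Y`. -/
inductive InvRel {M : Y.Modules} (ρ : DModuleStructure K M) (U : X.Opens) :
    FreeAbelianGroup (InvGen (K := K) f M U) → Prop
  | add_left (V : Y.Opens) (h : U ≤ f ⁻¹ᵁ V) (n n' : Γ(Transfer K f, U)) (m : Γ(M, V)) :
      InvRel ρ U (InvGen.mk f h (n + n') m - (InvGen.mk f h n m + InvGen.mk f h n' m))
  | add_right (V : Y.Opens) (h : U ≤ f ⁻¹ᵁ V) (n : Γ(Transfer K f, U)) (m m' : Γ(M, V)) :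
      InvRel ρ U (InvGen.mk f h n (m + m') - (InvGen.mk f h n m + InvGen.mk f h n m'))
  | res (V V' : Y.Opens) (h : U ≤ f ⁻¹ᵁ V') (h' : V' ≤ V) (n : Γ(Transfer K f, U)) (m : Γ(M, V)) :
      InvRel ρ U (InvGen.mk f (h.trans (preimage_le f h')) n m - InvGen.mk f h n (res M h' m))
  | balanced (V : Y.Opens) (h : U ≤ f ⁻¹ᵁ V) (n : Γ(Transfer K f, U)) (P : D (X := Y) K V)
      (m : Γ(M, V)) :
      InvRel ρ U (InvGen.mk f h (rightMul f h P n) m - InvGen.mk f h n (ρ.act V P m))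

/-- The subgroup generated by the relations. -/
def invRels {M : Y.Modules} (ρ : DModuleStructure K M) (U : X.Opens) :
    AddSubgroup (FreeAbelianGroup (InvGen (K := K) f M U)) :=
  AddSubgroup.closure {z | InvRel f ρ U z}

/-- Restriction of the symbols `n ⊗ m`. -/
def InvGen.res (M : Y.Modules) {U U' : X.Opens} (h : U' ≤ U) :
    FreeAbelianGroup (InvGen (K := K) f M U) →+ FreeAbelianGroup (InvGen (K := K) f M U') :=
  FreeAbelianGroup.map fun g => ⟨⟨g.1.1, h.trans g.1.2⟩, DConn.res (Transfer K f) h g.2.1, g.2.2⟩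

lemma InvGen.res_mk {M : Y.Modules} {U U' : X.Opens} {V : Y.Opens} (h' : U' ≤ U) (h : U ≤ f ⁻¹ᵁ V)
    (n : Γ(Transfer K f, U)) (m : Γ(M, V)) : InvGen.res f M h' (InvGen.mk f h n m) =
      InvGen.mk f (h'.trans h) (DConn.res (Transfer K f) h' n) m :=
  FreeAbelianGroup.map_of_apply _

lemma invRels_le {M : Y.Modules} (ρ : DModuleStructure K M) {U U' : X.Opens} (h : U' ≤ U) :
    invRels f ρ U ≤ (invRels f ρ U').comap (InvGen.res f M h) := by
  rw [invRels, AddSubgroup.closure_le]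
  rintro z (⟨V, hV, n, n', m⟩ | ⟨V, hV, n, m, m'⟩ | ⟨V, V', hV, hV', n, m⟩ | ⟨V, hV, n, P, m⟩) <;>
    refine AddSubgroup.subset_closure ?_ <;>
    simp only [map_sub, map_add, InvGen.res_mk, rightMul_res]
  · exact InvRel.add_left _ _ _ _ _
  · exact InvRel.add_right _ _ _ _ _
  · exact InvRel.res _ _ _ _ _ _
  · exact InvRel.balanced _ _ _ _ _

/-- The presheaf `U ↦ D_{X → Y}(U) ⊗ (f⁻¹M)(U)`, the tensor product being over `(f⁻¹D_Y)(U)`. -/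
def invPre {M : Y.Modules} (ρ : DModuleStructure K M) : TopCat.Presheaf Ab.{u} X where
  obj U := AddCommGrpCat.of (FreeAbelianGroup (InvGen (K := K) f M U.unop) ⧸ invRels f ρ U.unop)
  map i := AddCommGrpCat.ofHom (QuotientAddGroup.map _ _ (InvGen.res f M i.unop.le)
    (invRels_le f ρ i.unop.le))
  map_id U := by
    refine AddCommGrpCat.hom_ext (QuotientAddGroup.addMonoidHom_ext _ (FreeAbelianGroup.lift_ext
      _ _ fun g => ?_))
    refine congrArg (QuotientAddGroup.mk' (invRels f ρ U.unop))
      ((InvGen.res_mk f _ g.1.2 _ _).trans ?_)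
    rw [res_self]
    rfl
  map_comp {U V W} i j := by
    refine AddCommGrpCat.hom_ext (QuotientAddGroup.addMonoidHom_ext _ (FreeAbelianGroup.lift_ext
      _ _ fun g => ?_))
    refine congrArg (QuotientAddGroup.mk' (invRels f ρ W.unop)) ?_
    refine (InvGen.res_mk f (U := U.unop) (U' := W.unop) (j.unop.le.trans i.unop.le) g.1.2
      g.2.1 g.2.2).trans ?_
    rw [← res_res (Transfer K f) i.unop.le j.unop.le]
    rfl

/-- The sheaf `D_{X → Y} ⊗ f⁻¹M`, the tensor product being over `f⁻¹D_Y`, for a left `D_Y`-module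
`M`. -/
def InvD {M : Y.Modules} (ρ : DModuleStructure K M) : TopCat.Presheaf Ab.{u} X :=
  ((presheafToSheaf (Opens.grothendieckTopology X) Ab.{u}).obj (invPre f ρ)).obj

/-- The section `n ⊗ m` of the sheaf `D_{X → Y} ⊗ f⁻¹M`. -/
def InvD.tmul {M : Y.Modules} (ρ : DModuleStructure K M) {U : X.Opens} {V : Y.Opens}
    (h : U ≤ f ⁻¹ᵁ V) (n : Γ(Transfer K f, U)) (m : Γ(M, V)) : (InvD f ρ).obj (op U) :=
  (toSheafify (Opens.grothendieckTopology X) (invPre f ρ)).app (op U)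
    (QuotientAddGroup.mk (InvGen.mk f h n m))

end InverseImage

end DConn

end

open DConn

/-!
The proof works locally, with coordinates `y₁, …, yₙ` and the dual derivations `η₁, …, ηₙ`; over a
smooth scheme they exist near every point, and the `ηᵢ` commute.

*D-modules and integrable connections.* A `D`-module structure gives the connection
`∇ e = ∑ dyᵢ ⊗ ηᵢ e`; it is determined by its values on derivations, because in characteristic zero
`D` is generated by functions and derivations. The latter holds since the operator
`P ↦ ∑ [P, yᵢ] ηᵢ` is multiplication by `n` on operators of order `n` modulo lower order
(`DOp.induction`). Conversely, let `∇` be an integrable connection with operators `Δ_∂`. The pairs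
`(a, a)` and `(ηᵢ, Δ_{ηᵢ})` satisfy the relations of a Weyl algebra in the product of `D` with the
additive endomorphisms of `E`. Every element of the subring they generate is a combination of
normally ordered words, and such a combination vanishes as soon as its first component does
(`IsWeylSystem.eq_zero_of_map_eq_zero`). Hence the subring is locally the graph of an action of `D`
(`Connection.graph_unique`, `Connection.exists_action`), and these actions glue.

*Inverse image of a connection.* The map `Ω¹ ⊗ E → P¹ ⊗ E` is injective, and `f^*M` is locally
generated by the sections `α ⊗ m` (`pullback_induction`). The value of `f^*δ - c_X` at `α ⊗ m` lies
in `Ω¹ ⊗ f^*M` (`pullDelta_tmul`), so there is exactly one connection `f^*∇` with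
`c_X + f^*∇ = f^*δ`, and its value at `α ⊗ m` is the asserted one. Its curvature is `O_X`-linear and
vanishes on `1 ⊗ m`, so it is integrable (`Connection.Integrable.inverseImage`). The `D_X`-module
structure corresponding to it satisfies the formula for inverse images of `D`-modules. Uniqueness
follows again from the generation of `D` by functions and derivations.

*Transfer module.* Right multiplication on `D_Y` and, for a section `m` of `M`, the evaluation
`n ↦ n m` induce maps on `f^* D_Y` that commute with the action of `D_X` (`opS_rightEval`). The
evaluations define a map from `D_{X→Y} ⊗ f⁻¹M` to `f^*M`, inverse to `α ⊗ m ↦ (α ⊗ 1) ⊗ m`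
(`tensorIso`). The action of `D_X` on the tensor product is obtained by transport along this
isomorphism, and the compatibility of the evaluations with `D_X` identifies it with the action on
the left factor.
-/

noncomputable section

namespace DConn

/-! ### Local properties of sections -/

section Local

variable {X : Scheme.{u}}

lemma PreMod.exists_toSheaf_eq (P : PreMod X) {U : X.Opens} (s : Γ(P.sheaf, U)) {x : X}
    (hx : x ∈ U) : ∃ (V : X.Opens) (h : V ≤ U) (_ : x ∈ V) (y : P.obj V),
      P.toSheaf V y = DConn.res P.sheaf h s := by
  have h1 := Presheaf.imageSieve_mem (Opens.grothendieckTopology X)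
    (CategoryTheory.toSheafify (Opens.grothendieckTopology X) P.presheafOfModules.presheaf)
    (U := op U) s
  obtain ⟨V, i, ⟨t, ht⟩, hxV⟩ := h1 x hx
  exact ⟨V, i.le, hxV, t, ht⟩

lemma PreMod.exists_res_eq_zero (P : PreMod X) {U : X.Opens} (y : P.obj U)
    (hy : P.toSheaf U y = 0) {x : X} (hx : x ∈ U) :
    ∃ (V : X.Opens) (h : V ≤ U) (_ : x ∈ V), P.res h y = 0 := by
  have h1 := Presheaf.equalizerSieve_mem (Opens.grothendieckTopology X)
    (CategoryTheory.toSheafify (Opens.grothendieckTopology X) P.presheafOfModules.presheaf)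
    (X := op U) y 0 (hy.trans (map_zero (P.toSheaf U)).symm)
  obtain ⟨V, i, hi, hxV⟩ := h1 x hx
  exact ⟨V, i.le, hxV, Eq.trans hi (map_zero (P.res i.le))⟩

/-- Restriction for a presheaf of abelian groups. -/
def resAb (F : TopCat.Presheaf Ab.{u} X) {U V : X.Opens} (h : V ≤ U) :
    F.obj (op U) →+ F.obj (op V) :=
  (F.map (homOfLE h).op).hom

lemma eq_of_locally_ab {F : TopCat.Presheaf Ab.{u} X} (hF : F.IsSheaf) {U : X.Opens}
    {s t : F.obj (op U)}
    (H : ∀ x ∈ U, ∃ (V : X.Opens) (h : V ≤ U), x ∈ V ∧ resAb F h s = resAb F h t) : s = t := by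
  choose V h hx hst using H
  refine TopCat.Sheaf.eq_of_locally_eq' ⟨F, hF⟩ (fun x : U => V x.1 x.2) U
    (fun x => homOfLE (h x.1 x.2)) (fun x hxU => Opens.mem_iSup.mpr ⟨⟨x, hxU⟩, hx x hxU⟩) s t
    fun x => hst x.1 x.2

lemma eq_of_locally (E : X.Modules) {U : X.Opens} {s t : Γ(E, U)}
    (H : ∀ x ∈ U, ∃ (V : X.Opens) (h : V ≤ U), x ∈ V ∧ res E h s = res E h t) : s = t :=
  eq_of_locally_ab E.isSheaf H

/-- Gluing of sections characterized by a local property `Q` that determines them. -/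
lemma exists_of_locally_ab {F : TopCat.Presheaf Ab.{u} X} (hF : F.IsSheaf) {U : X.Opens}
    (Q : ∀ V : X.Opens, V ≤ U → F.obj (op V) → Prop)
    (hres : ∀ (V W : X.Opens) (hV : V ≤ U) (h : W ≤ V) s, Q V hV s → Q W (h.trans hV) (resAb F h s))
    (huniq : ∀ (V : X.Opens) (hV : V ≤ U) s t, Q V hV s → Q V hV t → s = t)
    (hex : ∀ x ∈ U, ∃ (V : X.Opens) (h : V ≤ U), x ∈ V ∧ ∃ s, Q V h s) :
    ∃ t : F.obj (op U), ∀ x ∈ U, ∃ (V : X.Opens) (h : V ≤ U), x ∈ V ∧ Q V h (resAb F h t) := by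
  choose V h hx s hs using hex
  obtain ⟨t, ht, -⟩ := TopCat.Sheaf.existsUnique_gluing' ⟨F, hF⟩ (fun x : U => V x.1 x.2) U
    (fun x => homOfLE (h x.1 x.2)) (fun x hxU => Opens.mem_iSup.mpr ⟨⟨x, hxU⟩, hx x hxU⟩)
    (fun x => s x.1 x.2) (fun x y => huniq _ (inf_le_left.trans (h x.1 x.2)) _ _
      (hres _ _ _ _ _ (hs x.1 x.2)) (hres _ _ _ _ _ (hs y.1 y.2)))
  refine ⟨t, fun x hxU => ⟨V x hxU, h x hxU, hx x hxU, ?_⟩⟩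
  have := ht ⟨x, hxU⟩
  change resAb F _ t = _ at this
  rw [this]
  exact hs x hxU

lemma exists_of_locally (E : X.Modules) {U : X.Opens}
    (Q : ∀ V : X.Opens, V ≤ U → Γ(E, V) → Prop)
    (hres : ∀ (V W : X.Opens) (hV : V ≤ U) (h : W ≤ V) s, Q V hV s → Q W (h.trans hV) (res E h s))
    (huniq : ∀ (V : X.Opens) (hV : V ≤ U) s t, Q V hV s → Q V hV t → s = t)
    (hex : ∀ x ∈ U, ∃ (V : X.Opens) (h : V ≤ U), x ∈ V ∧ ∃ s, Q V h s) :
    ∃ t : Γ(E, U), ∀ x ∈ U, ∃ (V : X.Opens) (h : V ≤ U), x ∈ V ∧ Q V h (res E h t) :=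
  exists_of_locally_ab E.isSheaf Q hres huniq hex

variable {K : Type u} [Field K] [X.Over (Spec (CommRingCat.of K))]

/-- The structure sheaf as a presheaf of abelian groups. -/
def oAb (X : Scheme.{u}) : TopCat.Presheaf Ab.{u} X :=
  X.presheaf ⋙ forget₂ CommRingCat RingCat ⋙ forget₂ RingCat Ab

lemma oAb_isSheaf (X : Scheme.{u}) : (oAb X).IsSheaf :=
  (SheafOfModules.unit X.ringCatSheaf).isSheaf

lemma eq_of_locallyO {U : X.Opens} {a b : Γ(X, U)}
    (H : ∀ x ∈ U, ∃ (V : X.Opens) (h : V ≤ U), x ∈ V ∧ resO K h a = resO K h b) : a = b :=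
  eq_of_locally_ab (oAb_isSheaf X) H

lemma exists_of_locallyO {U : X.Opens}
    (Q : ∀ V : X.Opens, V ≤ U → Γ(X, V) → Prop)
    (hres : ∀ (V W : X.Opens) (hV : V ≤ U) (h : W ≤ V) s, Q V hV s → Q W (h.trans hV) (resO K h s))
    (huniq : ∀ (V : X.Opens) (hV : V ≤ U) s t, Q V hV s → Q V hV t → s = t)
    (hex : ∀ x ∈ U, ∃ (V : X.Opens) (h : V ≤ U), x ∈ V ∧ ∃ s, Q V h s) :
    ∃ t : Γ(X, U), ∀ x ∈ U, ∃ (V : X.Opens) (h : V ≤ U), x ∈ V ∧ Q V h (resO K h t) :=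
  exists_of_locally_ab (oAb_isSheaf X) Q hres huniq hex

/-- Affine neighbourhoods inside a given open subset. -/
lemma exists_affine {U : X.Opens} {x : X} (hx : x ∈ U) :
    ∃ V : X.Opens, IsAffineOpen V ∧ V ≤ U ∧ x ∈ V := by
  obtain ⟨V, hV, hxV, hVU⟩ := Opens.isBasis_iff_nbhd.mp X.isBasis_affineOpens hx
  exact ⟨V, hV, hVU, hxV⟩

end Local

end DConn

end

noncomputable section

namespace DConn

/-! ### Local coordinates on smooth schemes -/

section Coordinates

/-- A derivation is determined by its values on elements whose differentials span. -/
lemma derivation_ext_of_span {K A N ι : Type*} [CommRing K] [CommRing A] [Algebra K A]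
    [AddCommGroup N] [Module A N] [Module K N] [IsScalarTower K A N] (y : ι → A)
    (hy : Submodule.span A (Set.range fun i => KaehlerDifferential.D K A (y i)) = ⊤)
    {d d' : Derivation K A N} (h : ∀ i, d (y i) = d' (y i)) : d = d' := by
  have h1 : d.liftKaehlerDifferential = d'.liftKaehlerDifferential := by
    refine LinearMap.ext_on_range hy fun i => ?_
    simpa using h i
  ext a
  simpa using LinearMap.congr_fun h1 (KaehlerDifferential.D K A a)

/-- Two derivations compatible with a ring homomorphism `φ` on generating functions are compatible
with `φ`. -/
lemma derivation_comp_eq_of_span {K A B : Type u} {ι : Type*} [CommRing K] [CommRing A]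
    [CommRing B] [Algebra K A] [Algebra K B] (φ : A →ₐ[K] B) (y : ι → A)
    (hy : Submodule.span A (Set.range fun i => KaehlerDifferential.D K A (y i)) = ⊤)
    (d : Derivation K A A) (d' : Derivation K B B) (h : ∀ i, φ (d (y i)) = d' (φ (y i))) (a : A) :
    φ (d a) = d' (φ a) := by
  let _ : Algebra A B := φ.toRingHom.toAlgebra
  have : IsScalarTower K A B := IsScalarTower.of_algebraMap_eq fun x => (φ.commutes x).symm
  have h1 : (IsScalarTower.toAlgHom K A B).toLinearMap = φ.toLinearMap := rfl
  have h2 := derivation_ext_of_span (K := K) (N := B) y hy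
    (d := (Algebra.linearMap A B).compDer d) (d' := d'.compAlgebraMap A) h
  exact congrArg (fun D => D a) h2

variable {K : Type u} [Field K] {X : Scheme.{u}} [X.Over (Spec (CommRingCat.of K))]

/-- Coordinates on an affine open subset are coordinates on every smaller affine open subset, as
open immersions are étale. -/
lemma exists_basis_of_le {V W : X.Opens} (hV : IsAffineOpen V) (hW : IsAffineOpen W) (h : W ≤ V)
    {n : ℕ} (b : Module.Basis (Fin n) Γ(X, V) Ω[Γ(X, V)⁄K]) (y : Fin n → Γ(X, V))
    (hb : ∀ i, b i = KaehlerDifferential.D K Γ(X, V) (y i)) :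
    ∃ b' : Module.Basis (Fin n) Γ(X, W) Ω[Γ(X, W)⁄K],
      ∀ i, b' i = KaehlerDifferential.D K Γ(X, W) (resO K h (y i)) := by
  let _ : Algebra Γ(X, V) Γ(X, W) := (resO K h).toRingHom.toAlgebra
  have : IsScalarTower K Γ(X, V) Γ(X, W) :=
    IsScalarTower.of_algebraMap_eq fun x => ((resO K h).commutes x).symm
  have h1 : (resO K h).toRingHom.Etale := by
    have h2 := Scheme.Hom.etale_appLE (𝟙 X) hV hW h
    have h3 : (𝟙 X : X ⟶ X).appLE V W h = X.presheaf.map (homOfLE h).op :=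
      Category.id_comp _
    rwa [h3] at h2
  have h3 : Algebra.Etale Γ(X, V) Γ(X, W) := h1
  have h4 := KaehlerDifferential.isBaseChange_of_formallyEtale K Γ(X, V) Γ(X, W)
  refine ⟨h4.basis b, fun i => ?_⟩
  rw [IsBaseChange.basis_apply, hb, KaehlerDifferential.map_D]
  rfl

/-- A smooth scheme is covered by affine open subsets with a basis of exact differentials. -/
lemma exists_kaehler_basis [Smooth (X ↘ Spec (CommRingCat.of K))] (x : X) :
    ∃ (V : X.Opens) (_ : IsAffineOpen V) (_ : x ∈ V) (n : ℕ) (y : Fin n → Γ(X, V))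
      (b : Module.Basis (Fin n) Γ(X, V) Ω[Γ(X, V)⁄K]),
      ∀ i, b i = KaehlerDifferential.D K Γ(X, V) (y i) := by
  obtain ⟨U, hU, V, hV, hx, e, hs⟩ :=
    Smooth.exists_isStandardSmooth (X ↘ Spec (CommRingCat.of K)) x
  obtain rfl : U = ⊤ := by
    refine eq_top_iff.mpr fun z _ => ?_
    have : Subsingleton (Spec (CommRingCat.of K)) :=
      inferInstanceAs (Subsingleton (PrimeSpectrum K))
    rw [Subsingleton.elim z ((X ↘ Spec (CommRingCat.of K)) x)]
    exact e hx
  have h1 : (algebraMap K Γ(X, V)).IsStandardSmooth :=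
    RingHom.isStandardSmooth_respectsIso.2 _
      (Scheme.ΓSpecIso (CommRingCat.of K)).symm.commRingCatIsoToRingEquiv hs
  rw [RingHom.isStandardSmooth_algebraMap] at h1
  obtain ⟨ι, σ, _, _, ⟨P⟩⟩ := h1.out
  classical
  obtain ⟨n, ⟨e⟩⟩ := Finite.exists_equiv_fin ((Set.range P.map)ᶜ : Set ι)
  exact ⟨V, hV, hx, n, fun i => P.val (e.symm i), P.basisKaehler.reindex e, fun i => by
    rw [Module.Basis.reindex_apply, Algebra.SubmersivePresentation.basisKaehler_apply]⟩

/-- The vector field on `V` given by compatible derivations on affine open subsets. -/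
lemma exists_vectorField {V : X.Opens}
    (d : ∀ W : X.Opens, W ≤ V → IsAffineOpen W → Derivation K Γ(X, W) Γ(X, W))
    (hd : ∀ (W W' : X.Opens) (hW : W ≤ V) (ha : IsAffineOpen W) (ha' : IsAffineOpen W')
      (h : W' ≤ W) (a : Γ(X, W)), resO K h (d W hW ha a) = d W' (h.trans hW) ha' (resO K h a)) :
    ∃ η : VectorField K V, ∀ (W : X.Opens) (hW : W ≤ V) (ha : IsAffineOpen W),
      η.der W hW = d W hW ha := by
  have key : ∀ (W : X.Opens) (hW : W ≤ V) (a : Γ(X, W)), ∃ t : Γ(X, W), ∀ (W' : X.Opens)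
      (h : W' ≤ W) (ha : IsAffineOpen W'), resO K h t = d W' (h.trans hW) ha (resO K h a) := by
    intro W hW a
    let Q : ∀ U : X.Opens, U ≤ W → Γ(X, U) → Prop := fun U hU t => ∀ (W' : X.Opens)
      (h : W' ≤ U) (ha : IsAffineOpen W'),
        resO K h t = d W' ((h.trans hU).trans hW) ha (resO K (h.trans hU) a)
    have huniq : ∀ (U : X.Opens) (hU : U ≤ W) (s t : Γ(X, U)), Q U hU s → Q U hU t → s = t := by
      intro U hU s t hs ht
      refine eq_of_locallyO (K := K) fun x hx => ?_
      obtain ⟨W', ha, h, hx'⟩ := exists_affine hx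
      exact ⟨W', h, hx', (hs W' h ha).trans (ht W' h ha).symm⟩
    have hres : ∀ (U U' : X.Opens) (hU : U ≤ W) (h : U' ≤ U) (s : Γ(X, U)), Q U hU s →
        Q U' (h.trans hU) (resO K h s) := by
      intro U U' hU h s hs W' h' ha
      rw [resO_resO]
      exact hs W' (h'.trans h) ha
    obtain ⟨t, ht⟩ := exists_of_locallyO (K := K) Q hres huniq fun x hx => by
      obtain ⟨W', ha, h, hx'⟩ := exists_affine hx
      refine ⟨W', h, hx', d W' (h.trans hW) ha (resO K h a), fun W'' h'' ha'' => ?_⟩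
      rw [hd W' W'' _ ha ha'' h'', resO_resO]
    refine ⟨t, fun W' h ha => ?_⟩
    refine eq_of_locallyO (K := K) fun x hx => ?_
    obtain ⟨U, hU, hxU, hQ⟩ := ht x (h hx)
    obtain ⟨W'', ha'', h'', hx''⟩ := exists_affine (U := U ⊓ W') ⟨hxU, hx⟩
    refine ⟨W'', h''.trans inf_le_right, hx'', ?_⟩
    have := hQ W'' (h''.trans inf_le_left) ha''
    rw [resO_resO] at this
    rw [resO_resO, this, hd W' W'' _ ha ha'', resO_resO]
  choose g hg using key
  have huniq : ∀ (W : X.Opens) (hW : W ≤ V) (s t : Γ(X, W)), (∀ (W' : X.Opens)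
      (h : W' ≤ W) (_ : IsAffineOpen W'), resO K h s = resO K h t) → s = t := by
    intro W hW s t hst
    refine eq_of_locallyO (K := K) fun x hx => ?_
    obtain ⟨W', ha, h, hx'⟩ := exists_affine hx
    exact ⟨W', h, hx', hst W' h ha⟩
  refine ⟨⟨fun W hW => Derivation.mk' ⟨⟨g W hW, fun a b => ?_⟩, fun c a => ?_⟩ fun a b => ?_,
    fun W W' hW h a => ?_⟩, fun W hW ha => ?_⟩
  · refine huniq W hW _ _ fun W' h ha => ?_
    rw [map_add, hg _ _ _ _ _ ha, hg _ _ _ _ _ ha, hg _ _ _ _ _ ha, map_add, map_add]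
  · refine huniq W hW _ _ fun W' h ha => ?_
    change resO K h (g W hW (c • a)) = resO K h (c • g W hW a)
    rw [map_smul, hg _ _ _ _ _ ha, hg _ _ _ _ _ ha, map_smul, Derivation.map_smul]
  · refine huniq W hW _ _ fun W' h ha => ?_
    change resO K h (g W hW (a * b)) = resO K h (a * g W hW b + b * g W hW a)
    rw [map_add, map_mul, map_mul, hg _ _ _ _ _ ha, hg _ _ _ _ _ ha, hg _ _ _ _ _ ha, map_mul,
      Derivation.leibniz, smul_eq_mul, smul_eq_mul]
  · refine huniq W' (h.trans hW) _ _ fun W'' h' ha => ?_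
    change resO K h' (resO K h (g W hW a)) = resO K h' (g W' _ (resO K h a))
    rw [resO_resO, hg _ _ _ _ _ ha, hg _ _ _ _ _ ha, resO_resO]
  · ext a
    have := hg W hW a W le_rfl ha
    rw [resO_self] at this
    exact this

/-- Every point of a smooth scheme has an affine open neighbourhood with local coordinates. -/
theorem exists_coordinates [Smooth (X ↘ Spec (CommRingCat.of K))] (x : X) :
    ∃ (V : X.Opens) (_ : IsAffineOpen V) (_ : x ∈ V) (n : ℕ) (y : Fin n → Γ(X, V))
      (η : Fin n → VectorField K V), IsCoordinates y η := by
  obtain ⟨V, hV, hx, n, y, b, hb⟩ := exists_kaehler_basis (K := K) x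
  have H : ∀ (W : X.Opens) (h : W ≤ V) (_ : IsAffineOpen W),
      ∃ b' : Module.Basis (Fin n) Γ(X, W) Ω[Γ(X, W)⁄K],
        ∀ i, b' i = KaehlerDifferential.D K Γ(X, W) (resO K h (y i)) :=
    fun W h hW => exists_basis_of_le hV hW h b y hb
  choose B hB using H
  have hspan : ∀ (W : X.Opens) (h : W ≤ V), IsAffineOpen W → Submodule.span Γ(X, W)
      (Set.range fun i => KaehlerDifferential.D K Γ(X, W) (resO K h (y i))) = ⊤ := by
    intro W h hW
    rw [← (B W h hW).span_eq]
    congr 2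
    funext i
    exact (hB W h hW i).symm
  let d : Fin n → ∀ W : X.Opens, W ≤ V → IsAffineOpen W → Derivation K Γ(X, W) Γ(X, W) :=
    fun i W h hW => ((B W h hW).coord i).compDer (KaehlerDifferential.D K Γ(X, W))
  have hdy : ∀ i W h hW j, d i W h hW (resO K h (y j)) = if i = j then 1 else 0 := by
    intro i W h hW j
    change (B W h hW).coord i (KaehlerDifferential.D K Γ(X, W) (resO K h (y j))) = _
    rw [← hB W h hW, Module.Basis.coord_apply, Module.Basis.repr_self, Finsupp.single_apply]
    simp only [eq_comm]
  have hcompat : ∀ (i : Fin n) (W W' : X.Opens) (hW : W ≤ V) (ha : IsAffineOpen W)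
      (ha' : IsAffineOpen W') (h : W' ≤ W) (a : Γ(X, W)),
      resO K h (d i W hW ha a) = d i W' (h.trans hW) ha' (resO K h a) := by
    intro i W W' hW ha ha' h a
    refine derivation_comp_eq_of_span (resO K h) (fun j => resO K hW (y j)) (hspan W hW ha) _ _
      (fun j => ?_) a
    rw [hdy, resO_resO, hdy]
    split_ifs <;> simp
  choose η hη using fun i => exists_vectorField (d i) (hcompat i)
  refine ⟨V, hV, hx, n, y, η, fun W h hW => ?_, hspan, fun i j => ?_⟩
  · have := (B W h hW).linearIndependent
    convert this using 1
    funext i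
    exact (hB W h hW i).symm
  · have := hdy i V le_rfl hV j
    rw [resO_self] at this
    rw [VectorField.apply, hη i V le_rfl hV]
    exact this

lemma IsCoordinates.restrict {V V' : X.Opens} {n : ℕ} {y : Fin n → Γ(X, V)}
    {η : Fin n → VectorField K V} (h : IsCoordinates y η) (hV : V' ≤ V) :
    IsCoordinates (fun i => resO K hV (y i)) (fun i => (η i).res hV) where
  linearIndependent W hW ha := by
    have := h.linearIndependent W (hW.trans hV) ha
    simpa only [resO_resO] using this
  span_eq_top W hW ha := by
    have := h.span_eq_top W (hW.trans hV) ha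
    simpa only [resO_resO] using this
  dual i j := by
    have := congrArg (resO K hV) (h.dual i j)
    rw [VectorField.apply, (η i).compat] at this
    change (η i).der V' _ (resO K hV (y j)) = _
    rw [this]
    split_ifs <;> simp

/-- Every neighbourhood of a point of a smooth scheme contains an affine open neighbourhood with
local coordinates. -/
theorem exists_coordinates_le [Smooth (X ↘ Spec (CommRingCat.of K))] {U : X.Opens} {x : X}
    (hx : x ∈ U) :
    ∃ (V : X.Opens) (_ : IsAffineOpen V) (_ : V ≤ U) (_ : x ∈ V) (n : ℕ) (y : Fin n → Γ(X, V))
      (η : Fin n → VectorField K V), IsCoordinates y η := by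
  obtain ⟨V, hV, hxV, n, y, η, h⟩ := exists_coordinates (K := K) x
  obtain ⟨W, hW, hWV, hxW⟩ := exists_affine (U := U ⊓ V) ⟨hx, hxV⟩
  exact ⟨W, hW, hWV.trans inf_le_left, hxW, n, _, _, h.restrict (hWV.trans inf_le_right)⟩

/-- A vector field is determined by its values on coordinates. -/
lemma IsCoordinates.der_eq {V : X.Opens} {n : ℕ} {y : Fin n → Γ(X, V)}
    {η : Fin n → VectorField K V} (h : IsCoordinates y η) {W : X.Opens} (hW : W ≤ V)
    (d d' : VectorField K W)
    (hd : ∀ i, d.apply (resO K hW (y i)) = d'.apply (resO K hW (y i))) : d = d' := by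
  ext W' hW' a
  refine eq_of_locallyO (K := K) fun x hx => ?_
  obtain ⟨U, ha, hU, hxU⟩ := exists_affine hx
  refine ⟨U, hU, hxU, ?_⟩
  rw [d.compat, d'.compat]
  congr 1
  refine derivation_ext_of_span (fun j => resO K ((hU.trans hW').trans hW) (y j))
    (h.span_eq_top U ((hU.trans hW').trans hW) ha) fun i => ?_
  have := congrArg (resO K (hU.trans hW')) (hd i)
  rwa [VectorField.apply, VectorField.apply, d.compat, d'.compat, resO_resO] at this

/-- The product of a function and a derivation. -/
def VectorField.smul {U : X.Opens} (a : Γ(X, U)) (d : VectorField K U) : VectorField K U where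
  der V hV := resO K hV a • d.der V hV
  compat V W hV h b := by
    simp only [Derivation.smul_apply, smul_eq_mul, map_mul, d.compat V W hV h, resO_resO]

/-- The sum of derivations. -/
def VectorField.sum {U : X.Opens} {n : ℕ} (d : Fin n → VectorField K U) : VectorField K U where
  der V hV := ∑ i, (d i).der V hV
  compat V W hV h b := by
    have : ∀ (s : X.Opens) (hs : s ≤ U) (c : Γ(X, s)), (∑ i, (d i).der s hs) c =
        ∑ i, (d i).der s hs c := fun s hs c =>
      map_sum (⟨⟨fun e : Derivation K Γ(X, s) Γ(X, s) => e c, rfl⟩, fun _ _ => rfl⟩ :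
        Derivation K Γ(X, s) Γ(X, s) →+ Γ(X, s)) _ _
    rw [this, this, map_sum]
    exact Finset.sum_congr rfl fun i _ => (d i).compat V W hV h b

lemma VectorField.sum_der {U : X.Opens} {n : ℕ} (d : Fin n → VectorField K U) {V : X.Opens}
    (hV : V ≤ U) (c : Γ(X, V)) : (VectorField.sum d).der V hV c = ∑ i, (d i).der V hV c :=
  map_sum (⟨⟨fun e : Derivation K Γ(X, V) Γ(X, V) => e c, rfl⟩, fun _ _ => rfl⟩ :
        Derivation K Γ(X, V) Γ(X, V) →+ Γ(X, V)) _ _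

/-! ### The ring of differential operators -/

variable (K) in
/-- The ring `D_X(U)`, as a type with a ring structure whose instances do not unfold. -/
def DOp (U : X.Opens) : Type u := D (X := X) K U

instance DOp.instRing (U : X.Opens) : Ring (DOp K U) := inferInstanceAs (Ring (D (X := X) K U))

/-- Restriction of differential operators. -/
def DOp.res {U V : X.Opens} (h : V ≤ U) : DOp K U →+* DOp K V := D.res (K := K) h

/-- Functions as differential operators. -/
def DOp.ofFun {U : X.Opens} : Γ(X, U) →+* DOp K U := D.ofFun (K := K)

/-- Derivations as differential operators. -/
def VectorField.toOp {U : X.Opens} (d : VectorField K U) : DOp K U := d.toD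

/-- The value of a differential operator on a function. -/
def DOp.eval {U : X.Opens} (V : X.Opens) (h : V ≤ U) (b : Γ(X, V)) : DOp K U →+ Γ(X, V) :=
  AddMonoidHom.mk' (fun P : D (X := X) K U => P.1 ⟨V, h⟩ b) fun _ _ => rfl

lemma DOp.ext {U : X.Opens} {P Q : DOp K U}
    (h : ∀ (V : X.Opens) (hV : V ≤ U) b, P.eval V hV b = Q.eval V hV b) : P = Q :=
  Subtype.ext (funext fun V => LinearMap.ext fun b => h V.1 V.2 b)

lemma DOp.eval_mul {U V : X.Opens} (h : V ≤ U) (P Q : DOp K U) (b : Γ(X, V)) :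
    DOp.eval V h b (P * Q) = DOp.eval V h (DOp.eval V h b Q) P := rfl

lemma DOp.eval_ofFun {U V : X.Opens} (h : V ≤ U) (a : Γ(X, U)) (b : Γ(X, V)) :
    DOp.eval V h b (DOp.ofFun a : DOp K U) = resO K h a * b := rfl

lemma DOp.eval_smul {U V : X.Opens} (h : V ≤ U) (P : DOp K U) (k : K) (b : Γ(X, V)) :
    DOp.eval V h (k • b) P = k • DOp.eval V h b P :=
  LinearMap.map_smul (P.1 ⟨V, h⟩) k b

lemma DOp.resO_eval {U V W : X.Opens} (h : V ≤ U) (h' : W ≤ V) (P : DOp K U) (b : Γ(X, V)) :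
    resO K h' (DOp.eval V h b P) = DOp.eval W (h'.trans h) (resO K h' b) P :=
  P.2.1 V W h h' b

lemma DOp.eval_res {U V W : X.Opens} (h : V ≤ U) (h' : W ≤ V) (P : DOp K U) (b : Γ(X, W)) :
    DOp.eval W h' b (DOp.res h P) = DOp.eval W (h'.trans h) b P := rfl

lemma DOp.res_ofFun {U V : X.Opens} (h : V ≤ U) (a : Γ(X, U)) :
    DOp.res h (DOp.ofFun a : DOp K U) = DOp.ofFun (resO K h a) := D.res_ofFun h a

lemma DOp.res_res {U V W : X.Opens} (h : V ≤ U) (h' : W ≤ V) (P : DOp K U) :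
    DOp.res h' (DOp.res h P) = DOp.res (h'.trans h) P := rfl

lemma DOp.res_self {U : X.Opens} (h : U ≤ U) (P : DOp K U) : DOp.res h P = P := rfl

lemma DOp.eq_of_locally {U : X.Opens} {P Q : DOp K U}
    (H : ∀ x ∈ U, ∃ (V : X.Opens) (h : V ≤ U), x ∈ V ∧ DOp.res h P = DOp.res h Q) : P = Q :=
  eq_of_locally_ab (DAb_isSheaf K X) H

lemma VectorField.toOp_sum {U : X.Opens} {n : ℕ} (d : Fin n → VectorField K U) :
    (VectorField.sum d).toOp = ∑ i, (d i).toOp := by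
  refine DOp.ext fun V hV b => ?_
  have h1 : (∑ i, (d i).toOp).eval V hV b = ∑ i, ((d i).toOp).eval V hV b :=
    map_sum (DOp.eval V hV b) _ _
  rw [h1]
  exact VectorField.sum_der d hV b

lemma VectorField.toOp_bracket {U : X.Opens} (d d' : VectorField K U) :
    (d.bracket d').toOp = d.toOp * d'.toOp - d'.toOp * d.toOp := by
  refine DOp.ext fun V hV b => ?_
  rw [map_sub]
  rfl

lemma VectorField.toOp_mul_ofFun {U : X.Opens} (d : VectorField K U) (a : Γ(X, U)) :
    d.toOp * DOp.ofFun a - DOp.ofFun a * d.toOp = DOp.ofFun (d.apply a) := by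
  refine DOp.ext fun V hV c => ?_
  rw [map_sub]
  change d.der V hV (resO K hV a * c) - resO K hV a * d.der V hV c =
    resO K hV (d.der U le_rfl a) * c
  rw [d.compat, Derivation.leibniz, smul_eq_mul, smul_eq_mul]
  ring

/-- The expansion `∂ = ∑ᵢ ∂(yᵢ) ηᵢ`. -/
lemma IsCoordinates.eq_sum {V : X.Opens} {n : ℕ} {y : Fin n → Γ(X, V)}
    {η : Fin n → VectorField K V} (h : IsCoordinates y η) (d : VectorField K V) :
    d = VectorField.sum fun i => (η i).smul (d.apply (y i)) := by
  refine h.der_eq le_rfl _ _ fun j => ?_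
  rw [resO_self, AlgHom.id_apply]
  refine ((VectorField.sum_der _ le_rfl (y j)).trans ?_).symm
  have : ∀ i, ((η i).smul (d.apply (y i))).der V le_rfl (y j) =
      d.apply (y i) * if i = j then 1 else 0 := by
    intro i
    change resO K le_rfl (d.apply (y i)) * (η i).apply (y j) = _
    rw [h.dual, resO_self, AlgHom.id_apply]
  simp only [this]
  simp

lemma IsCoordinates.toOp_eq_sum {V : X.Opens} {n : ℕ} {y : Fin n → Γ(X, V)}
    {η : Fin n → VectorField K V} (h : IsCoordinates y η) (d : VectorField K V) :
    d.toOp = ∑ i, DOp.ofFun (d.apply (y i)) * (η i).toOp := by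
  conv_lhs => rw [h.eq_sum d]
  rw [VectorField.toOp_sum]
  rfl

/-- The dual derivations of coordinates commute with each other. -/
lemma IsCoordinates.bracket_apply {V : X.Opens} {n : ℕ} {y : Fin n → Γ(X, V)}
    {η : Fin n → VectorField K V} (h : IsCoordinates y η) (i j k : Fin n) :
    ((η i).bracket (η j)).apply (y k) = 0 := by
  change (η i).apply ((η j).apply (y k)) - (η j).apply ((η i).apply (y k)) = 0
  have h0 : ∀ (d : VectorField K V) (P : Prop) [Decidable P],
      d.apply (if P then 1 else 0) = 0 := by
    intro d P _
    split_ifs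
    · exact (d.der V le_rfl).map_one_eq_zero
    · exact map_zero (d.der V le_rfl)
  rw [h.dual, h.dual, h0, h0, sub_zero]

lemma IsCoordinates.toOp_comm {V : X.Opens} {n : ℕ} {y : Fin n → Γ(X, V)}
    {η : Fin n → VectorField K V} (h : IsCoordinates y η) (i j : Fin n) :
    (η i).toOp * (η j).toOp = (η j).toOp * (η i).toOp := by
  rw [← sub_eq_zero, ← VectorField.toOp_bracket, h.toOp_eq_sum]
  refine Finset.sum_eq_zero fun k _ => ?_
  rw [h.bracket_apply, map_zero, zero_mul]

end Coordinates

end DConn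

end

noncomputable section

namespace DConn

/-! ### Contraction with derivations -/

section Contraction

variable {K : Type u} [Field K] {X : Scheme.{u}} [X.Over (Spec (CommRingCat.of K))]

lemma contractAlg_tmul {A E : Type u} [CommRing A] [Algebra K A] [AddCommGroup E] [Module A E]
    (d : Derivation K A A) (w : Ω[A⁄K]) (e : E) :
    contractAlg d (w ⊗ₜ[A] e) = d.liftKaehlerDifferential w • e := rfl

/-- Contraction can be computed locally, on representatives in the presheaf `Ω ⊗ E`. -/
lemma res_contract {U W : X.Opens} (h : W ≤ U) (d : VectorField K U) {E : X.Modules}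
    (s : Γ(Omega K E, U)) (x : (omegaPre K E).obj W)
    (hx : (omegaPre K E).toSheaf W x = res (Omega K E) h s) :
    res E h (contract d s) = contractAlg (E := Γ(E, W)) (d.der W h) x := by
  have hW : W ≤ cap U W := le_cap h le_rfl
  have h1 : res E h (contract d s) =
      res E hW (openExtSections E U W ((contractExt d E).app W (res (Omega K E) h s))) := by
    rw [app_res, openExtSections_res, contract, res_res, res_res]
  have h2 : (contractExt d E).app W ((omegaPre K E).toSheaf W x) = contractPre d E W x :=
    (omegaPre K E).lift_toSheaf (openExt E U) (contractPre d E) (contractPre_res d E)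
      (contractPre_smul d E) W x
  rw [h1, ← hx, h2]
  refine (contractAlg_kaehlerTensorMap (resO K hW) (res E hW) (res_smul E hW)
    (d.der (cap U W) (cap_le_left U W)) (d.der W h) (d.compat _ _ _ hW)
    ((omegaPre K E).res (cap_le_right U W) x)).symm.trans ?_
  refine congrArg (contractAlg (E := Γ(E, W)) (d.der W h)) ?_
  exact ((omegaPre K E).res_res _ _ _).trans ((omegaPre K E).res_self _ _)

lemma contract_dTmul {U : X.Opens} (d : VectorField K U) {E : X.Modules} (a : Γ(X, U))
    (e : Γ(E, U)) : contract d (dTmul a e) = d.apply a • e := by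
  have := contract_omegaTmul d a 1 e
  rwa [one_smul, one_mul] at this

/-- The sections of `Ω¹ ⊗ E` are locally finite sums of pure tensors. -/
lemma omega_locally {E : X.Modules} {U : X.Opens} (s : Γ(Omega K E, U)) {x : X} (hx : x ∈ U) :
    ∃ (V : X.Opens) (h : V ≤ U) (_ : x ∈ V) (y : (omegaPre K E).obj V), IsAffineOpen V ∧
      (omegaPre K E).toSheaf V y = res (Omega K E) h s := by
  obtain ⟨V, h, hxV, y, hy⟩ := (omegaPre K E).exists_toSheaf_eq s hx
  obtain ⟨W, ha, hW, hxW⟩ := exists_affine hxV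
  refine ⟨W, hW.trans h, hxW, (omegaPre K E).res hW y, ha, ?_⟩
  rw [PreMod.toSheaf_res, hy]
  exact res_res (Omega K E) _ _ _

lemma contract_res {U V : X.Opens} (h : V ≤ U) (d : VectorField K U) {E : X.Modules}
    (s : Γ(Omega K E, U)) : contract (d.res h) (res (Omega K E) h s) = res E h (contract d s) := by
  refine eq_of_locally E fun x hx => ?_
  obtain ⟨W, hW, hxW, y, -, hy⟩ := omega_locally (res (Omega K E) h s) hx
  refine ⟨W, hW, hxW, ?_⟩
  rw [res_contract hW _ _ y hy, res_res, res_contract (hW.trans h) _ _ y (by rw [hy, res_res])]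
  rfl

lemma contract_add {U : X.Opens} (d : VectorField K U) {E : X.Modules}
    (s t : Γ(Omega K E, U)) : contract d (s + t) = contract d s + contract d t := by
  simp only [contract, map_add]

/-- Contraction as an additive map. -/
def contractHom {U : X.Opens} (d : VectorField K U) (E : X.Modules) :
    Γ(Omega K E, U) →+ Γ(E, U) := AddMonoidHom.mk' (contract d) (contract_add d)

lemma contract_smul {U : X.Opens} (d : VectorField K U) {E : X.Modules} (a : Γ(X, U))
    (s : Γ(Omega K E, U)) : contract d (a • s) = a • contract d s := by
  rw [contract, Scheme.Modules.Hom.app_smul, openExtSections_smul K, res_smul (K := K), resO_resO,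
    resO_self]
  rfl

lemma contract_finsum {U : X.Opens} (d : VectorField K U) {E : X.Modules} {n : ℕ}
    (s : Fin n → Γ(Omega K E, U)) : contract d (∑ i, s i) = ∑ i, contract d (s i) :=
  map_sum (contractHom d E) _ _

lemma derivation_sum_lift {A : Type u} [CommRing A] [Algebra K A] {n : ℕ} (a : Fin n → A)
    (d : Derivation K A A) (η : Fin n → Derivation K A A) (h : ∀ b, d b = ∑ i, a i * η i b)
    (w : Ω[A⁄K]) :
    d.liftKaehlerDifferential w = ∑ i, a i * (η i).liftKaehlerDifferential w := by
  induction w using kaehler_induction with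
  | hd b => simp [h]
  | hadd x y hx hy => simp only [map_add, hx, hy, mul_add, Finset.sum_add_distrib]
  | hsmul c x hx =>
    simp only [map_smul, hx, smul_eq_mul, Finset.mul_sum]
    exact Finset.sum_congr rfl fun i _ => by ring

/-- In coordinates, `⟨∂, s⟩ = ∑ᵢ ∂(yᵢ) ⟨ηᵢ, s⟩`. -/
lemma IsCoordinates.contract_eq_sum {V : X.Opens} {n : ℕ} {y : Fin n → Γ(X, V)}
    {η : Fin n → VectorField K V} (h : IsCoordinates y η) (d : VectorField K V) {E : X.Modules}
    (s : Γ(Omega K E, V)) : contract d s = ∑ i, d.apply (y i) • contract (η i) s := by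
  refine eq_of_locally E fun x hx => ?_
  obtain ⟨W, hW, hxW, z, -, hz⟩ := omega_locally s hx
  refine ⟨W, hW, hxW, ?_⟩
  rw [map_sum, res_contract hW _ _ z hz]
  simp only [res_smul (K := K), res_contract hW _ _ z hz]
  have h1 : ∀ b, d.der W hW b = ∑ i, resO K hW (d.apply (y i)) * (η i).der W hW b := by
    intro b
    conv_lhs => rw [h.eq_sum d]
    rw [VectorField.sum_der]
    rfl
  change (Ω[Γ(X, W)⁄K] ⊗[Γ(X, W)] Γ(E, W)) at z
  clear hz
  induction z using TensorProduct.induction_on with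
  | zero => simp
  | tmul w e =>
    simp only [contractAlg_tmul, derivation_sum_lift _ _ _ h1, Finset.sum_smul, mul_smul]
  | add u v hu hv => simp only [map_add, hu, hv, smul_add, Finset.sum_add_distrib]

lemma kaehler_eq_sum {A : Type u} [CommRing A] [Algebra K A] {n : ℕ} (y : Fin n → A)
    (η : Fin n → Derivation K A A)
    (hy : Submodule.span A (Set.range fun i => KaehlerDifferential.D K A (y i)) = ⊤)
    (hη : ∀ i j, η i (y j) = if i = j then 1 else 0) (w : Ω[A⁄K]) :
    w = ∑ i, (η i).liftKaehlerDifferential w • KaehlerDifferential.D K A (y i) := by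
  have : (LinearMap.id : Ω[A⁄K] →ₗ[A] Ω[A⁄K]) =
      ∑ i, (η i).liftKaehlerDifferential.smulRight (KaehlerDifferential.D K A (y i)) := by
    refine LinearMap.ext_on_range hy fun j => ?_
    simp [hη]
  simpa using LinearMap.congr_fun this w

lemma IsCoordinates.dual_res {V : X.Opens} {n : ℕ} {y : Fin n → Γ(X, V)}
    {η : Fin n → VectorField K V} (h : IsCoordinates y η) {W : X.Opens} (hW : W ≤ V)
    (i j : Fin n) : (η i).der W hW (resO K hW (y j)) = if i = j then 1 else 0 := by
  have := (h.restrict hW).dual i j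
  exact this

/-- In coordinates, `s = ∑ᵢ dyᵢ ⊗ ⟨ηᵢ, s⟩`. -/
lemma IsCoordinates.omega_eq_sum {V : X.Opens} {n : ℕ} {y : Fin n → Γ(X, V)}
    {η : Fin n → VectorField K V} (h : IsCoordinates y η) {E : X.Modules}
    (s : Γ(Omega K E, V)) : s = ∑ i, dTmul (y i) (contract (η i) s) := by
  refine eq_of_locally (Omega K E) fun x hx => ?_
  obtain ⟨W, hW, hxW, z, ha, hz⟩ := omega_locally s hx
  refine ⟨W, hW, hxW, ?_⟩
  rw [map_sum, ← hz]
  have h1 : ∀ i, res (Omega K E) hW (dTmul (y i) (contract (η i) s)) =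
      (omegaPre K E).toSheaf W (KaehlerDifferential.D K _ (resO K hW (y i)) ⊗ₜ[Γ(X, W)]
        contractAlg (E := Γ(E, W)) ((η i).der W hW) z) := by
    intro i
    rw [dTmul, omegaTmul_res, kaehlerMap_D, res_contract hW _ _ z hz]
    rfl
  simp only [h1]
  refine Eq.trans ?_ (map_sum ((omegaPre K E).toSheaf W) _ _)
  refine congrArg ((omegaPre K E).toSheaf W) ?_
  clear hz h1
  change (Ω[Γ(X, W)⁄K] ⊗[Γ(X, W)] Γ(E, W)) at z
  induction z using TensorProduct.induction_on with
  | zero =>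
    simp only [map_zero, TensorProduct.tmul_zero]
    exact Finset.sum_const_zero.symm
  | tmul w e =>
    conv_lhs => rw [kaehler_eq_sum _ _ (h.span_eq_top W hW ha) (h.dual_res hW) w]
    rw [TensorProduct.sum_tmul]
    simp only [contractAlg_tmul, TensorProduct.smul_tmul]
    rfl
  | add u v hu hv =>
    refine (congrArg₂ (· + ·) hu hv).trans ?_
    simp only [map_add, TensorProduct.tmul_add]
    exact Finset.sum_add_distrib.symm

/-- A section of `Ω¹ ⊗ E` is determined by its contractions with local derivations. -/
lemma omega_ext [Smooth (X ↘ Spec (CommRingCat.of K))] {E : X.Modules} {U : X.Opens}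
    {s t : Γ(Omega K E, U)} (H : ∀ (V : X.Opens) (h : V ≤ U) (d : VectorField K V),
      contract d (res (Omega K E) h s) = contract d (res (Omega K E) h t)) : s = t := by
  refine eq_of_locally (Omega K E) fun x hx => ?_
  obtain ⟨V, -, hV, hxV, n, y, η, h⟩ := exists_coordinates_le (K := K) hx
  refine ⟨V, hV, hxV, ?_⟩
  rw [h.omega_eq_sum (res (Omega K E) hV s), h.omega_eq_sum (res (Omega K E) hV t)]
  simp only [H]

end Contraction

/-! ### The inclusion of `Ω¹ ⊗ E` into `P¹ ⊗ E` -/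

section Inclusion

variable {K : Type u} [Field K]

section Algebra

variable {A : Type u} [CommRing A] [Algebra K A]

/-- The map `A ⊗ A → Ω`, `a ⊗ b ↦ b da`. -/
def tensorToKaehler : A ⊗[K] A →ₗ[K] Ω[A⁄K] :=
  TensorProduct.lift (((LinearMap.lsmul A Ω[A⁄K]).restrictScalars₁₂ K K).flip.comp
    (KaehlerDifferential.D K A).toLinearMap)

lemma tensorToKaehler_tmul (a b : A) :
    tensorToKaehler (K := K) (a ⊗ₜ[K] b) = b • KaehlerDifferential.D K A a := rfl

lemma tensorToKaehler_mul (x y : A ⊗[K] A) : tensorToKaehler (x * y) =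
    Algebra.TensorProduct.lmul' K (S := A) x • tensorToKaehler y +
      Algebra.TensorProduct.lmul' K (S := A) y • tensorToKaehler x := by
  induction x with
  | zero => simp
  | add x x' hx hx' => simp only [add_mul, map_add, hx, hx', add_smul, smul_add]; abel
  | tmul a b =>
    induction y with
    | zero => simp
    | add y y' hy hy' => simp only [mul_add, map_add, hy, hy', add_smul, smul_add]; abel
    | tmul c d =>
      simp only [Algebra.TensorProduct.tmul_mul_tmul, tensorToKaehler_tmul, Derivation.leibniz,
        Algebra.TensorProduct.lmul'_apply_tmul, smul_add, smul_smul]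
      congr 2 <;> ring

/-- The retraction `P¹ → Ω`, `a ⊗ b ↦ b da`, linear for the right structure. -/
def PP.toKaehler : PP K A →+ Ω[A⁄K] :=
  QuotientAddGroup.lift ((KaehlerDifferential.ideal K A) ^ 2).toAddSubgroup
    tensorToKaehler.toAddMonoidHom (by
      intro x hx
      change tensorToKaehler x = 0
      rw [pow_two] at hx
      refine Submodule.mul_induction_on hx (fun a ha b hb => ?_) fun a b ha hb => ?_
      · have ha' : Algebra.TensorProduct.lmul' K (S := A) a = 0 := ha
        have hb' : Algebra.TensorProduct.lmul' K (S := A) b = 0 := hb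
        rw [tensorToKaehler_mul, ha', hb', zero_smul, zero_smul, add_zero]
      · rw [map_add, ha, hb, add_zero])

lemma PP.toKaehler_mk (x : A ⊗[K] A) : PP.toKaehler (PP.mk K A x) = tensorToKaehler x := rfl

lemma PP.toKaehler_right_mul (a : A) (p : PP K A) :
    PP.toKaehler (PP.right K A a * p) = a • PP.toKaehler p := by
  obtain ⟨x, rfl⟩ := Ideal.Quotient.mk_surjective p
  change PP.toKaehler (PP.mk K A (1 ⊗ₜ a) * PP.mk K A x) = a • PP.toKaehler (PP.mk K A x)
  rw [← map_mul, PP.toKaehler_mk, PP.toKaehler_mk, tensorToKaehler_mul, tensorToKaehler_tmul]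
  simp

lemma PP.toKaehler_ofKaehler (w : Ω[A⁄K]) : PP.toKaehler (PP.ofKaehler w) = w := by
  induction w using kaehler_induction with
  | hd b =>
    rw [PP.ofKaehler_D, map_sub]
    change tensorToKaehler (b ⊗ₜ 1) - tensorToKaehler (1 ⊗ₜ b) = _
    rw [tensorToKaehler_tmul, tensorToKaehler_tmul]
    simp
  | hadd x y hx hy => rw [map_add, map_add, hx, hy]
  | hsmul a x hx => rw [PP.ofKaehler_smul_right, PP.right_smul, PP.toKaehler_right_mul, hx]

variable {E : Type u} [AddCommGroup E] [Module A E]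

/-- The retraction `P¹ ⊗ E → Ω ⊗ E`, `(a ⊗ b) ⊗ e ↦ da ⊗ b e`. -/
def PPT.toKaehler : PPT K A E →+ Ω[A⁄K] ⊗[A] E :=
  PPT.lift (biadd (fun p e => PP.toKaehler p ⊗ₜ[A] e)
    (fun p q e => by rw [map_add, TensorProduct.add_tmul])
    (fun p e e' => TensorProduct.tmul_add _ e e'))
    (fun a p e => by
      simp only [biadd_apply]; rw [PP.toKaehler_right_mul, TensorProduct.smul_tmul])

lemma PPT.toKaehler_ofKaehler (x : Ω[A⁄K] ⊗[A] E) : PPT.toKaehler (PPT.ofKaehler x) = x := by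
  induction x using TensorProduct.induction_on with
  | zero => simp
  | tmul w e => simp [PPT.toKaehler, PP.toKaehler_ofKaehler]
  | add x y hx hy => simp only [map_add, hx, hy]

end Algebra

variable {X : Scheme.{u}} [X.Over (Spec (CommRingCat.of K))]

lemma omegaToParts_toSheaf (E : X.Modules) (U : X.Opens) (x : (omegaPre K E).obj U) :
    (omegaToParts K E).app U ((omegaPre K E).toSheaf U x) =
      (partsPre K E).toSheaf U (PPT.ofKaehler (E := Γ(E, U)) x) :=
  (omegaPre K E).lift_toSheaf _ _ _ _ U x

/-- The morphism `Ω¹ ⊗ E → P¹ ⊗ E` is injective, because its presheaf version has a (non linear)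
retraction. -/
lemma omegaToParts_injective (E : X.Modules) (U : X.Opens) :
    Function.Injective ((omegaToParts K E).app U) := by
  refine (injective_iff_map_eq_zero ((omegaToParts K E).app U).hom).mpr fun s hs => ?_
  refine eq_of_locally (Omega K E) fun x hx => ?_
  obtain ⟨V, hV, hxV, y, -, hy⟩ := omega_locally s hx
  have h1 : (partsPre K E).toSheaf V (PPT.ofKaehler (E := Γ(E, V)) y) = 0 := by
    rw [← omegaToParts_toSheaf, hy, app_res]
    exact (congrArg (res (Parts K E) hV) hs).trans (map_zero _)
  obtain ⟨W, hW, hxW, hz⟩ := (partsPre K E).exists_res_eq_zero _ h1 hxV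
  refine ⟨W, hW.trans hV, hxW, ?_⟩
  have h2 : PPT.ofKaehler (K := K) (E := Γ(E, W)) ((omegaPre K E).res hW y) = 0 :=
    (PPT.map_ofKaehler _ _ (res_smul E hW) y).symm.trans hz
  have h3 : (omegaPre K E).res hW y = 0 := by
    have := congrArg PPT.toKaehler h2
    exact (PPT.toKaehler_ofKaehler (E := Γ(E, W)) _).symm.trans (this.trans (map_zero _))
  have h4 := (omegaPre K E).toSheaf_res hW y
  rw [h3, hy] at h4
  rw [map_zero, ← res_res (Omega K E) hV hW]
  exact h4.symm.trans (map_zero _)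

end Inclusion

end DConn

end

noncomputable section

namespace DConn

/-! ### Generation of the differential operators by functions and derivations -/

section Generation

variable {K : Type u} [Field K] {X : Scheme.{u}} [X.Over (Spec (CommRingCat.of K))]

/-- The commutator `[P, a]` of a differential operator with a function. -/
def DOp.comm {U : X.Opens} (P : DOp K U) (a : Γ(X, U)) : DOp K U :=
  P * DOp.ofFun a - DOp.ofFun a * P

/-- Differential operators of order `< n`. -/
def DOp.OrderLT (n : ℕ) {U : X.Opens} (P : DOp K U) : Prop := OpFam.OrderLT n P.1

lemma DOp.res_comm {U V : X.Opens} (h : V ≤ U) (P : DOp K U) (a : Γ(X, U)) :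
    DOp.res h (DOp.comm P a) = DOp.comm (DOp.res h P) (resO K h a) := by
  rw [DOp.comm, map_sub, map_mul, map_mul, DOp.res_ofFun]; rfl

lemma DOp.orderLT_succ {n : ℕ} {U : X.Opens} {P : DOp K U} : DOp.OrderLT (n + 1) P ↔
    ∀ (V : X.Opens) (h : V ≤ U) (a : Γ(X, V)), DOp.OrderLT n (DOp.comm (DOp.res h P) a) := Iff.rfl

lemma DOp.orderLT_zero {U : X.Opens} {P : DOp K U} : DOp.OrderLT 0 P ↔ P = 0 :=
  ⟨fun h => Subtype.ext h, fun h => congrArg Subtype.val h⟩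

lemma DOp.OrderLT.comm {n : ℕ} {U : X.Opens} {P : DOp K U} (h : DOp.OrderLT (n + 1) P)
    (a : Γ(X, U)) : DOp.OrderLT n (DOp.comm P a) := h U le_rfl a

lemma DOp.OrderLT.res {n : ℕ} {U V : X.Opens} {P : DOp K U} (hP : DOp.OrderLT n P)
    (h : V ≤ U) : DOp.OrderLT n (DOp.res h P) := OpFam.OrderLT.restrict h hP

lemma DOp.OrderLT.add {n : ℕ} {U : X.Opens} {P Q : DOp K U} (hP : DOp.OrderLT n P)
    (hQ : DOp.OrderLT n Q) : DOp.OrderLT n (P + Q) := OpFam.OrderLT.add hP hQ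

lemma DOp.OrderLT.ofFun_mul {n : ℕ} {U : X.Opens} {P : DOp K U} (hP : DOp.OrderLT n P)
    (a : Γ(X, U)) : DOp.OrderLT n (DOp.ofFun a * P) := by
  cases n with
  | zero => rw [DOp.orderLT_zero] at *; rw [hP, mul_zero]
  | succ n =>
    have := OpFam.OrderLT.mul (OpFam.orderLT_ofFun (K := K) a) hP
    intro V h b
    have h1 := DOp.orderLT_succ.mp hP V h b
    have h2 : DOp.comm (DOp.res h (DOp.ofFun a * P)) b =
        DOp.ofFun (resO K h a) * DOp.comm (DOp.res h P) b := by
      rw [map_mul, DOp.res_ofFun, DOp.comm, DOp.comm, mul_sub, ← mul_assoc, ← mul_assoc,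
        ← mul_assoc,
        ← map_mul, ← map_mul, mul_comm b]
    change DOp.OrderLT n (DOp.comm (DOp.res h (DOp.ofFun a * P)) b)
    rw [h2]
    exact DOp.OrderLT.ofFun_mul h1 _

lemma DOp.orderLT_of_zero (n : ℕ) (U : X.Opens) : DOp.OrderLT n (0 : DOp K U) :=
  OpFam.OrderLT.zero n U

lemma DOp.OrderLT.neg {n : ℕ} {U : X.Opens} {P : DOp K U} (hP : DOp.OrderLT n P) :
    DOp.OrderLT n (-P) := by
  have := hP.ofFun_mul (-1)
  rwa [map_neg, map_one, neg_one_mul] at this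

lemma DOp.OrderLT.sub {n : ℕ} {U : X.Opens} {P Q : DOp K U} (hP : DOp.OrderLT n P)
    (hQ : DOp.OrderLT n Q) : DOp.OrderLT n (P - Q) := by
  rw [sub_eq_add_neg]; exact hP.add hQ.neg

lemma DOp.OrderLT.sum {n : ℕ} {U : X.Opens} {ι : Type*} (s : Finset ι) {P : ι → DOp K U}
    (hP : ∀ i ∈ s, DOp.OrderLT n (P i)) : DOp.OrderLT n (∑ i ∈ s, P i) :=
  Finset.sum_induction _ _ (fun _ _ => DOp.OrderLT.add) (DOp.orderLT_of_zero n U) hP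

/-- The order of a differential operator is a local notion. -/
lemma DOp.orderLT_of_locally (n : ℕ) {U : X.Opens} {P : DOp K U}
    (H : ∀ x ∈ U, ∃ (V : X.Opens) (h : V ≤ U), x ∈ V ∧ DOp.OrderLT n (DOp.res h P)) :
    DOp.OrderLT n P := by
  induction n generalizing U with
  | zero =>
    rw [DOp.orderLT_zero]
    refine DOp.eq_of_locally fun x hx => ?_
    obtain ⟨V, h, hxV, h0⟩ := H x hx
    exact ⟨V, h, hxV, (DOp.orderLT_zero.mp h0).trans (map_zero _).symm⟩
  | succ n ih =>
    refine DOp.orderLT_succ.mpr fun V h a => ih fun x hx => ?_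
    obtain ⟨W, hW, hxW, h0⟩ := H x (h hx)
    refine ⟨W ⊓ V, inf_le_right, ⟨hxW, hx⟩, ?_⟩
    rw [DOp.res_comm, DOp.res_res]
    exact DOp.orderLT_succ.mp h0 (W ⊓ V) inf_le_left _

lemma DOp.comm_mul_right {U : X.Opens} (P : DOp K U) (a b : Γ(X, U)) :
    DOp.comm P (a * b) = DOp.ofFun a * DOp.comm P b + DOp.ofFun b * DOp.comm P a +
      DOp.comm (DOp.comm P a) b := by
  simp only [DOp.comm, mul_sub, sub_mul, map_mul, mul_assoc]
  abel

lemma DOp.comm_add_right {U : X.Opens} (P : DOp K U) (a b : Γ(X, U)) :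
    DOp.comm P (a + b) = DOp.comm P a + DOp.comm P b := by
  simp only [DOp.comm, map_add, mul_add, add_mul]; abel

lemma DOp.comm_algebraMap {U : X.Opens} (P : DOp K U) (k : K) :
    DOp.comm P (algebraMap K Γ(X, U) k) = 0 := by
  refine sub_eq_zero.mpr (DOp.ext fun V hV b => ?_)
  rw [DOp.eval_mul, DOp.eval_mul, DOp.eval_ofFun, DOp.eval_ofFun, AlgHom.commutes,
    ← Algebra.smul_def, ← Algebra.smul_def, DOp.eval_smul]

/-- The symbol of an operator is a derivation: modulo operators of lower order, `[P, a]` is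
determined by the commutators of `P` with coordinates. -/
lemma IsCoordinates.orderLT_comm_sub {U : X.Opens} {m : ℕ} {y : Fin m → Γ(X, U)}
    {η : Fin m → VectorField K U} (h : IsCoordinates y η) {n : ℕ} {P : DOp K U}
    (hP : DOp.OrderLT (n + 2) P) (a : Γ(X, U)) :
    DOp.OrderLT n (DOp.comm P a - ∑ i, DOp.ofFun ((η i).apply a) * DOp.comm P (y i)) := by
  -- the case of an affine open subset
  have key : ∀ {U : X.Opens} {y : Fin m → Γ(X, U)} {η : Fin m → VectorField K U}
      (_ : IsAffineOpen U) (_ : IsCoordinates y η) {P : DOp K U}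
      (_ : DOp.OrderLT (n + 2) P) (a : Γ(X, U)),
      DOp.OrderLT n (DOp.comm P a - ∑ i, DOp.ofFun ((η i).apply a) * DOp.comm P (y i)) := by
    intro U y η ha h P hP a
    let _ : Module Γ(X, U) (DOp K U) :=
      Module.compHom _ (DOp.ofFun : Γ(X, U) →+* DOp K U)
    have smul_def : ∀ (b : Γ(X, U)) (Q : DOp K U), b • Q = DOp.ofFun b * Q :=
      fun _ _ => rfl
    -- modulo the operators `N` of lower order, `g` is a derivation of `Γ(X, U)` that vanishes on
    -- the coordinates, hence vanishes
    let N : Submodule Γ(X, U) (DOp K U) :=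
      { carrier := {Q | DOp.OrderLT n Q}
        zero_mem' := DOp.orderLT_of_zero n U
        add_mem' := fun h1 h2 => h1.add h2
        smul_mem' := fun b Q hQ => hQ.ofFun_mul b }
    let _ : Module K (DOp K U ⧸ N) := Module.compHom _ (algebraMap K Γ(X, U))
    have : IsScalarTower K Γ(X, U) (DOp K U ⧸ N) :=
      ⟨fun k b x => by rw [Algebra.smul_def, mul_smul]; rfl⟩
    let g : Γ(X, U) → DOp K U := fun b =>
      DOp.comm P b - ∑ i, DOp.ofFun ((η i).apply b) * DOp.comm P (y i)
    have hg_add : ∀ b c, g (b + c) = g b + g c := by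
      intro b c
      have : ∀ i, (η i).apply (b + c) = (η i).apply b + (η i).apply c := fun i =>
        map_add ((η i).der U le_rfl) b c
      simp only [g, DOp.comm_add_right, this, map_add, add_mul, Finset.sum_add_distrib]
      abel
    have hg_mul : ∀ b c, g (b * c) = b • g c + c • g b + DOp.comm (DOp.comm P b) c := by
      intro b c
      have : ∀ i, (η i).apply (b * c) = b * (η i).apply c + c * (η i).apply b := fun i =>
        (η i).der U le_rfl |>.leibniz b c
      simp only [g, DOp.comm_mul_right, this, map_add, add_mul, Finset.sum_add_distrib, smul_def,
        mul_sub, Finset.mul_sum, map_mul, mul_assoc]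
      abel
    have hg_alg : ∀ k : K, g (algebraMap K _ k) = 0 := by
      intro k
      have : ∀ i, (η i).apply (algebraMap K _ k) = 0 := fun i =>
        ((η i).der U le_rfl).map_algebraMap k
      simp only [g, this, DOp.comm_algebraMap, map_zero, zero_mul, Finset.sum_const_zero, sub_zero]
    have hmk_mul : ∀ b c, N.mkQ (g (b * c)) = b • N.mkQ (g c) + c • N.mkQ (g b) := by
      intro b c
      have h0 : N.mkQ (DOp.comm (DOp.comm P b) c) = 0 :=
        (Submodule.Quotient.mk_eq_zero N).mpr ((hP.comm b).comm c)
      rw [hg_mul, map_add, h0, add_zero, map_add, map_smul, map_smul]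
    let δ : Derivation K Γ(X, U) (DOp K U ⧸ N) := Derivation.mk'
      { toFun := fun b => N.mkQ (g b)
        map_add' := fun b c => by rw [hg_add, map_add]
        map_smul' := fun k b => by
          rw [Algebra.smul_def, hmk_mul, hg_alg, map_zero, smul_zero, add_zero]; rfl } hmk_mul
    have hδ : δ = 0 := by
      have hs := h.span_eq_top U le_rfl ha
      simp only [resO_self, AlgHom.id_apply] at hs
      refine derivation_ext_of_span y hs fun j => ?_
      have h0 : g (y j) = 0 := by
        simp only [g, h.dual]
        simp
      change N.mkQ (g (y j)) = 0
      rw [h0, map_zero]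
    exact (Submodule.Quotient.mk_eq_zero N).mp (congrArg (fun e => e a) hδ)
  refine DOp.orderLT_of_locally n fun x hx => ?_
  obtain ⟨V, ha, hV, hxV⟩ := exists_affine hx
  refine ⟨V, hV, hxV, ?_⟩
  have := key ha (h.restrict hV) (hP.res hV) (resO K hV a)
  rw [map_sub, map_sum, DOp.res_comm]
  simp only [map_mul, DOp.res_ofFun, DOp.res_comm]
  convert this using 6 with i
  exact (η i).compat _ _ _ _ _

/-- Euler's formula: up to operators of lower order, `∑ᵢ [P, yᵢ] ηᵢ = n P` for `P` of order `n`. -/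
lemma IsCoordinates.orderLT_euler {U : X.Opens} {m : ℕ} {y : Fin m → Γ(X, U)}
    {η : Fin m → VectorField K U} (h : IsCoordinates y η) {n : ℕ} {P : DOp K U}
    (hP : DOp.OrderLT (n + 1) P) : DOp.OrderLT n (∑ i, DOp.comm P (y i) * (η i).toOp - n • P) := by
  induction n generalizing U with
  | zero =>
    rw [DOp.orderLT_zero, zero_smul, sub_zero]
    refine Finset.sum_eq_zero fun i _ => ?_
    rw [DOp.orderLT_zero.mp (hP.comm (y i)), zero_mul]
  | succ n ih =>
    -- the commutator with a function, on `U` itself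
    have key : ∀ {U : X.Opens} {y : Fin m → Γ(X, U)} {η : Fin m → VectorField K U}
        (_ : IsCoordinates y η) {P : DOp K U} (_ : DOp.OrderLT (n + 2) P) (a : Γ(X, U)),
        DOp.OrderLT n (DOp.comm (∑ i, DOp.comm P (y i) * (η i).toOp - (n + 1) • P) a) := by
      intro U y η h P hP a
      have h1 := ih h (hP.comm a)
      have h2 := h.orderLT_comm_sub hP a
      have h3 : DOp.OrderLT n (∑ i, DOp.comm (DOp.comm P (y i)) ((η i).apply a)) :=
        DOp.OrderLT.sum _ fun i _ => (hP.comm _).comm _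
      convert (h1.add h3).sub h2 using 1
      have e1 : ∀ i, DOp.comm (DOp.comm P (y i) * (η i).toOp) a =
          DOp.comm (DOp.comm P a) (y i) * (η i).toOp +
            (DOp.comm (DOp.comm P (y i)) ((η i).apply a) +
            DOp.ofFun ((η i).apply a) * DOp.comm P (y i)) := by
        intro i
        have e2 : DOp.comm (DOp.comm P a) (y i) = DOp.comm (DOp.comm P (y i)) a := by
          have := congrArg (DOp.ofFun (K := K)) (mul_comm a (y i))
          simp only [map_mul] at this
          simp only [DOp.comm, mul_sub, sub_mul, mul_assoc, this]
          simp only [← mul_assoc, this]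
          abel
        rw [e2, ← VectorField.toOp_mul_ofFun]
        generalize DOp.comm P (y i) = Q
        simp only [DOp.comm, ← VectorField.toOp_mul_ofFun, mul_sub, sub_mul, mul_assoc]
        abel
      have e3 : DOp.comm (∑ i, DOp.comm P (y i) * (η i).toOp - (n + 1) • P) a =
          ∑ i, DOp.comm (DOp.comm P (y i) * (η i).toOp) a - (n + 1) • DOp.comm P a := by
        simp only [DOp.comm, sub_mul, mul_sub, Finset.sum_mul, Finset.mul_sum,
          Finset.sum_sub_distrib, smul_sub, smul_mul_assoc, mul_smul_comm]
        abel
      rw [e3]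
      simp only [e1, Finset.sum_add_distrib, add_smul, one_smul]
      abel
    refine DOp.orderLT_succ.mpr fun V hV a => ?_
    have := key (h.restrict hV) (hP.res hV) a
    rw [map_sub, map_sum, map_nsmul]
    simp only [map_mul, DOp.res_comm]
    exact this

lemma DOp.eq_ofFun_of_orderLT_one {U : X.Opens} {P : DOp K U} (hP : DOp.OrderLT 1 P) :
    P = DOp.ofFun (DOp.eval U le_rfl 1 P) := by
  refine DOp.ext fun V hV b => ?_
  have h1 := DOp.orderLT_zero.mp (DOp.orderLT_succ.mp hP V hV b)
  have h2 := congrArg (DOp.eval V le_rfl 1) h1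
  rw [DOp.comm, map_sub, map_zero, DOp.eval_mul, DOp.eval_mul, DOp.eval_ofFun, DOp.eval_ofFun,
    resO_self, AlgHom.id_apply, mul_one, sub_eq_zero, DOp.eval_res, DOp.eval_res] at h2
  rw [h2, DOp.eval_ofFun, DOp.resO_eval, map_one, mul_comm]

/-- In characteristic `0`, operators of finite order on a coordinate neighbourhood are generated by
functions and the coordinate derivations. -/
lemma IsCoordinates.mem_closure [CharZero K] {U : X.Opens} {m : ℕ} {y : Fin m → Γ(X, U)}
    {η : Fin m → VectorField K U} (h : IsCoordinates y η) {n : ℕ} {P : DOp K U}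
    (hP : DOp.OrderLT n P) :
    P ∈ Subring.closure (Set.range (DOp.ofFun : Γ(X, U) → DOp K U) ∪
      Set.range fun i => (η i).toOp) := by
  have hfun : ∀ a, (DOp.ofFun a : DOp K U) ∈ Subring.closure
      (Set.range (DOp.ofFun : Γ(X, U) → DOp K U) ∪ Set.range fun i => (η i).toOp) :=
    fun a => Subring.subset_closure (Or.inl ⟨a, rfl⟩)
  induction n generalizing P with
  | zero => rw [DOp.orderLT_zero.mp hP]; exact zero_mem _
  | succ n ih =>
    rcases Nat.eq_zero_or_pos n with rfl | hn
    · rw [DOp.eq_ofFun_of_orderLT_one hP]; exact hfun _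
    · have h1 := ih (h.orderLT_euler hP)
      have h2 : ∑ i, DOp.comm P (y i) * (η i).toOp ∈ Subring.closure
          (Set.range (DOp.ofFun : Γ(X, U) → DOp K U) ∪ Set.range fun i => (η i).toOp) :=
        sum_mem fun i _ => mul_mem (ih (hP.comm _)) (Subring.subset_closure (Or.inr ⟨i, rfl⟩))
      have h3 := mul_mem (hfun (algebraMap K Γ(X, U) (n : K)⁻¹)) (sub_mem h2 h1)
      rw [sub_sub_cancel] at h3
      convert h3 using 1
      rw [nsmul_eq_mul, ← mul_assoc, ← map_natCast (DOp.ofFun : Γ(X, U) →+* DOp K U),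
        ← map_mul, ← map_natCast (algebraMap K Γ(X, U)), ← map_mul, inv_mul_cancel₀, map_one,
        map_one, one_mul]
      exact_mod_cast hn.ne'

/-- A local property of differential operators which holds for functions and derivations, and is
stable under sums and products, holds for all differential operators. -/
theorem DOp.induction [CharZero K] [Smooth (X ↘ Spec (CommRingCat.of K))]
    {p : ∀ U : X.Opens, DOp K U → Prop}
    (hloc : ∀ (U : X.Opens) (P : DOp K U),
      (∀ x ∈ U, ∃ (V : X.Opens) (h : V ≤ U), x ∈ V ∧ p V (DOp.res h P)) → p U P)
    (hfun : ∀ (U : X.Opens) (a : Γ(X, U)), p U (DOp.ofFun a))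
    (hvec : ∀ (U : X.Opens) (d : VectorField K U), p U d.toOp)
    (hadd : ∀ (U : X.Opens) (P Q : DOp K U), p U P → p U Q → p U (P + Q))
    (hmul : ∀ (U : X.Opens) (P Q : DOp K U), p U P → p U Q → p U (P * Q))
    {U : X.Opens} (P : DOp K U) : p U P := by
  refine hloc U P fun x hx => ?_
  obtain ⟨V, hV, hxV, n, hn⟩ := P.2.2 x hx
  obtain ⟨W, -, hW, hxW, m, y, η, h⟩ := exists_coordinates_le (K := K) hxV
  refine ⟨W, hW.trans hV, hxW, ?_⟩
  have h1 : DOp.OrderLT n (DOp.res (hW.trans hV) P) := OpFam.OrderLT.restrict hW hn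
  refine Subring.closure_induction (p := fun Q _ => p W Q) ?_ ?_ ?_ ?_ ?_ ?_ (h.mem_closure h1)
  · rintro _ (⟨a, rfl⟩ | ⟨i, rfl⟩)
    · exact hfun _ _
    · exact hvec _ _
  · rw [← map_zero DOp.ofFun]; exact hfun _ _
  · rw [← map_one DOp.ofFun]; exact hfun _ _
  · exact fun P Q _ _ => hadd W P Q
  · intro P _ hP
    rw [← neg_one_mul, ← map_one DOp.ofFun, ← map_neg]
    exact hmul _ _ _ (hfun _ _) hP
  · exact fun P Q _ _ => hmul W P Q

end Generation

end DConn

end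

noncomputable section

namespace DConn

/-! ### Normally ordered expressions in functions and commuting derivations -/

section Weyl

variable {A R S : Type*} [CommRing A] [Ring R] [Ring S] (ι : A →+* R) {n : ℕ} (D : Fin n → R)

/-- The span of the products `a D_{i₁} ⋯ D_{iₖ}` with exactly `k` factors `D_i`. -/
def wordSpan : ℕ → Submodule ℤ R
  | 0 => LinearMap.range ι.toAddMonoidHom.toIntLinearMap
  | k + 1 => ⨆ i, (wordSpan k).map (LinearMap.mulRight ℤ (D i))

lemma fun_mem_wordSpan (a : A) : ι a ∈ wordSpan ι D 0 := ⟨a, rfl⟩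

lemma mul_mem_wordSpan {k : ℕ} {s : R} (hs : s ∈ wordSpan ι D k) (i : Fin n) :
    s * D i ∈ wordSpan ι D (k + 1) :=
  Submodule.mem_iSup_of_mem i ⟨s, hs, rfl⟩

lemma wordSpan_induction {p : ℕ → R → Prop} (h0 : ∀ a, p 0 (ι a))
    (hadd : ∀ k s t, p k s → p k t → p k (s + t)) (hzero : ∀ k, p k 0)
    (hmul : ∀ k s i, s ∈ wordSpan ι D k → p k s → p (k + 1) (s * D i)) {k : ℕ} {s : R}
    (hs : s ∈ wordSpan ι D k) : p k s := by
  induction k generalizing s with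
  | zero => obtain ⟨a, rfl⟩ := hs; exact h0 a
  | succ k ih =>
    refine Submodule.iSup_induction _ (motive := p (k + 1)) hs ?_ (hzero _) (hadd _)
    rintro i _ ⟨s, hs, rfl⟩
    exact hmul k s i hs (ih hs)

/-- The span of the normally ordered products with at most `N` factors `D_i`. -/
def wordsUpTo : ℕ → Submodule ℤ R
  | 0 => wordSpan ι D 0
  | k + 1 => wordsUpTo k ⊔ wordSpan ι D (k + 1)

lemma wordSpan_le_wordsUpTo (k : ℕ) : wordSpan ι D k ≤ wordsUpTo ι D k := by
  cases k with
  | zero => exact le_rfl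
  | succ k => exact le_sup_right

lemma wordsUpTo_mono : Monotone (wordsUpTo ι D) :=
  monotone_nat_of_le_succ fun _ => le_sup_left

lemma wordsUpTo_induction {p : R → Prop} (hadd : ∀ s t, p s → p t → p (s + t)) {N : ℕ}
    (hw : ∀ k ≤ N, ∀ s ∈ wordSpan ι D k, p s) {s : R} (hs : s ∈ wordsUpTo ι D N) : p s := by
  induction N generalizing s with
  | zero => exact hw 0 le_rfl s hs
  | succ N ih =>
    obtain ⟨t, ht, u, hu, rfl⟩ := Submodule.mem_sup.mp hs
    exact hadd _ _ (ih (fun k hk => hw k (hk.trans N.le_succ)) ht) (hw _ le_rfl u hu)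

/-- The elements `D_i` of `R` commute with each other, and their commutators with the functions
`ι a` are the functions `ι (δ_i a)`, where `δ_i (x_j)` is the Kronecker symbol. -/
structure IsWeylSystem (δ : Fin n → A → A) (x : Fin n → A) : Prop where
  comm : ∀ i j, D i * D j = D j * D i
  mul_fun : ∀ i a, D i * ι a = ι a * D i + ι (δ i a)
  dual : ∀ i j, δ i (x j) = if i = j then 1 else 0

variable {ι D} {δ : Fin n → A → A} {x : Fin n → A}

lemma fun_mul_mem_wordSpan (a : A) {k : ℕ} {s : R} (hs : s ∈ wordSpan ι D k) :
    ι a * s ∈ wordSpan ι D k := by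
  refine wordSpan_induction ι D (p := fun k s => ι a * s ∈ wordSpan ι D k)
    (fun b => ⟨a * b, map_mul ι a b⟩) ?_ ?_ ?_ hs
  · intro k s t hs ht; rw [mul_add]; exact add_mem hs ht
  · intro k; rw [mul_zero]; exact zero_mem _
  · intro k s i _ hs; rw [← mul_assoc]; exact mul_mem_wordSpan ι D hs i

namespace IsWeylSystem

/-- Moving `D_i` to the right across functions and the other `D_j` produces only shorter words. -/
lemma mul_mem (H : IsWeylSystem ι D δ x) (i : Fin n) {k : ℕ} {s : R} (hs : s ∈ wordSpan ι D k) :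
    D i * s ∈ wordSpan ι D (k + 1) ⊔ wordSpan ι D k := by
  refine wordSpan_induction ι D
    (p := fun k s => D i * s ∈ wordSpan ι D (k + 1) ⊔ wordSpan ι D k) ?_ ?_ ?_ ?_ hs
  · intro a
    rw [H.mul_fun]
    exact Submodule.add_mem_sup (mul_mem_wordSpan ι D (fun_mem_wordSpan ι D a) i)
      (fun_mem_wordSpan ι D _)
  · intro k s t hs ht; rw [mul_add]; exact add_mem hs ht
  · intro k; rw [mul_zero]; exact zero_mem _
  · intro k s j _ hs
    obtain ⟨t, ht, u, hu, htu⟩ := Submodule.mem_sup.mp hs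
    rw [← mul_assoc, ← htu, add_mul]
    exact Submodule.add_mem_sup (mul_mem_wordSpan ι D ht j) (mul_mem_wordSpan ι D hu j)

/-- Every element of the subring generated by the functions and the `D_i` is a combination of
normally ordered products. -/
lemma mem_wordsUpTo (H : IsWeylSystem ι D δ x) {s : R}
    (hs : s ∈ Subring.closure (Set.range ι ∪ Set.range D)) :
    ∃ N, s ∈ wordsUpTo ι D N := by
  have key : ∀ t, (∃ N, t ∈ wordsUpTo ι D N) → ∃ N, s * t ∈ wordsUpTo ι D N := by
    refine Subring.closure_induction (p := fun s _ => ∀ t, (∃ N, t ∈ wordsUpTo ι D N) →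
      ∃ N, s * t ∈ wordsUpTo ι D N) ?_ ?_ ?_ ?_ ?_ ?_ hs
    · rintro _ (⟨a, rfl⟩ | ⟨i, rfl⟩) t ⟨N, ht⟩
      · refine ⟨N, wordsUpTo_induction ι D (p := fun t => ι a * t ∈ wordsUpTo ι D N) ?_ ?_ ht⟩
        · intro s t hs ht; rw [mul_add]; exact add_mem hs ht
        · exact fun k hk s hs => wordsUpTo_mono ι D hk (wordSpan_le_wordsUpTo ι D k
            (fun_mul_mem_wordSpan a hs))
      · refine ⟨N + 1, wordsUpTo_induction ι D (p := fun t => D i * t ∈ wordsUpTo ι D (N + 1))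
          ?_ ?_ ht⟩
        · intro s t hs ht; rw [mul_add]; exact add_mem hs ht
        · intro k hk s hs
          refine (sup_le ?_ ?_ : _ ≤ wordsUpTo ι D (N + 1)) (H.mul_mem i hs)
          · exact (wordSpan_le_wordsUpTo ι D _).trans (wordsUpTo_mono ι D (Nat.succ_le_succ hk))
          · exact (wordSpan_le_wordsUpTo ι D _).trans (wordsUpTo_mono ι D (hk.trans N.le_succ))
    · rintro t -; exact ⟨0, by rw [zero_mul]; exact zero_mem _⟩
    · intro t ht; rwa [one_mul]
    · intro a b _ _ ha hb t ht
      obtain ⟨M, hM⟩ := ha t ht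
      obtain ⟨N, hN⟩ := hb t ht
      refine ⟨max M N, ?_⟩
      rw [add_mul]
      exact add_mem (wordsUpTo_mono ι D (le_max_left _ _) hM)
        (wordsUpTo_mono ι D (le_max_right _ _) hN)
    · intro a _ ha t ht
      obtain ⟨M, hM⟩ := ha t ht
      exact ⟨M, by rw [neg_mul]; exact neg_mem hM⟩
    · intro a b _ _ ha hb t ht
      rw [mul_assoc]
      exact ha _ (hb t ht)
  have := key 1 ⟨0, ⟨1, map_one ι⟩⟩
  rwa [mul_one] at this

lemma comm_mul (H : IsWeylSystem ι D δ x) (s : R) (i j : Fin n) :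
    s * D j * ι (x i) - ι (x i) * (s * D j) =
    (s * ι (x i) - ι (x i) * s) * D j + if j = i then s else 0 := by
  rw [mul_assoc, H.mul_fun, H.dual]
  split_ifs
  · simp only [mul_add, sub_mul, mul_assoc, map_one, mul_one]; abel
  · simp only [map_zero, add_zero, sub_mul, mul_assoc]

/-- The commutator with `x_i` is a formal derivative with respect to `D_i`: it lowers the length of
words by one. -/
lemma comm_mem_wordsUpTo (H : IsWeylSystem ι D δ x) (i : Fin n) {N : ℕ} {s : R}
    (hs : s ∈ wordsUpTo ι D (N + 1)) :
    s * ι (x i) - ι (x i) * s ∈ wordsUpTo ι D N := by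
  have key : ∀ (k : ℕ) (s : R), s ∈ wordSpan ι D k →
      (k = 0 → s * ι (x i) - ι (x i) * s = 0) ∧
        ∀ l, k = l + 1 → s * ι (x i) - ι (x i) * s ∈ wordSpan ι D l := by
    intro k s hs
    refine wordSpan_induction ι D (p := fun k s => (k = 0 → s * ι (x i) - ι (x i) * s = 0) ∧
        ∀ l, k = l + 1 → s * ι (x i) - ι (x i) * s ∈ wordSpan ι D l) ?_ ?_ ?_ ?_ hs
    · intro a
      refine ⟨fun _ => ?_, fun l hl => by omega⟩
      rw [← map_mul, ← map_mul, mul_comm, sub_self]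
    · intro k s t hs ht
      have : (s + t) * ι (x i) - ι (x i) * (s + t) = (s * ι (x i) - ι (x i) * s) +
        (t * ι (x i) - ι (x i) * t) := by rw [add_mul, mul_add]; abel
      rw [this]
      exact ⟨fun h => by rw [hs.1 h, ht.1 h, add_zero], fun l hl => add_mem (hs.2 l hl) (ht.2 l hl)⟩
    · intro k
      rw [zero_mul, mul_zero, sub_zero]
      exact ⟨fun _ => rfl, fun _ _ => zero_mem _⟩
    · intro k s j hs h
      refine ⟨fun h => by omega, fun l hl => ?_⟩
      obtain rfl : k = l := by omega
      rw [H.comm_mul]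
      refine add_mem ?_ ?_
      · cases k with
        | zero => rw [h.1 rfl, zero_mul]; exact zero_mem _
        | succ k => exact mul_mem_wordSpan ι D (h.2 k rfl) j
      · split_ifs
        exacts [hs, zero_mem _]
  refine wordsUpTo_induction ι D
    (p := fun s => s * ι (x i) - ι (x i) * s ∈ wordsUpTo ι D N) ?_ ?_ hs
  · intro s t hs ht
    have : (s + t) * ι (x i) - ι (x i) * (s + t) = (s * ι (x i) - ι (x i) * s) +
      (t * ι (x i) - ι (x i) * t) := by rw [add_mul, mul_add]; abel
    rw [this]
    exact add_mem hs ht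
  · intro k hk s hs
    cases k with
    | zero => rw [(key 0 s hs).1 rfl]; exact zero_mem _
    | succ k =>
      exact wordsUpTo_mono ι D (Nat.succ_le_succ_iff.mp hk)
        (wordSpan_le_wordsUpTo ι D k ((key _ s hs).2 k rfl))

variable (ι D x) in
/-- The Euler operator `s ↦ ∑ᵢ [s, xᵢ] D_i`. -/
def euler : R →ₗ[ℤ] R :=
  (AddMonoidHom.mk' (fun s => ∑ i, (s * ι (x i) - ι (x i) * s) * D i) fun s t => by
    rw [← Finset.sum_add_distrib]
    exact Finset.sum_congr rfl fun i _ => by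
      rw [← add_mul, add_mul, mul_add]; abel_nf).toIntLinearMap

lemma euler_apply (s : R) : euler ι D x s = ∑ i, (s * ι (x i) - ι (x i) * s) * D i := rfl

lemma euler_mul (H : IsWeylSystem ι D δ x) (s : R) (j : Fin n) :
    euler ι D x (s * D j) = euler ι D x s * D j + s * D j := by
  simp only [euler_apply, H.comm_mul, add_mul, Finset.sum_add_distrib, Finset.sum_mul]
  congr 1
  · exact Finset.sum_congr rfl fun i _ => by rw [mul_assoc, H.comm j i, mul_assoc]
  · simp

/-- Words with `k` factors `D_i` are eigenvectors of the Euler operator. -/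
lemma euler_eq (H : IsWeylSystem ι D δ x) {k : ℕ} {s : R} (hs : s ∈ wordSpan ι D k) :
    euler ι D x s = (k : ℤ) • s := by
  refine wordSpan_induction ι D (p := fun k s => euler ι D x s = (k : ℤ) • s) ?_ ?_ ?_ ?_ hs
  · intro a
    rw [euler_apply, Nat.cast_zero, zero_smul]
    refine Finset.sum_eq_zero fun i _ => ?_
    rw [← map_mul, ← map_mul, mul_comm, sub_self, zero_mul]
  · intro k s t hs ht; rw [map_add, hs, ht, smul_add]
  · intro k; rw [map_zero, smul_zero]
  · intro k s i _ hs
    rw [H.euler_mul, hs, Nat.cast_succ, add_smul, one_smul, smul_mul_assoc]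

/-- An element of the subring generated by the functions and the `D_i` is zero if its image under
`π` is, as soon as functions can be recovered from their images under `π`. The proof is by
induction on the length of words: commutators with the `x_i` are shorter and still map to zero, and
an element commuting with all `x_i` is a function, because words of length `k` are Euler eigenvectors with eigenvalue `k` and
eigenspaces are independent. -/
theorem eq_zero_of_map_eq_zero (H : IsWeylSystem ι D δ x) [Module.IsTorsionFree ℤ R]
    (π : R →+* S) (ε : S →+ A)
    (hε : ∀ a, ε (π (ι a)) = a) {s : R}
    (hs : s ∈ Subring.closure (Set.range ι ∪ Set.range D)) (h0 : π s = 0) : s = 0 := by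
  have hzero : ∀ s ∈ wordSpan ι D 0, π s = 0 → s = 0 := by
    rintro _ ⟨a, rfl⟩ ha
    have h1 : ε (π (ι a)) = 0 := (congrArg ε ha).trans (map_zero ε)
    rw [hε] at h1
    rw [h1, map_zero]
  obtain ⟨N, hN⟩ := H.mem_wordsUpTo hs
  clear hs
  induction N generalizing s with
  | zero => exact hzero s hN h0
  | succ N ih =>
    -- the commutators with the `xᵢ` vanish by induction, so `s` has Euler eigenvalue zero
    have h1 : ∀ i, s * ι (x i) - ι (x i) * s = 0 := fun i =>
      ih (by rw [map_sub, map_mul, map_mul, h0, zero_mul, mul_zero, sub_zero])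
        (H.comm_mem_wordsUpTo i hN)
    have h2 : euler ι D x s = 0 := by
      rw [euler_apply]
      exact Finset.sum_eq_zero fun i _ => by rw [h1, zero_mul]
    have h3 : wordsUpTo ι D (N + 1) ≤ wordSpan ι D 0 ⊔
        ⨆ μ : ℤ, ⨆ _ : μ ≠ 0, Module.End.eigenspace (euler ι D x) μ := by
      intro t ht
      refine wordsUpTo_induction ι D (fun _ _ => add_mem) (fun k hk t ht => ?_) ht
      cases k with
      | zero => exact Submodule.mem_sup_left ht
      | succ k =>
        refine Submodule.mem_sup_right (Submodule.mem_iSup_of_mem ((k + 1 : ℕ) : ℤ)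
          (Submodule.mem_iSup_of_mem (by omega) ?_))
        exact Module.End.mem_eigenspace_iff.mpr (H.euler_eq ht)
    obtain ⟨t, ht, u, hu, htu⟩ := Submodule.mem_sup.mp (h3 hN)
    have h4 : u ∈ Module.End.eigenspace (euler ι D x) 0 := by
      rw [Module.End.mem_eigenspace_iff, zero_smul]
      have h5 := H.euler_eq ht
      rw [Nat.cast_zero, zero_smul] at h5
      have h6 := congrArg (euler ι D x) htu
      rwa [map_add, h5, h2, zero_add] at h6
    -- `u` is a sum of eigenvectors with nonzero eigenvalues and has eigenvalue zero
    have h7 : u = 0 := Submodule.disjoint_def.mp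
      (Module.End.eigenspaces_iSupIndep (euler ι D x) 0) u h4 hu
    rw [h7, add_zero] at htu
    exact hzero s (htu ▸ ht) h0

end IsWeylSystem

end Weyl

end DConn

end

noncomputable section

namespace DConn

/-! ### From integrable connections to `D`-modules -/

section ConnectionToModule

variable {K : Type u} [Field K] {X : Scheme.{u}} [X.Over (Spec (CommRingCat.of K))]
  {E : X.Modules}

/-- The operator `Δ_∂`. -/
def Connection.alongEnd (c : Connection K E) {U : X.Opens} (d : VectorField K U) :
    AddMonoid.End Γ(E, U) := (contractHom d E).comp c.apply

lemma Connection.along_res (c : Connection K E) {U V : X.Opens} (h : V ≤ U) (d : VectorField K U)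
    (e : Γ(E, U)) : c.along (d.res h) (res E h e) = res E h (c.along d e) := by
  rw [Connection.along, c.apply_res, contract_res]; rfl

lemma Connection.along_smul (c : Connection K E) {U : X.Opens} (d : VectorField K U)
    (a : Γ(X, U)) (e : Γ(E, U)) : c.along d (a • e) = a • c.along d e + d.apply a • e := by
  rw [Connection.along, c.apply_smul, contract_add, contract_smul, contract_dTmul]; rfl

lemma Connection.along_add (c : Connection K E) {U : X.Opens} (d : VectorField K U)
    (e e' : Γ(E, U)) : c.along d (e + e') = c.along d e + c.along d e' :=
  (c.alongEnd d).map_add e e'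

/-- Functions as pairs of operators on `O_X` and on `E`. -/
def funPair (E : X.Modules) (U : X.Opens) : Γ(X, U) →+* DOp K U × AddMonoid.End Γ(E, U) :=
  (DOp.ofFun : Γ(X, U) →+* DOp K U).prod (Module.toAddMonoidEnd Γ(X, U) Γ(E, U))

/-- Derivations as pairs of operators on `O_X` and on `E`. -/
def Connection.derPair (c : Connection K E) {U : X.Opens} (d : VectorField K U) :
    DOp K U × AddMonoid.End Γ(E, U) := (d.toOp, c.alongEnd d)

/-- The ring generated by the pairs of operators `(a, a)` and `(∂, Δ_∂)`. It turns out to be, on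
small open subsets, the graph of the action of differential operators on `E`. -/
def Connection.graph (c : Connection K E) (U : X.Opens) :
    Subring (DOp K U × AddMonoid.End Γ(E, U)) :=
  Subring.closure (Set.range (funPair E U) ∪ Set.range c.derPair)

lemma Connection.funPair_mem (c : Connection K E) {U : X.Opens} (a : Γ(X, U)) :
    funPair E U a ∈ c.graph U := Subring.subset_closure (Or.inl ⟨a, rfl⟩)

lemma Connection.derPair_mem (c : Connection K E) {U : X.Opens} (d : VectorField K U) :
    c.derPair d ∈ c.graph U := Subring.subset_closure (Or.inr ⟨d, rfl⟩)

lemma Connection.graph_res (c : Connection K E) {U V : X.Opens} (h : V ≤ U)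
    {s : DOp K U × AddMonoid.End Γ(E, U)} (hs : s ∈ c.graph U) :
    ∃ T : AddMonoid.End Γ(E, V), (DOp.res h s.1, T) ∈ c.graph V ∧
      ∀ e, res E h (s.2 e) = T (res E h e) := by
  refine Subring.closure_induction (p := fun s _ => ∃ T : AddMonoid.End Γ(E, V),
    (DOp.res h s.1, T) ∈ c.graph V ∧ ∀ e, res E h (s.2 e) = T (res E h e)) ?_ ?_ ?_ ?_ ?_ ?_ hs
  · rintro _ (⟨a, rfl⟩ | ⟨d, rfl⟩)
    · refine ⟨(funPair (K := K) E V (resO K h a)).2, ?_, fun e => res_smul E h a e⟩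
      have := c.funPair_mem (resO K h a)
      have h1 : DOp.res h (funPair E U a).1 = (funPair E V (resO K h a)).1 := DOp.res_ofFun h a
      rw [h1]
      exact this
    · exact ⟨c.alongEnd (d.res h), c.derPair_mem (d.res h), fun e => (c.along_res h d e).symm⟩
  · refine ⟨0, ?_, fun e => map_zero _⟩
    have := (c.graph V).zero_mem
    rwa [Prod.fst_zero, map_zero]
  · refine ⟨1, ?_, fun e => rfl⟩
    have := (c.graph V).one_mem
    rwa [Prod.fst_one, map_one]
  · rintro s t _ _ ⟨S, hS, hS'⟩ ⟨T, hT, hT'⟩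
    refine ⟨S + T, ?_, fun e => ?_⟩
    · have := add_mem hS hT
      rwa [Prod.fst_add, map_add]
    · exact (map_add (res E h) _ _).trans (congrArg₂ (· + ·) (hS' e) (hT' e))
  · rintro s _ ⟨S, hS, hS'⟩
    refine ⟨-S, ?_, fun e => ?_⟩
    · have := neg_mem hS
      rwa [Prod.fst_neg, map_neg]
    · exact (map_neg (res E h) _).trans (congrArg (- ·) (hS' e))
  · rintro s t _ _ ⟨S, hS, hS'⟩ ⟨T, hT, hT'⟩
    refine ⟨S * T, ?_, fun e => ?_⟩
    · have := mul_mem hS hT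
      rwa [Prod.fst_mul, map_mul]
    · exact (hS' (t.2 e)).trans (congrArg S (hT' e))

lemma isTorsionFree_pairs [CharZero K] (E : X.Modules) (U : X.Opens) :
    Module.IsTorsionFree ℤ (DOp K U × AddMonoid.End Γ(E, U)) := by
  have key : ∀ (m : ℤ), m ≠ 0 → ∀ s : DOp K U × AddMonoid.End Γ(E, U), m • s = 0 → s = 0 := by
    intro m hm s hs
    have h1 : funPair (K := K) E U (algebraMap K _ (m : K)⁻¹) * (m • s) = s := by
      rw [zsmul_eq_mul, ← map_intCast (funPair (K := K) E U), ← map_intCast (algebraMap K Γ(X, U)),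
        ← mul_assoc, ← map_mul, ← map_mul, inv_mul_cancel₀ (Int.cast_ne_zero.mpr hm), map_one,
        map_one, one_mul]
    rw [← h1, hs, mul_zero]
  refine ⟨fun m hm s t hst => ?_⟩
  have hm' : m ≠ 0 := hm.ne_zero
  exact sub_eq_zero.mp (key m hm' _ ((smul_sub m s t).trans (sub_eq_zero.mpr hst)))

lemma IsCoordinates.isWeylSystem {U : X.Opens} {n : ℕ} {y : Fin n → Γ(X, U)}
    {η : Fin n → VectorField K U} (h : IsCoordinates y η) {c : Connection K E}
    (hc : c.Integrable) : IsWeylSystem (funPair E U) (fun i => c.derPair (η i))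
      (fun i => (η i).apply) y where
  comm i j := by
    refine Prod.ext (h.toOp_comm i j) (AddMonoidHom.ext fun e => ?_)
    have h1 := hc U (η i) (η j) e
    have h2 : c.along ((η i).bracket (η j)) e = 0 := by
      rw [Connection.along, h.contract_eq_sum]
      refine Finset.sum_eq_zero fun k _ => ?_
      rw [h.bracket_apply, zero_smul]
    rw [h2] at h1
    exact (sub_eq_zero.mp h1.symm)
  mul_fun i a := by
    refine Prod.ext ?_ (AddMonoidHom.ext fun e => ?_)
    · exact (sub_eq_iff_eq_add'.mp ((η i).toOp_mul_ofFun a))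
    · exact c.along_smul (η i) a e
  dual := h.dual

lemma AddMonoid.End.sum_apply {M : Type*} [AddCommGroup M] {n : ℕ}
    (T : Fin n → AddMonoid.End M) (e : M) : (∑ i, T i) e = ∑ i, T i e :=
  map_sum (AddMonoidHom.eval e) T Finset.univ

lemma IsCoordinates.graph_le {U : X.Opens} {n : ℕ} {y : Fin n → Γ(X, U)}
    {η : Fin n → VectorField K U} (h : IsCoordinates y η) (c : Connection K E) :
    c.graph U ≤ Subring.closure
      (Set.range (funPair E U) ∪ Set.range fun i => c.derPair (η i)) := by
  refine Subring.closure_le.mpr ?_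
  rintro _ (⟨a, rfl⟩ | ⟨d, rfl⟩)
  · exact Subring.subset_closure (Or.inl ⟨a, rfl⟩)
  · have h1 : c.derPair d = ∑ i, funPair E U (d.apply (y i)) * c.derPair (η i) := by
      refine Prod.ext ?_ (AddMonoidHom.ext fun e => ?_)
      · rw [Prod.fst_sum]
        exact h.toOp_eq_sum d
      · rw [Prod.snd_sum]
        exact (h.contract_eq_sum d (c.apply e)).trans
          (AddMonoid.End.sum_apply
            (fun i => (funPair E U (d.apply (y i)) * c.derPair (η i)).2) e).symm
    rw [h1]
    exact sum_mem fun i _ => mul_mem (Subring.subset_closure (Or.inl ⟨_, rfl⟩))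
      (Subring.subset_closure (Or.inr ⟨i, rfl⟩))

/-- The operator on `E` is determined by the differential operator. -/
lemma Connection.graph_unique [CharZero K] [Smooth (X ↘ Spec (CommRingCat.of K))]
    {c : Connection K E} (hc : c.Integrable) {U : X.Opens} {P : DOp K U}
    {T T' : AddMonoid.End Γ(E, U)} (hT : (P, T) ∈ c.graph U) (hT' : (P, T') ∈ c.graph U) :
    T = T' := by
  refine AddMonoidHom.ext fun e => eq_of_locally E fun x hx => ?_
  obtain ⟨V, -, hV, hxV, n, y, η, h⟩ := exists_coordinates_le (K := K) hx
  refine ⟨V, hV, hxV, ?_⟩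
  obtain ⟨S, hS, hS'⟩ := c.graph_res hV (sub_mem hT hT')
  have := isTorsionFree_pairs (K := K) E V
  have h1 := (h.isWeylSystem hc).eq_zero_of_map_eq_zero (RingHom.fst _ _)
    (DOp.eval V le_rfl 1) (fun a => by
      change DOp.eval V le_rfl 1 (DOp.ofFun a) = a
      rw [DOp.eval_ofFun, resO_self, mul_one]; rfl) (h.graph_le c hS) (by
      change DOp.res hV (P - P) = 0
      rw [sub_self, map_zero])
  have h2 : S = 0 := congrArg Prod.snd h1
  have h3 := hS' e
  rw [h2] at h3
  have h4 : res E hV (T e) - res E hV (T' e) = 0 := (map_sub (res E hV) _ _).symm.trans h3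
  exact sub_eq_zero.mp h4

/-- Every differential operator locally acts on `E`. -/
lemma Connection.graph_exists [CharZero K] [Smooth (X ↘ Spec (CommRingCat.of K))]
    (c : Connection K E) {U : X.Opens} (P : DOp K U) {x : X} (hx : x ∈ U) :
    ∃ (V : X.Opens) (h : V ≤ U) (_ : x ∈ V) (T : AddMonoid.End Γ(E, V)),
      (DOp.res h P, T) ∈ c.graph V := by
  have h1 : ∀ x ∈ U, ∃ (V : X.Opens) (h : V ≤ U), x ∈ V ∧ ∃ (T : AddMonoid.End Γ(E, V)),
      (DOp.res h P, T) ∈ c.graph V := by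
    refine DOp.induction (p := fun U P => ∀ x ∈ U, ∃ (V : X.Opens) (h : V ≤ U), x ∈ V ∧
      ∃ (T : AddMonoid.End Γ(E, V)), (DOp.res h P, T) ∈ c.graph V) ?_ ?_ ?_ ?_ ?_ P
    · intro U P H x hx
      obtain ⟨V, h, hxV, hV⟩ := H x hx
      obtain ⟨W, h', hxW, T, hT⟩ := hV x hxV
      exact ⟨W, h'.trans h, hxW, T, hT⟩
    · exact fun U a x hx => ⟨U, le_rfl, hx, _, c.funPair_mem a⟩
    · exact fun U d x hx => ⟨U, le_rfl, hx, _, c.derPair_mem d⟩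
    · intro U P Q hP hQ x hx
      obtain ⟨V, h, hxV, S, hS⟩ := hP x hx
      obtain ⟨W, h', hxW, T, hT⟩ := hQ x hx
      obtain ⟨S', hS', -⟩ := c.graph_res (inf_le_left : V ⊓ W ≤ V) hS
      obtain ⟨T', hT', -⟩ := c.graph_res (inf_le_right : V ⊓ W ≤ W) hT
      refine ⟨V ⊓ W, inf_le_left.trans h, ⟨hxV, hxW⟩, S' + T', ?_⟩
      rw [map_add]
      exact add_mem hS' hT'
    · intro U P Q hP hQ x hx
      obtain ⟨V, h, hxV, S, hS⟩ := hP x hx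
      obtain ⟨W, h', hxW, T, hT⟩ := hQ x hx
      obtain ⟨S', hS', -⟩ := c.graph_res (inf_le_left : V ⊓ W ≤ V) hS
      obtain ⟨T', hT', -⟩ := c.graph_res (inf_le_right : V ⊓ W ≤ W) hT
      refine ⟨V ⊓ W, inf_le_left.trans h, ⟨hxV, hxW⟩, S' * T', ?_⟩
      rw [map_mul]
      exact mul_mem hS' hT'
  obtain ⟨V, h, hxV, T, hT⟩ := h1 x hx
  exact ⟨V, h, hxV, T, hT⟩

lemma Connection.graph_exists₂ [CharZero K] [Smooth (X ↘ Spec (CommRingCat.of K))]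
    (c : Connection K E) {U : X.Opens} (P Q : DOp K U) {x : X} (hx : x ∈ U) :
    ∃ (V : X.Opens) (h : V ≤ U) (_ : x ∈ V) (S T : AddMonoid.End Γ(E, V)),
      (DOp.res h P, S) ∈ c.graph V ∧ (DOp.res h Q, T) ∈ c.graph V := by
  obtain ⟨V, h, hxV, S, hS⟩ := c.graph_exists P hx
  obtain ⟨W, h', hxW, T, hT⟩ := c.graph_exists Q hx
  obtain ⟨S', hS', -⟩ := c.graph_res (inf_le_left : V ⊓ W ≤ V) hS
  obtain ⟨T', hT', -⟩ := c.graph_res (inf_le_right : V ⊓ W ≤ W) hT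
  exact ⟨V ⊓ W, inf_le_left.trans h, ⟨hxV, hxW⟩, S', T', hS', hT'⟩

lemma Connection.exists_action [CharZero K] [Smooth (X ↘ Spec (CommRingCat.of K))]
    {c : Connection K E} (hc : c.Integrable) {U : X.Opens} (P : DOp K U) (e : Γ(E, U)) :
    ∃ e' : Γ(E, U), ∀ (V : X.Opens) (h : V ≤ U) (T : AddMonoid.End Γ(E, V)),
      (DOp.res h P, T) ∈ c.graph V → res E h e' = T (res E h e) := by
  obtain ⟨e', he'⟩ := exists_of_locally E
    (Q := fun V h s => ∃ T : AddMonoid.End Γ(E, V), (DOp.res h P, T) ∈ c.graph V ∧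
      s = T (res E h e)) (U := U) (by
    rintro V W hV h s ⟨T, hT, rfl⟩
    obtain ⟨T', hT', hres⟩ := c.graph_res h hT
    exact ⟨T', hT', (hres _).trans (congrArg T' (res_res E hV h e))⟩) (by
    rintro V hV s t ⟨S, hS, rfl⟩ ⟨T, hT, rfl⟩
    rw [Connection.graph_unique hc hS hT]) (by
    intro x hx
    obtain ⟨V, h, hxV, T, hT⟩ := c.graph_exists P hx
    exact ⟨V, h, hxV, _, T, hT, rfl⟩)
  refine ⟨e', fun V h T hT => eq_of_locally E fun x hx => ?_⟩
  obtain ⟨W, hW, hxW, S, hS, hS'⟩ := he' x (h hx)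
  obtain ⟨T', hT', hT''⟩ := c.graph_res (inf_le_left : V ⊓ W ≤ V) hT
  obtain ⟨S', hS1, hS2⟩ := c.graph_res (inf_le_right : V ⊓ W ≤ W) hS
  refine ⟨V ⊓ W, inf_le_left, ⟨hx, hxW⟩, ?_⟩
  have h1 : res E (inf_le_right : V ⊓ W ≤ W) (res E hW e') =
      S' (res E inf_le_right (res E hW e)) := by rw [hS']; exact hS2 _
  rw [res_res, res_res, Connection.graph_unique hc hS1 hT'] at h1
  rw [hT'', res_res, res_res, h1]

/-- The action of a differential operator on `E` defined by an integrable connection. -/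
def Connection.op [CharZero K] [Smooth (X ↘ Spec (CommRingCat.of K))]
    {c : Connection K E} (hc : c.Integrable) {U : X.Opens} (P : DOp K U) (e : Γ(E, U)) :
    Γ(E, U) := (Connection.exists_action hc P e).choose

lemma Connection.res_op [CharZero K] [Smooth (X ↘ Spec (CommRingCat.of K))]
    {c : Connection K E} (hc : c.Integrable) {U : X.Opens} (P : DOp K U) (e : Γ(E, U))
    {V : X.Opens} (h : V ≤ U) {T : AddMonoid.End Γ(E, V)} (hT : (DOp.res h P, T) ∈ c.graph V) :
    res E h (Connection.op hc P e) = T (res E h e) :=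
  (Connection.exists_action hc P e).choose_spec V h T hT

lemma Connection.op_eq [CharZero K] [Smooth (X ↘ Spec (CommRingCat.of K))]
    {c : Connection K E} (hc : c.Integrable) {U : X.Opens} {P : DOp K U}
    {T : AddMonoid.End Γ(E, U)} (hT : (P, T) ∈ c.graph U) (e : Γ(E, U)) :
    Connection.op hc P e = T e := by
  have := Connection.res_op hc P e le_rfl (T := T) hT
  rwa [res_self, res_self] at this

/-- The ring homomorphism from differential operators to endomorphisms of `E`. -/
def Connection.opHom [CharZero K] [Smooth (X ↘ Spec (CommRingCat.of K))]
    {c : Connection K E} (hc : c.Integrable) (U : X.Opens) : DOp K U →+* AddMonoid.End Γ(E, U) where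
  toFun P := AddMonoidHom.mk' (Connection.op hc P) fun e e' => by
    refine eq_of_locally E fun x hx => ?_
    obtain ⟨V, h, hxV, T, hT⟩ := c.graph_exists P hx
    refine ⟨V, h, hxV, ?_⟩
    rw [Connection.res_op hc _ _ h hT, map_add, map_add, map_add, Connection.res_op hc _ _ h hT,
      Connection.res_op hc _ _ h hT]
  map_one' := AddMonoidHom.ext fun e => Connection.op_eq hc (c.graph U).one_mem e
  map_zero' := AddMonoidHom.ext fun e => Connection.op_eq hc (c.graph U).zero_mem e
  map_mul' P Q := by
    refine AddMonoidHom.ext fun e => eq_of_locally E fun x hx => ?_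
    obtain ⟨V, h, hxV, S, T, hS, hT⟩ := c.graph_exists₂ P Q hx
    refine ⟨V, h, hxV, ?_⟩
    change res E h (Connection.op hc (P * Q) e) =
      res E h (Connection.op hc P (Connection.op hc Q e))
    have hST : (DOp.res h (P * Q), S * T) ∈ c.graph V := by
      rw [map_mul]; exact mul_mem hS hT
    rw [Connection.res_op hc _ _ h hST, Connection.res_op hc _ _ h hS,
      Connection.res_op hc _ _ h hT]
    rfl
  map_add' P Q := by
    refine AddMonoidHom.ext fun e => eq_of_locally E fun x hx => ?_
    obtain ⟨V, h, hxV, S, T, hS, hT⟩ := c.graph_exists₂ P Q hx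
    refine ⟨V, h, hxV, ?_⟩
    change res E h (Connection.op hc (P + Q) e) =
      res E h (Connection.op hc P e + Connection.op hc Q e)
    have hST : (DOp.res h (P + Q), S + T) ∈ c.graph V := by
      rw [map_add]; exact add_mem hS hT
    rw [map_add, Connection.res_op hc _ _ h hST, Connection.res_op hc _ _ h hS,
      Connection.res_op hc _ _ h hT]
    rfl

/-- The `D`-module defined by an integrable connection. -/
def Connection.toDModule [CharZero K] [Smooth (X ↘ Spec (CommRingCat.of K))]
    {c : Connection K E} (hc : c.Integrable) : DModuleStructure K E where
  act U := Connection.opHom hc U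
  act_res U V h P e := by
    change res E h (Connection.op hc P e) = Connection.op hc (DOp.res h P) (res E h e)
    refine eq_of_locally E fun x hx => ?_
    obtain ⟨W, h', hxW, T, hT⟩ := c.graph_exists (DOp.res h P) hx
    refine ⟨W, h', hxW, ?_⟩
    rw [Connection.res_op hc _ _ h' hT, res_res, res_res]
    exact Connection.res_op hc P e (h'.trans h) hT
  act_ofFun U a e := Connection.op_eq hc (c.funPair_mem a) e

lemma Connection.corresponds_toDModule [CharZero K] [Smooth (X ↘ Spec (CommRingCat.of K))]
    {c : Connection K E} (hc : c.Integrable) : c.Corresponds (Connection.toDModule hc) :=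
  fun _ d e => Connection.op_eq hc (c.derPair_mem d) e

end ConnectionToModule

/-! ### From `D`-modules to integrable connections -/

section ModuleToConnection

variable {K : Type u} [Field K] {X : Scheme.{u}} [X.Over (Spec (CommRingCat.of K))]

/-- The action of differential operators as a ring homomorphism. -/
def DAction.op {F : TopCat.Presheaf Ab.{u} X} (ρ : DAction K F) (U : X.Opens) :
    DOp K U →+* AddMonoid.End (F.obj (op U)) := ρ.act U

lemma DAction.res_op {F : TopCat.Presheaf Ab.{u} X} (ρ : DAction K F) {U V : X.Opens} (h : V ≤ U)
    (P : DOp K U) (s : F.obj (Opposite.op U)) :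
    resAb F h (ρ.op U P s) = ρ.op V (DOp.res h P) (resAb F h s) := ρ.act_res U V h P s

lemma DAction.ext_op {F : TopCat.Presheaf Ab.{u} X} {ρ ρ' : DAction K F}
    (h : ∀ (U : X.Opens) (P : DOp K U) s, ρ.op U P s = ρ'.op U P s) : ρ = ρ' := by
  ext1
  funext U
  exact RingHom.ext fun P => AddMonoidHom.ext fun s => h U P s

/-- A structure of `D`-module is determined by the action of derivations. -/
lemma DModuleStructure.ext_der [CharZero K] [Smooth (X ↘ Spec (CommRingCat.of K))]
    {E : X.Modules} {ρ ρ' : DModuleStructure K E}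
    (h : ∀ (U : X.Opens) (d : VectorField K U) (e : Γ(E, U)),
      ρ.act U d.toD e = ρ'.act U d.toD e) : ρ = ρ' := by
  have key : ∀ (U : X.Opens) (P : DOp K U), ∀ e : Γ(E, U),
      ρ.toDAction.op U P e = ρ'.toDAction.op U P e := by
    intro U P
    refine DOp.induction (p := fun U P => ∀ e : Γ(E, U),
      ρ.toDAction.op U P e = ρ'.toDAction.op U P e) ?_ ?_ ?_ ?_ ?_ P
    · intro U P H e
      refine eq_of_locally E fun x hx => ?_
      obtain ⟨V, h, hxV, hV⟩ := H x hx
      exact ⟨V, h, hxV, (ρ.toDAction.res_op h P e).trans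
        ((hV _).trans (ρ'.toDAction.res_op h P e).symm)⟩
    · exact fun U a e => (ρ.act_ofFun U a e).trans (ρ'.act_ofFun U a e).symm
    · exact fun U d e => h U d e
    · intro U P Q hP hQ e
      rw [map_add, map_add]
      exact congrArg₂ (· + ·) (hP e) (hQ e)
    · intro U P Q hP hQ e
      rw [map_mul, map_mul]
      exact (congrArg _ (hQ e)).trans (hP _)
  have h1 : ρ.toDAction = ρ'.toDAction := DAction.ext_op key
  cases ρ; cases ρ'; cases h1; rfl

/-- The action of a derivation. -/
def DModuleStructure.der {E : X.Modules} (ρ : DModuleStructure K E) {U : X.Opens}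
    (d : VectorField K U) : Γ(E, U) →+ Γ(E, U) := ρ.toDAction.op U d.toOp

lemma DModuleStructure.der_smul {E : X.Modules} (ρ : DModuleStructure K E) {U : X.Opens}
    (d : VectorField K U) (a : Γ(X, U)) (e : Γ(E, U)) :
    ρ.der d (a • e) = a • ρ.der d e + d.apply a • e := by
  have hf : ∀ (b : Γ(X, U)) (e : Γ(E, U)), ρ.toDAction.op U (DOp.ofFun b) e = b • e :=
    fun b e => ρ.act_ofFun U b e
  have h1 := congrArg (ρ.toDAction.op U) (sub_eq_iff_eq_add'.mp (d.toOp_mul_ofFun a))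
  rw [map_add, map_mul, map_mul] at h1
  have h2 : ρ.toDAction.op U d.toOp (ρ.toDAction.op U (DOp.ofFun a) e) =
      ρ.toDAction.op U (DOp.ofFun a) (ρ.toDAction.op U d.toOp e) +
        ρ.toDAction.op U (DOp.ofFun (d.apply a)) e := congrArg (fun T => T e) h1
  rw [hf] at h2
  exact h2.trans (congrArg₂ (· + ·) (hf _ _) (hf _ _))

lemma DModuleStructure.der_res {E : X.Modules} (ρ : DModuleStructure K E) {U V : X.Opens}
    (h : V ≤ U) (d : VectorField K U) (e : Γ(E, U)) :
    res E h (ρ.der d e) = ρ.der (d.res h) (res E h e) := ρ.toDAction.res_op h d.toOp e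

/-- In coordinates, `∂ e = ∑ᵢ ∂(yᵢ) ηᵢ e`. -/
lemma IsCoordinates.der_eq_sum {V : X.Opens} {n : ℕ} {y : Fin n → Γ(X, V)}
    {η : Fin n → VectorField K V} (h : IsCoordinates y η) {E : X.Modules}
    (ρ : DModuleStructure K E) (d : VectorField K V) (e : Γ(E, V)) :
    ρ.der d e = ∑ i, d.apply (y i) • ρ.der (η i) e := by
  have h1 := congrArg (ρ.toDAction.op V) (h.toOp_eq_sum d)
  rw [map_sum] at h1
  refine (congrArg (fun T : AddMonoid.End Γ(E, V) => T e) h1).trans ?_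
  refine (AddMonoid.End.sum_apply _ e).trans (Finset.sum_congr rfl fun i _ => ?_)
  rw [map_mul]
  exact ρ.act_ofFun V _ _

variable [Smooth (X ↘ Spec (CommRingCat.of K))]

/-- The section `∇(e)` of `Ω¹ ⊗ E` with `⟨∂, ∇(e)⟩ = ∂ e`; in coordinates, it is
`∑ᵢ dyᵢ ⊗ ηᵢ e`. -/
lemma DModuleStructure.exists_nabla {E : X.Modules} (ρ : DModuleStructure K E) {U : X.Opens}
    (e : Γ(E, U)) : ∃ s : Γ(Omega K E, U), ∀ (V : X.Opens) (h : V ≤ U) (d : VectorField K V),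
      contract d (res (Omega K E) h s) = ρ.der d (res E h e) := by
  obtain ⟨s, hs⟩ := exists_of_locally (Omega K E) (U := U)
    (Q := fun V h s => ∀ (W : X.Opens) (h' : W ≤ V) (d : VectorField K W),
      contract d (res (Omega K E) h' s) = ρ.der d (res E (h'.trans h) e)) (by
    intro V W hV h s H W' h' d
    rw [res_res]
    exact H W' (h'.trans h) d) (by
    intro V hV s t hs ht
    exact omega_ext fun W h' d => (hs W h' d).trans (ht W h' d).symm) (by
    intro x hx
    obtain ⟨V, -, hV, hxV, n, y, η, h⟩ := exists_coordinates_le (K := K) hx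
    refine ⟨V, hV, hxV, ∑ i, dTmul (y i) (ρ.der (η i) (res E hV e)), fun W h' d => ?_⟩
    have h1 : ∀ i, contract d (res (Omega K E) h' (dTmul (y i) (ρ.der (η i) (res E hV e)))) =
        d.apply (resO K h' (y i)) • ρ.der ((η i).res h') (res E (h'.trans hV) e) := by
      intro i
      rw [dTmul, omegaTmul_res, kaehlerMap_D]
      refine (contract_dTmul _ _ _).trans ?_
      rw [ρ.der_res, res_res]
    rw [map_sum, contract_finsum]
    simp only [h1]
    exact ((h.restrict h').der_eq_sum ρ d _).symm)
  refine ⟨s, fun V h d => eq_of_locally E fun x hx => ?_⟩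
  obtain ⟨W, hW, hxW, H⟩ := hs x (h hx)
  refine ⟨V ⊓ W, inf_le_left, ⟨hx, hxW⟩, ?_⟩
  rw [← contract_res, ρ.der_res, res_res, res_res]
  have := H (V ⊓ W) inf_le_right (d.res inf_le_left)
  rwa [res_res] at this

/-- The section `∇(e)`, as a function of `e`. -/
def DModuleStructure.nabla {E : X.Modules} (ρ : DModuleStructure K E) {U : X.Opens}
    (e : Γ(E, U)) : Γ(Omega K E, U) := (ρ.exists_nabla e).choose

lemma DModuleStructure.contract_res_nabla {E : X.Modules} (ρ : DModuleStructure K E)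
    {U : X.Opens} (e : Γ(E, U)) {V : X.Opens} (h : V ≤ U) (d : VectorField K V) :
    contract d (res (Omega K E) h (ρ.nabla e)) = ρ.der d (res E h e) :=
  (ρ.exists_nabla e).choose_spec V h d

lemma DModuleStructure.nabla_add {E : X.Modules} (ρ : DModuleStructure K E) {U : X.Opens}
    (e e' : Γ(E, U)) : ρ.nabla (e + e') = ρ.nabla e + ρ.nabla e' :=
  omega_ext fun V h d => by
    rw [map_add, contract_add, contract_res_nabla, contract_res_nabla, contract_res_nabla,
      map_add, map_add]

lemma DModuleStructure.nabla_res {E : X.Modules} (ρ : DModuleStructure K E) {U V : X.Opens}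
    (h : V ≤ U) (e : Γ(E, U)) : ρ.nabla (res E h e) = res (Omega K E) h (ρ.nabla e) :=
  omega_ext fun W h' d => by
    rw [contract_res_nabla, res_res, res_res, contract_res_nabla]

lemma DModuleStructure.nabla_smul {E : X.Modules} (ρ : DModuleStructure K E) {U : X.Opens}
    (a : Γ(X, U)) (e : Γ(E, U)) : ρ.nabla (a • e) = a • ρ.nabla e + dTmul a e :=
  omega_ext fun V h d => by
    have h1 : res (Omega K E) h (dTmul a e) = dTmul (resO K h a) (res E h e) := by
      rw [dTmul, omegaTmul_res, kaehlerMap_D]; rfl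
    rw [contract_res_nabla, map_add, contract_add, res_smul (K := K), res_smul (K := K),
      contract_smul, contract_res_nabla, h1, contract_dTmul, ρ.der_smul]

/-- A morphism of abelian presheaves from its components. -/
def abHomOfApp {F G : TopCat.Presheaf Ab.{u} X} (φ : ∀ U : X.Opens, F.obj (op U) →+ G.obj (op U))
    (h : ∀ (U V : X.Opens) (h : V ≤ U) s, φ V (resAb F h s) = resAb G h (φ U s)) : F ⟶ G where
  app U := AddCommGrpCat.ofHom (φ U.unop)
  naturality U V i := AddCommGrpCat.hom_ext (AddMonoidHom.ext fun e => h U.unop V.unop i.unop.le e)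

/-- The connection defined by a `D`-module. -/
def DModuleStructure.toConnection {E : X.Modules} (ρ : DModuleStructure K E) :
    Connection K E where
  nabla := abHomOfApp (F := E.presheaf) (G := (Omega K E).presheaf)
    (fun U => AddMonoidHom.mk' (fun e : Γ(E, U) => ρ.nabla e) ρ.nabla_add)
    fun _ _ h e => ρ.nabla_res h e
  leibniz _ a e := ρ.nabla_smul a e

lemma DModuleStructure.along_toConnection {E : X.Modules} (ρ : DModuleStructure K E)
    {U : X.Opens} (d : VectorField K U) (e : Γ(E, U)) :
    ρ.toConnection.along d e = ρ.der d e := by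
  have := ρ.contract_res_nabla e le_rfl d
  rwa [res_self, res_self] at this

lemma DModuleStructure.corresponds_toConnection {E : X.Modules} (ρ : DModuleStructure K E) :
    ρ.toConnection.Corresponds ρ := fun _ d e => (ρ.along_toConnection d e).symm

/-- A connection corresponding to a `D`-module is integrable. -/
lemma Connection.Corresponds.integrable {E : X.Modules} {c : Connection K E}
    {ρ : DModuleStructure K E} (h : c.Corresponds ρ) : c.Integrable := by
  intro U d d' e
  have h' : ∀ (d : VectorField K U) e, c.along d e = ρ.toDAction.op U d.toOp e :=
    fun d e => (h U d e).symm
  rw [h', h', h', h', h', VectorField.toOp_bracket, map_sub, map_mul, map_mul]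
  rfl

/-- A connection is determined by the operators `Δ_∂`. -/
lemma Connection.ext_along {E : X.Modules} {c c' : Connection K E}
    (h : ∀ (U : X.Opens) (d : VectorField K U) (e : Γ(E, U)), c.along d e = c'.along d e) :
    c = c' := by
  ext1
  ext U e
  change c.apply (U := U) e = c'.apply (U := U) e
  refine omega_ext fun V hV d => ?_
  rw [← c.apply_res, ← c'.apply_res]
  exact h V d _

theorem DModuleStructure.existsUnique_connection {E : X.Modules} (ρ : DModuleStructure K E) :
    ∃! c : Connection K E, c.Integrable ∧ c.Corresponds ρ :=
  ⟨ρ.toConnection, ⟨ρ.corresponds_toConnection.integrable, ρ.corresponds_toConnection⟩,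
    fun _ hc => Connection.ext_along fun U d e =>
      (hc.2 U d e).symm.trans (ρ.corresponds_toConnection U d e)⟩

theorem Connection.existsUnique_dModule [CharZero K] {E : X.Modules} {c : Connection K E}
    (hc : c.Integrable) : ∃! ρ : DModuleStructure K E, c.Corresponds ρ :=
  ⟨Connection.toDModule hc, Connection.corresponds_toDModule hc, fun _ hρ =>
    DModuleStructure.ext_der fun U d e =>
      (hρ U d e).trans (Connection.corresponds_toDModule hc U d e).symm⟩

end ModuleToConnection

end DConn

end

noncomputable section

namespace DConn

/-! ### Generation of the inverse image by pure tensors -/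

section Generation

variable {X Y : Scheme.{u}} (f : X ⟶ Y)

lemma pullback_hom_ext {E : Y.Modules} {F : X.Modules}
    {φ ψ : (Scheme.Modules.pullback f).obj E ⟶ F}
    (h : ∀ (V : Y.Opens) (e : Γ(E, V)),
      φ.app (f ⁻¹ᵁ V) (pull f E V e) = ψ.app (f ⁻¹ᵁ V) (pull f E V e)) : φ = ψ := by
  refine ((Scheme.Modules.pullbackPushforwardAdjunction f).homEquiv E F).injective ?_
  rw [Adjunction.homEquiv_unit, Adjunction.homEquiv_unit]
  ext V e
  exact h V e

variable {f} {M : Y.Modules}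

lemma tmul_add {U : X.Opens} {V : Y.Opens} (h : U ≤ f ⁻¹ᵁ V) (a : Γ(X, U)) (m m' : Γ(M, V)) :
    tmul f M h a (m + m') = tmul f M h a m + tmul f M h a m' := by
  simp only [tmul, map_add, smul_add]

lemma smul_tmul {U : X.Opens} {V : Y.Opens} (h : U ≤ f ⁻¹ᵁ V) (b a : Γ(X, U)) (m : Γ(M, V)) :
    b • tmul f M h a m = tmul f M h (b * a) m := smul_smul _ _ _

lemma one_tmul {U : X.Opens} {V : Y.Opens} (h : U ≤ f ⁻¹ᵁ V) (m : Γ(M, V)) :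
    tmul f M h 1 m = res _ h (pull f M V m) := one_smul _ _

variable (f M) in
/-- The sections of `f^*M` over `U` that are `O_X(U)`-linear combinations of sections `1 ⊗ m`. -/
def tensorSpan (U : X.Opens) : Submodule Γ(X, U) Γ((Scheme.Modules.pullback f).obj M, U) :=
  Submodule.span _ {s | ∃ (V : Y.Opens) (h : U ≤ f ⁻¹ᵁ V) (m : Γ(M, V)),
    s = res _ h (pull f M V m)}

lemma res_mem_tensorSpan {U U' : X.Opens} (h : U' ≤ U)
    {s : Γ((Scheme.Modules.pullback f).obj M, U)} (hs : s ∈ tensorSpan f M U) :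
    res _ h s ∈ tensorSpan f M U' := by
  refine Submodule.span_induction (p := fun s _ => res _ h s ∈ tensorSpan f M U')
    ?_ ?_ ?_ ?_ hs
  · rintro _ ⟨V, hV, m, rfl⟩
    exact Submodule.subset_span ⟨V, h.trans hV, m, res_res _ _ _ _⟩
  · rw [map_zero]; exact zero_mem _
  · intro s t _ _ hs ht
    rw [map_add]; exact add_mem hs ht
  · intro a s _ hs
    exact (congrArg (· ∈ tensorSpan f M U')
      (Scheme.Modules.map_smul ((Scheme.Modules.pullback f).obj M) (homOfLE h) a s)).mpr
      (Submodule.smul_mem _ _ hs)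

variable (f M) in
/-- The presheaf cokernel of the inclusion of `tensorSpan` in `f^*M`. -/
def tensorCoker : PreMod X where
  obj U := Γ((Scheme.Modules.pullback f).obj M, U) ⧸ tensorSpan f M U
  res {U V} h := QuotientAddGroup.map (tensorSpan f M U).toAddSubgroup
    (tensorSpan f M V).toAddSubgroup (res _ h) fun _ hs => res_mem_tensorSpan h hs
  res_self {U} h x := by
    obtain ⟨s, rfl⟩ := (tensorSpan f M U).mkQ_surjective x
    exact congrArg (tensorSpan f M U).mkQ (res_self _ h s)
  res_res {U V W} h h' x := by
    obtain ⟨s, rfl⟩ := (tensorSpan f M U).mkQ_surjective x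
    exact congrArg (tensorSpan f M W).mkQ (res_res _ h h' s)
  res_smul {U V} h a x := by
    obtain ⟨s, rfl⟩ := (tensorSpan f M U).mkQ_surjective x
    exact congrArg (tensorSpan f M V).mkQ
      (Scheme.Modules.map_smul ((Scheme.Modules.pullback f).obj M) (homOfLE h) a s)

/-- The morphism from `f^*M` to the cokernel vanishes on the sections `1 ⊗ m`, hence vanishes
by the universal property of `f^*M`. -/
lemma exists_res_mem_tensorSpan {U : X.Opens} (s : Γ((Scheme.Modules.pullback f).obj M, U))
    {x : X} (hx : x ∈ U) :
    ∃ (V : X.Opens) (h : V ≤ U) (_ : x ∈ V), res _ h s ∈ tensorSpan f M V := by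
  let q : (Scheme.Modules.pullback f).obj M ⟶ (tensorCoker f M).sheaf := homOfApp
    (fun U => ((tensorCoker f M).toSheaf U).toAddMonoidHom.comp
      (tensorSpan f M U).mkQ.toAddMonoidHom)
    (fun U V h e => (tensorCoker f M).toSheaf_res h ((tensorSpan f M U).mkQ e))
    (fun U a e => (congrArg ((tensorCoker f M).toSheaf U)
      ((tensorSpan f M U).mkQ.map_smul a e)).trans (map_smul _ _ _))
  have hq : q = 0 := pullback_hom_ext f fun V e => by
    change (tensorCoker f M).toSheaf _ ((tensorSpan f M _).mkQ _) = 0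
    have h1 : (tensorSpan f M (f ⁻¹ᵁ V)).mkQ (pull f M V e) = 0 :=
      (Submodule.Quotient.mk_eq_zero _).mpr
        (Submodule.subset_span ⟨V, le_rfl, e, (res_self _ _ _).symm⟩)
    rw [h1]
    exact map_zero _
  have h0 : (tensorCoker f M).toSheaf U ((tensorSpan f M U).mkQ s) = 0 := by
    change q.app U s = 0
    rw [hq]; rfl
  obtain ⟨V, h, hxV, hV⟩ := (tensorCoker f M).exists_res_eq_zero _ h0 hx
  exact ⟨V, h, hxV, (Submodule.Quotient.mk_eq_zero _).mp hV⟩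

/-- A local additive property of sections of `f^*M` that holds for all `α ⊗ m` holds for all
sections. -/
theorem pullback_induction {p : ∀ U : X.Opens, Γ((Scheme.Modules.pullback f).obj M, U) → Prop}
    (hloc : ∀ U s, (∀ x ∈ U, ∃ (V : X.Opens) (h : V ≤ U), x ∈ V ∧ p V (res _ h s)) → p U s)
    (hadd : ∀ U s t, p U s → p U t → p U (s + t))
    (htmul : ∀ (U : X.Opens) (V : Y.Opens) (h : U ≤ f ⁻¹ᵁ V) (a : Γ(X, U)) (m : Γ(M, V)),
      p U (tmul f M h a m))
    (U : X.Opens) (s : Γ((Scheme.Modules.pullback f).obj M, U)) : p U s := by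
  have hzero : ∀ U : X.Opens, p U 0 := fun U => hloc U 0 fun x hx => by
    refine ⟨U, le_rfl, hx, ?_⟩
    have := htmul U ⊤ (fun _ _ => trivial) 0 0
    have h0 : tmul f M (U := U) (V := ⊤) (fun _ _ => trivial) 0 (0 : Γ(M, ⊤)) = 0 := zero_smul _ _
    rw [h0] at this
    rwa [map_zero]
  refine hloc U s fun x hx => ?_
  obtain ⟨V, h, hxV, hV⟩ := exists_res_mem_tensorSpan s hx
  refine ⟨V, h, hxV, ?_⟩
  refine Submodule.span_induction
    (p := fun s _ => ∀ a : Γ(X, V), p V (a • s)) ?_ ?_ ?_ ?_ hV 1 |> fun h => by rwa [one_smul] at h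
  · rintro _ ⟨W, hW, m, rfl⟩ a
    exact htmul V W hW a m
  · intro a
    rw [smul_zero]; exact hzero V
  · intro s t _ _ hs ht a
    rw [smul_add]; exact hadd _ _ _ (hs a) (ht a)
  · intro b s _ hs a
    rw [smul_smul]; exact hs _

end Generation

section GenerationOver

variable {K : Type u} [Field K] {X Y : Scheme.{u}} [X.Over (Spec (CommRingCat.of K))]
  [Y.Over (Spec (CommRingCat.of K))] {f : X ⟶ Y} [f.IsOver (Spec (CommRingCat.of K))]
  {M : Y.Modules}

lemma res_tmul {U U' : X.Opens} {V : Y.Opens} (h : U ≤ f ⁻¹ᵁ V) (h' : U' ≤ U) (a : Γ(X, U))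
    (m : Γ(M, V)) : res _ h' (tmul f M h a m) = tmul f M (h'.trans h) (resO K h' a) m := by
  rw [tmul, res_smul (K := K), res_res]; rfl

lemma tmul_res {U : X.Opens} {V V' : Y.Opens} (h : U ≤ f ⁻¹ᵁ V') (h' : V' ≤ V) (a : Γ(X, U))
    (m : Γ(M, V)) : tmul f M h a (res M h' m) = tmul f M (h.trans (preimage_le f h')) a m := by
  refine congrArg (a • ·) ?_
  rw [pull_res]
  exact res_res ((Scheme.Modules.pullback f).obj M) (preimage_le f h') h (pull f M V m)

lemma tmul_smul {U : X.Opens} {V : Y.Opens} (h : U ≤ f ⁻¹ᵁ V) (a : Γ(X, U)) (b : Γ(Y, V))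
    (m : Γ(M, V)) : tmul f M h a (b • m) = tmul f M h (a * pullO K f h b) m := by
  rw [tmul, pull_smul' (K := K), res_smul (K := K), smul_smul, tmul]
  congr 2
  change (f.appLE _ _ _ ≫ X.presheaf.map _) b = f.appLE _ _ _ b
  rw [Scheme.Hom.appLE_map]

lemma resO_pullO {U U' : X.Opens} {V : Y.Opens} (h : U ≤ f ⁻¹ᵁ V) (h' : U' ≤ U) (b : Γ(Y, V)) :
    resO K h' (pullO K f h b) = pullO K f (h'.trans h) b := by
  change (f.appLE _ _ _ ≫ X.presheaf.map _) b = f.appLE _ _ _ b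
  rw [Scheme.Hom.appLE_map]

lemma pullO_resO {U : X.Opens} {V V' : Y.Opens} (h : U ≤ f ⁻¹ᵁ V') (h' : V' ≤ V) (b : Γ(Y, V)) :
    pullO K f h (resO K h' b) = pullO K f (h.trans (preimage_le f h')) b := by
  change (Y.presheaf.map _ ≫ f.appLE _ _ _) b = f.appLE _ _ _ b
  rw [Scheme.Hom.map_appLE]

/-- A local additive property of sections of `f^*M` holds for all sections if it holds for the
sections `α ⊗ m` with `m` defined on an open set with coordinates. -/
theorem pullback_induction_coordinates [Smooth (Y ↘ Spec (CommRingCat.of K))]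
    {p : ∀ U : X.Opens, Γ((Scheme.Modules.pullback f).obj M, U) → Prop}
    (hloc : ∀ U s, (∀ x ∈ U, ∃ (V : X.Opens) (h : V ≤ U), x ∈ V ∧ p V (res _ h s)) → p U s)
    (hadd : ∀ U s t, p U s → p U t → p U (s + t))
    (htmul : ∀ (U : X.Opens) (V : Y.Opens) (h : U ≤ f ⁻¹ᵁ V) (n : ℕ) (y : Fin n → Γ(Y, V))
      (η : Fin n → VectorField K V), IsCoordinates y η → ∀ (a : Γ(X, U)) (m : Γ(M, V)),
      p U (tmul f M h a m))
    (U : X.Opens) (s : Γ((Scheme.Modules.pullback f).obj M, U)) : p U s := by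
  refine pullback_induction hloc hadd (fun U V h a m => hloc _ _ fun x hx => ?_) U s
  obtain ⟨V', -, hV', hxV', n, y, η, hy⟩ :=
    exists_coordinates_le (K := K) (X := Y) (U := V) (x := f x) (h hx)
  have h1 : U ⊓ f ⁻¹ᵁ V' ≤ f ⁻¹ᵁ V' := inf_le_right
  refine ⟨U ⊓ f ⁻¹ᵁ V', inf_le_left, ⟨hx, hxV'⟩, ?_⟩
  rw [res_tmul (K := K), ← tmul_res h1 hV']
  exact htmul _ _ _ _ _ _ hy _ _

end GenerationOver

end DConn

end

noncomputable section

namespace DConn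

/-! ### The inverse image of a connection -/

section Parts

variable {K : Type u} [Field K] {X : Scheme.{u}} [X.Over (Spec (CommRingCat.of K))]

lemma PreMod.sheaf_hom_ext {P : PreMod X} {F : X.Modules} {φ ψ : P.sheaf ⟶ F}
    (h : ∀ (U : X.Opens) (x : P.obj U), φ.app U (P.toSheaf U x) = ψ.app U (P.toSheaf U x)) :
    φ = ψ := by
  ext U s
  refine eq_of_locally F fun x hx => ?_
  obtain ⟨V, hV, hxV, y, hy⟩ := P.exists_toSheaf_eq s hx
  refine ⟨V, hV, hxV, ?_⟩
  have h1 := h V y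
  rw [hy, app_res, app_res] at h1
  exact h1

lemma dTmul_res {E : X.Modules} {U V : X.Opens} (h : V ≤ U) (a : Γ(X, U)) (e : Γ(E, U)) :
    res (Omega K E) h (dTmul a e) = dTmul (resO K h a) (res E h e) := by
  rw [dTmul, omegaTmul_res, kaehlerMap_D]; rfl

lemma canon_add {E : X.Modules} {U : X.Opens} (e e' : Γ(E, U)) :
    canon (K := K) (e + e') = canon e + canon e' :=
  (congrArg ((partsPre K E).toSheaf U) (PPT.tmul_add 1 e e')).trans (map_add _ _ _)

lemma canon_res {E : X.Modules} {U V : X.Opens} (h : V ≤ U) (e : Γ(E, U)) :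
    res (Parts K E) h (canon e) = canon (res E h e) := by
  rw [canon, canon, partsTmul_res, map_one]

lemma smul_canon {E : X.Modules} {U : X.Opens} (a : Γ(X, U)) (e : Γ(E, U)) :
    a • canon (K := K) e = canon (a • e) + (omegaToParts K E).app U (dTmul a e) := by
  have h1 : canon (K := K) (a • e) = partsTmul (PP.right K _ a) e := by
    refine congrArg ((partsPre K E).toSheaf U) ?_
    rw [PPT.tmul_smul, mul_one]
  have h2 : a • canon (K := K) e = partsTmul (PP.left K _ a) e := by
    refine (((partsPre K E).toSheaf U).map_smul a _).symm.trans ?_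
    refine congrArg ((partsPre K E).toSheaf U) ((PPT.smul_tmul' a 1 e).trans ?_)
    rw [mul_one]
  have h3 : (omegaToParts K E).app U (dTmul a e) =
      partsTmul (PP.left K _ a) e - partsTmul (PP.right K _ a) e := by
    rw [dTmul, omegaToParts_omegaTmul, PP.ofKaehler_D]
    exact (congrArg ((partsPre K E).toSheaf U) (PPT.sub_tmul _ _ e)).trans (map_sub _ _ _)
  rw [h1, h2, h3]
  abel

end Parts

section InverseImage

variable {K : Type u} [Field K] {X Y : Scheme.{u}} [X.Over (Spec (CommRingCat.of K))]
  [Y.Over (Spec (CommRingCat.of K))] {f : X ⟶ Y} [f.IsOver (Spec (CommRingCat.of K))]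
  {M : Y.Modules}

lemma omegaPull_toSheaf (V : Y.Opens) (x : (omegaPre K M).obj V) :
    (omegaPull f M).app V ((omegaPre K M).toSheaf V x) =
      (omegaPre K ((Scheme.Modules.pullback f).obj M)).toSheaf (f ⁻¹ᵁ V)
        (kaehlerTensorMap (pullO K f le_rfl) (pull f M V) (pull_smul' f M V) x) :=
  (omegaPre K M).lift_toSheaf _ _ _ _ V x

lemma partsPull_toSheaf (V : Y.Opens) (x : (partsPre K M).obj V) :
    (partsPull f M).app V ((partsPre K M).toSheaf V x) =
      (partsPre K ((Scheme.Modules.pullback f).obj M)).toSheaf (f ⁻¹ᵁ V)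
        (PPT.map (pullO K f le_rfl) (pull f M V) (pull_smul' f M V) x) :=
  (partsPre K M).lift_toSheaf _ _ _ _ V x

lemma omegaPull_dTmul (V : Y.Opens) (b : Γ(Y, V)) (m : Γ(M, V)) :
    (omegaPull f M).app V (dTmul (K := K) b m) =
      dTmul (K := K) (pullO K f (le_refl (f ⁻¹ᵁ V)) b) (pull f M V m) := by
  refine (omegaPull_toSheaf V _).trans
    (congrArg ((omegaPre K ((Scheme.Modules.pullback f).obj M)).toSheaf (f ⁻¹ᵁ V)) ?_)
  refine (kaehlerTensorMap_tmul _ _ _ _ _).trans ?_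
  rw [kaehlerMap_D]

lemma partsPull_canon (V : Y.Opens) (m : Γ(M, V)) :
    (partsPull f M).app V (canon (K := K) m) = canon (K := K) (pull f M V m) := by
  refine (partsPull_toSheaf V _).trans
    (congrArg ((partsPre K ((Scheme.Modules.pullback f).obj M)).toSheaf (f ⁻¹ᵁ V)) ?_)
  refine (PPT.map_tmul _ _ _ _ _).trans ?_
  rw [map_one]

lemma partsPull_omegaToParts (V : Y.Opens) (s : Γ(Omega K M, V)) :
    (partsPull f M).app V ((omegaToParts K M).app V s) =
      (omegaToParts K ((Scheme.Modules.pullback f).obj M)).app (f ⁻¹ᵁ V)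
        ((omegaPull f M).app V s) := by
  have h1 : omegaToParts K M ≫ partsPull f M = omegaPull f M ≫
      (Scheme.Modules.pushforward f).map (omegaToParts K ((Scheme.Modules.pullback f).obj M)) := by
    refine PreMod.sheaf_hom_ext (P := omegaPre K M) fun V x => ?_
    change (partsPull f M).app V ((omegaToParts K M).app V ((omegaPre K M).toSheaf V x)) =
      (omegaToParts K ((Scheme.Modules.pullback f).obj M)).app (f ⁻¹ᵁ V)
        ((omegaPull f M).app V ((omegaPre K M).toSheaf V x))
    rw [omegaToParts_toSheaf, omegaPull_toSheaf]
    refine (partsPull_toSheaf V _).trans ?_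
    refine Eq.trans ?_ (omegaToParts_toSheaf _ _ _).symm
    exact congrArg ((partsPre K _).toSheaf _) (PPT.map_ofKaehler _ _ _ _)
  exact CategoryTheory.congr_fun (congrArg (fun φ => Scheme.Modules.Hom.app φ V) h1) s

lemma pullDelta_pull (c : Connection K M) (V : Y.Opens) (m : Γ(M, V)) :
    (pullDelta f c).app (f ⁻¹ᵁ V) (pull f M V m) = canon (pull f M V m) +
      (omegaToParts K ((Scheme.Modules.pullback f).obj M)).app (f ⁻¹ᵁ V)
        ((omegaPull f M).app V (c.apply m)) := by
  have h1 : pullDelta f c = pullLift f (c.delta ≫ partsPull f M) :=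
    (Adjunction.homEquiv_naturality_left_symm _ _ _).symm
  rw [h1, pullLift_pull]
  change (partsPull f M).app V (c.delta.app V m) = _
  rw [Connection.delta_app, map_add, partsPull_canon, partsPull_omegaToParts]
  rfl

/-- The value of `f^*δ` at `α ⊗ m`: the correction to `1 ⊗ (α ⊗ m)` lies in `Ω¹ ⊗ f^*M`. -/
lemma pullDelta_tmul (c : Connection K M) {U : X.Opens} {V : Y.Opens} (h : U ≤ f ⁻¹ᵁ V)
    (a : Γ(X, U)) (m : Γ(M, V)) :
    (pullDelta f c).app U (tmul f M h a m) = canon (tmul f M h a m) +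
      (omegaToParts K ((Scheme.Modules.pullback f).obj M)).app U
        (a • res (Omega K ((Scheme.Modules.pullback f).obj M)) h
            ((omegaPull f M).app V (c.apply m)) + dTmul a (tmul f M h 1 m)) := by
  have key : ∀ t : Γ(Omega K ((Scheme.Modules.pullback f).obj M), f ⁻¹ᵁ V),
      (pullDelta f c).app (f ⁻¹ᵁ V) (pull f M V m) = canon (pull f M V m) +
        (omegaToParts K _).app (f ⁻¹ᵁ V) t →
      (pullDelta f c).app U (tmul f M h a m) = canon (tmul f M h a m) +
        (omegaToParts K _).app U (a • res _ h t + dTmul a (tmul f M h 1 m)) := by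
    intro t ht
    rw [tmul, Scheme.Modules.Hom.app_smul, app_res, ht, map_add, canon_res, smul_add,
      smul_canon, map_add, Scheme.Modules.Hom.app_smul, one_tmul, app_res]
    abel
  exact key _ (pullDelta_pull c V m)

lemma exists_pullDelta_eq (c : Connection K M) (U : X.Opens)
    (s : Γ((Scheme.Modules.pullback f).obj M, U)) :
    ∃ t : Γ(Omega K ((Scheme.Modules.pullback f).obj M), U),
      (pullDelta f c).app U s = canon s + (omegaToParts K _).app U t := by
  refine pullback_induction (p := fun U s => ∃ t : Γ(Omega K _, U),
    (pullDelta f c).app U s = canon s + (omegaToParts K _).app U t) ?_ ?_ ?_ U s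
  · intro U s H
    obtain ⟨t, ht⟩ := exists_of_locally (Omega K ((Scheme.Modules.pullback f).obj M)) (U := U)
      (Q := fun V h t => (pullDelta f c).app V (res _ h s) =
        canon (res _ h s) + (omegaToParts K _).app V t) (by
      intro V W hV h t ht
      have h1 := congrArg (res (Parts K ((Scheme.Modules.pullback f).obj M)) h) ht
      rwa [map_add, ← app_res, ← app_res, canon_res, res_res] at h1) (by
      intro V hV t t' ht ht'
      exact omegaToParts_injective _ _ (add_left_cancel (ht.symm.trans ht')))
      H
    refine ⟨t, eq_of_locally _ fun x hx => ?_⟩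
    obtain ⟨V, h, hxV, hV⟩ := ht x hx
    refine ⟨V, h, hxV, ?_⟩
    rw [map_add, ← app_res, ← app_res, canon_res]
    exact hV
  · rintro U s s' ⟨t, ht⟩ ⟨t', ht'⟩
    refine ⟨t + t', ?_⟩
    rw [map_add, map_add, ht, ht', canon_add]
    abel
  · exact fun U V h a m => ⟨_, pullDelta_tmul c h a m⟩

/-- The section `(f^*∇)(s)`. -/
def Connection.pullNabla (c : Connection K M) {U : X.Opens}
    (s : Γ((Scheme.Modules.pullback f).obj M, U)) :
    Γ(Omega K ((Scheme.Modules.pullback f).obj M), U) := (exists_pullDelta_eq c U s).choose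

lemma Connection.pullDelta_eq (c : Connection K M) {U : X.Opens}
    (s : Γ((Scheme.Modules.pullback f).obj M, U)) :
    (pullDelta f c).app U s = canon s + (omegaToParts K _).app U (c.pullNabla s) :=
  (exists_pullDelta_eq c U s).choose_spec

lemma Connection.pullNabla_eq (c : Connection K M) {U : X.Opens}
    {s : Γ((Scheme.Modules.pullback f).obj M, U)}
    {t : Γ(Omega K ((Scheme.Modules.pullback f).obj M), U)}
    (h : (pullDelta f c).app U s = canon s + (omegaToParts K _).app U t) : c.pullNabla s = t :=
  omegaToParts_injective _ _ (add_left_cancel ((c.pullDelta_eq s).symm.trans h))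

variable (f) in
/-- The inverse image `f^*∇` of a connection. -/
def Connection.inverseImage (c : Connection K M) :
    Connection K ((Scheme.Modules.pullback f).obj M) where
  nabla := abHomOfApp (F := ((Scheme.Modules.pullback f).obj M).presheaf)
    (G := (Omega K ((Scheme.Modules.pullback f).obj M)).presheaf)
    (fun U => AddMonoidHom.mk'
      (fun e : Γ((Scheme.Modules.pullback f).obj M, U) => c.pullNabla e)
      fun e e' => c.pullNabla_eq (by
        rw [map_add, map_add, c.pullDelta_eq, c.pullDelta_eq, canon_add]; abel))
    fun U V h e => c.pullNabla_eq (f := f) (s := res _ h e)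
      (t := res (Omega K _) h (c.pullNabla e)) (by
        rw [app_res, app_res, c.pullDelta_eq, map_add, canon_res])
  leibniz U a e := c.pullNabla_eq (f := f) (by
    rw [Scheme.Modules.Hom.app_smul, map_add, Scheme.Modules.Hom.app_smul, c.pullDelta_eq,
      smul_add, smul_canon]
    abel)

lemma Connection.isInverseImage_iff (c : Connection K M)
    (c' : Connection K ((Scheme.Modules.pullback f).obj M)) :
    c.IsInverseImage f c' ↔ c' = c.inverseImage f := by
  constructor
  · intro h
    ext1
    ext U e
    change c'.apply (U := U) e = c.pullNabla (U := U) e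
    refine (c.pullNabla_eq ?_).symm
    rw [← Connection.delta_app]
    exact CategoryTheory.congr_fun (congrArg (fun φ => Scheme.Modules.Hom.app φ U) h.symm) e
  · rintro rfl
    unfold IsInverseImage
    ext U e
    exact (c.pullDelta_eq e).symm

lemma Connection.inverseImage_tmul (c : Connection K M) {U : X.Opens} {V : Y.Opens}
    (h : U ≤ f ⁻¹ᵁ V) (a : Γ(X, U)) (m : Γ(M, V)) :
    (c.inverseImage f).apply (tmul f M h a m) =
      a • res (Omega K ((Scheme.Modules.pullback f).obj M)) h
          ((omegaPull f M).app V (c.apply m)) + dTmul a (tmul f M h 1 m) :=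
  c.pullNabla_eq (pullDelta_tmul c h a m)

lemma Connection.along_inverseImage_tmul (c : Connection K M) {U : X.Opens} {V : Y.Opens}
    (h : U ≤ f ⁻¹ᵁ V) {n : ℕ} {y : Fin n → Γ(Y, V)} {η : Fin n → VectorField K V}
    (hy : IsCoordinates y η) (d : VectorField K U) (a : Γ(X, U)) (m : Γ(M, V)) :
    (c.inverseImage f).along d (tmul f M h a m) =
      a • ∑ i, tmul f M h (d.apply (pullO K f h (y i))) (c.along (η i) m) +
        tmul f M h (d.apply a) m := by
  have h1 : ∀ i, contract d (res (Omega K ((Scheme.Modules.pullback f).obj M)) h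
      ((omegaPull f M).app V (dTmul (y i) (c.along (η i) m)))) =
      tmul f M h (d.apply (pullO K f h (y i))) (c.along (η i) m) := by
    intro i
    rw [omegaPull_dTmul]
    refine (congrArg (contract d) (dTmul_res h _ _)).trans ?_
    rw [contract_dTmul, resO_pullO]
    rfl
  rw [Connection.along, c.inverseImage_tmul, contract_add, contract_smul, contract_dTmul,
    smul_tmul, mul_one]
  congr 2
  conv_lhs => rw [hy.omega_eq_sum (c.apply m)]
  rw [map_sum, ← Finset.sum_congr rfl fun i _ => h1 i, ← contract_finsum]
  exact congrArg (contract d) (map_sum (res (Omega K ((Scheme.Modules.pullback f).obj M)) h) _ _)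

/-- The curvature `Δ_[∂,∂'] - [Δ_∂, Δ_∂']`. -/
def Connection.curvature {E : X.Modules} (c : Connection K E) {U : X.Opens}
    (d d' : VectorField K U) : Γ(E, U) →+ Γ(E, U) :=
  c.alongEnd (d.bracket d') - (c.alongEnd d * c.alongEnd d' - c.alongEnd d' * c.alongEnd d)

lemma Connection.curvature_apply {E : X.Modules} (c : Connection K E) {U : X.Opens}
    (d d' : VectorField K U) (e : Γ(E, U)) : c.curvature d d' e = c.along (d.bracket d') e -
      (c.along d (c.along d' e) - c.along d' (c.along d e)) := rfl

lemma Connection.curvature_smul {E : X.Modules} (c : Connection K E) {U : X.Opens}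
    (d d' : VectorField K U) (a : Γ(X, U)) (e : Γ(E, U)) :
    c.curvature d d' (a • e) = a • c.curvature d d' e := by
  have h1 : (d.bracket d').apply a = d.apply (d'.apply a) - d'.apply (d.apply a) := rfl
  simp only [curvature_apply, along_smul, along_add, h1, smul_sub, sub_smul]
  abel

lemma Connection.curvature_res {E : X.Modules} (c : Connection K E) {U V : X.Opens} (h : V ≤ U)
    (d d' : VectorField K U) (e : Γ(E, U)) :
    res E h (c.curvature d d' e) = c.curvature (d.res h) (d'.res h) (res E h e) := by
  simp only [curvature_apply, map_sub, ← along_res]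
  rfl

lemma Connection.along_finsum {E : X.Modules} (c : Connection K E) {U : X.Opens}
    (d : VectorField K U) {n : ℕ} (e : Fin n → Γ(E, U)) :
    c.along d (∑ i, e i) = ∑ i, c.along d (e i) := map_sum (c.alongEnd d) _ _

lemma Connection.Integrable.along_comm {E : X.Modules} {c : Connection K E} (hc : c.Integrable)
    {U : X.Opens} {n : ℕ} {y : Fin n → Γ(X, U)} {η : Fin n → VectorField K U}
    (h : IsCoordinates y η) (i j : Fin n) (e : Γ(E, U)) :
    c.along (η i) (c.along (η j) e) = c.along (η j) (c.along (η i) e) :=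
  congrArg (fun T : DOp K U × AddMonoid.End Γ(E, U) => T.2 e) ((h.isWeylSystem hc).comm i j)

/-- The curvature of `f^*∇` is `O_X`-linear, and it vanishes on `1 ⊗ m` since the operators
`Δ_{ηᵢ}` on `M` commute. -/
lemma Connection.Integrable.inverseImage [Smooth (Y ↘ Spec (CommRingCat.of K))]
    {c : Connection K M} (hc : c.Integrable) : (c.inverseImage f).Integrable := by
  have key : ∀ (U : X.Opens) (s : Γ((Scheme.Modules.pullback f).obj M, U)),
      ∀ (W : X.Opens) (hW : W ≤ U) (d d' : VectorField K W),
        (c.inverseImage f).curvature d d' (res _ hW s) = 0 := by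
    refine pullback_induction_coordinates (K := K) ?_ ?_ ?_
    · intro U s H W hW d d'
      refine eq_of_locally _ fun x hx => ?_
      obtain ⟨V, h, hxV, hV⟩ := H x (hW hx)
      refine ⟨W ⊓ V, inf_le_left, ⟨hx, hxV⟩, ?_⟩
      rw [curvature_res, map_zero, res_res]
      have := hV (W ⊓ V) inf_le_right (d.res inf_le_left) (d'.res inf_le_left)
      rwa [res_res] at this
    · intro U s t hs ht W hW d d'
      rw [map_add, map_add, hs, ht, add_zero]
    · intro U V h n y η hy a m W hW d d'
      have hWV := hW.trans h
      have hone : ∀ (d : VectorField K W) (m : Γ(M, V)),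
          (c.inverseImage f).along d (tmul f M hWV 1 m) =
            ∑ i, d.apply (pullO K f hWV (y i)) • tmul f M hWV 1 (c.along (η i) m) := by
        intro d m
        have h1 : d.apply 1 = 0 := (d.der W le_rfl).map_one_eq_zero
        have h0 : tmul f M hWV 0 m = 0 := zero_smul _ _
        rw [c.along_inverseImage_tmul hWV hy, h1, h0, add_zero, one_smul]
        exact Finset.sum_congr rfl fun i _ => by rw [smul_tmul, mul_one]
      rw [res_tmul (K := K), ← mul_one (resO K hW a), ← smul_tmul, curvature_smul,
        curvature_apply]
      have htwo : ∀ d d' : VectorField K W,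
          (c.inverseImage f).along d ((c.inverseImage f).along d' (tmul f M hWV 1 m)) =
            ∑ i, ∑ j, (d'.apply (pullO K f hWV (y i)) * d.apply (pullO K f hWV (y j))) •
              tmul f M hWV 1 (c.along (η j) (c.along (η i) m)) +
            ∑ i, d.apply (d'.apply (pullO K f hWV (y i))) •
              tmul f M hWV 1 (c.along (η i) m) := by
        intro d d'
        rw [hone d' m, along_finsum, ← Finset.sum_add_distrib]
        refine Finset.sum_congr rfl fun i _ => ?_
        rw [along_smul, hone, Finset.smul_sum]
        simp only [smul_smul]
      have hsymm : ∑ i, ∑ j, (d'.apply (pullO K f hWV (y i)) * d.apply (pullO K f hWV (y j))) •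
            tmul f M hWV 1 (c.along (η j) (c.along (η i) m)) =
          ∑ i, ∑ j, (d.apply (pullO K f hWV (y i)) * d'.apply (pullO K f hWV (y j))) •
            tmul f M hWV 1 (c.along (η j) (c.along (η i) m)) := by
        rw [Finset.sum_comm]
        refine Finset.sum_congr rfl fun i _ => Finset.sum_congr rfl fun j _ => ?_
        rw [hc.along_comm hy i j, mul_comm]
      have hbr : ∀ b : Γ(X, W), (d.bracket d').apply b =
        d.apply (d'.apply b) - d'.apply (d.apply b) := fun _ => rfl
      rw [htwo d d', htwo d' d, hsymm, hone, add_sub_add_left_eq_sub, ← Finset.sum_sub_distrib]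
      simp only [hbr, sub_smul, sub_self, smul_zero]
  intro U d d' e
  have := key U e U le_rfl d d'
  rw [res_self, curvature_apply] at this
  exact sub_eq_zero.mp this

end InverseImage

end DConn

end

noncomputable section

namespace DConn

/-! ### The inverse image of a `D`-module -/

section Operators

variable {K : Type u} [Field K] {X : Scheme.{u}} [X.Over (Spec (CommRingCat.of K))]
  {E : X.Modules}

/-- The action of a differential operator on sections. -/
def DModuleStructure.opS (ρ : DModuleStructure K E) {U : X.Opens} (P : DOp K U) :
    Γ(E, U) →+ Γ(E, U) := ρ.toDAction.op U P

lemma DModuleStructure.opS_mul (ρ : DModuleStructure K E) {U : X.Opens} (P Q : DOp K U)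
    (e : Γ(E, U)) : ρ.opS (P * Q) e = ρ.opS P (ρ.opS Q e) :=
  congrArg (fun T : AddMonoid.End Γ(E, U) => T e) (map_mul (ρ.toDAction.op U) P Q)

lemma DModuleStructure.opS_add (ρ : DModuleStructure K E) {U : X.Opens} (P Q : DOp K U)
    (e : Γ(E, U)) : ρ.opS (P + Q) e = ρ.opS P e + ρ.opS Q e :=
  congrArg (fun T : AddMonoid.End Γ(E, U) => T e) (map_add (ρ.toDAction.op U) P Q)

lemma DModuleStructure.opS_one (ρ : DModuleStructure K E) {U : X.Opens}
    (e : Γ(E, U)) : ρ.opS 1 e = e :=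
  congrArg (fun T : AddMonoid.End Γ(E, U) => T e) (map_one (ρ.toDAction.op U))

lemma DModuleStructure.opS_ofFun (ρ : DModuleStructure K E) {U : X.Opens} (a : Γ(X, U))
    (e : Γ(E, U)) : ρ.opS (DOp.ofFun a) e = a • e := ρ.act_ofFun U a e

lemma DModuleStructure.res_opS (ρ : DModuleStructure K E) {U V : X.Opens} (h : V ≤ U)
    (P : DOp K U) (e : Γ(E, U)) : res E h (ρ.opS P e) = ρ.opS (DOp.res h P) (res E h e) :=
  ρ.toDAction.res_op h P e

lemma Connection.corresponds_iff [CharZero K] [Smooth (X ↘ Spec (CommRingCat.of K))]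
    {c : Connection K E} (hc : c.Integrable) (ρ : DModuleStructure K E) :
    c.Corresponds ρ ↔ ρ = Connection.toDModule hc := by
  refine ⟨fun h => DModuleStructure.ext_der fun U d e =>
    (h U d e).trans (Connection.corresponds_toDModule hc U d e).symm, ?_⟩
  rintro rfl
  exact Connection.corresponds_toDModule hc

end Operators

section InverseImage

variable {K : Type u} [Field K] [CharZero K] {X Y : Scheme.{u}}
  [X.Over (Spec (CommRingCat.of K))] [Y.Over (Spec (CommRingCat.of K))]
  [Smooth (X ↘ Spec (CommRingCat.of K))] [Smooth (Y ↘ Spec (CommRingCat.of K))]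
  (f : X ⟶ Y) [f.IsOver (Spec (CommRingCat.of K))] {M : Y.Modules}

/-- The inverse image of a `D`-module, defined through the inverse image of the connection. -/
def DModuleStructure.inverseImage (ρ : DModuleStructure K M) :
    DModuleStructure K ((Scheme.Modules.pullback f).obj M) :=
  Connection.toDModule (ρ.corresponds_toConnection.integrable.inverseImage (f := f))

lemma DModuleStructure.der_inverseImage (ρ : DModuleStructure K M) {U : X.Opens}
    (d : VectorField K U) (s : Γ((Scheme.Modules.pullback f).obj M, U)) :
    (ρ.inverseImage f).der d s = (ρ.toConnection.inverseImage f).along d s :=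
  Connection.corresponds_toDModule _ U d s

variable {f}

lemma DModuleStructure.der_inverseImage_tmul (ρ : DModuleStructure K M) {U : X.Opens}
    {V : Y.Opens} (h : U ≤ f ⁻¹ᵁ V) {n : ℕ} {y : Fin n → Γ(Y, V)} {η : Fin n → VectorField K V}
    (hy : IsCoordinates y η) (d : VectorField K U) (a : Γ(X, U)) (m : Γ(M, V)) :
    (ρ.inverseImage f).der d (tmul f M h a m) = tmul f M h (d.apply a) m +
      a • ∑ i, tmul f M h (d.apply (pullO K f h (y i))) (ρ.der (η i) m) := by
  rw [der_inverseImage, Connection.along_inverseImage_tmul _ h hy, add_comm]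
  simp only [ρ.along_toConnection]

lemma DModuleStructure.isInverseImage_iff (ρ : DModuleStructure K M)
    (σ : DModuleStructure K ((Scheme.Modules.pullback f).obj M)) :
    ρ.IsInverseImage f σ ↔ σ = ρ.inverseImage f := by
  constructor
  · intro hσ
    have key : ∀ (U : X.Opens) (s : Γ((Scheme.Modules.pullback f).obj M, U)),
        ∀ (W : X.Opens) (hW : W ≤ U) (d : VectorField K W),
          σ.der d (res _ hW s) = (ρ.inverseImage f).der d (res _ hW s) := by
      refine pullback_induction_coordinates (K := K) ?_ ?_ ?_
      · intro U s H W hW d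
        refine eq_of_locally _ fun x hx => ?_
        obtain ⟨V, h, hxV, hV⟩ := H x (hW hx)
        refine ⟨W ⊓ V, inf_le_left, ⟨hx, hxV⟩, ?_⟩
        rw [der_res, der_res, res_res]
        have := hV (W ⊓ V) inf_le_right (d.res inf_le_left)
        rwa [res_res] at this
      · intro U s t hs ht W hW d
        simp only [map_add, hs, ht]
      · intro U V h n y η hy a m W hW d
        rw [res_tmul (K := K), ρ.der_inverseImage_tmul _ hy]
        exact hσ.derivation_tmul W V _ n y η hy d _ m
    refine ext_der fun U d e => ?_
    have := key U e U le_rfl d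
    rwa [res_self] at this
  · rintro rfl
    exact ⟨fun U V h b a m => ((ρ.inverseImage f).act_ofFun U b _).trans (smul_tmul h b a m),
      fun U V h n y η hy d a m => ρ.der_inverseImage_tmul h hy d a m⟩

end InverseImage

/-! ### Evaluation of transfer operators on sections -/

section Eval

variable {K : Type u} [Field K] {X Y : Scheme.{u}}
  [X.Over (Spec (CommRingCat.of K))] [Y.Over (Spec (CommRingCat.of K))]
  {f : X ⟶ Y} [f.IsOver (Spec (CommRingCat.of K))] {M : Y.Modules}

/-- Induction on the sections of `f^*M` over open subsets of `f⁻¹(V)`: it suffices to consider the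
sections `α ⊗ m` with `m` defined on a coordinate open subset of `V`. -/
theorem pullback_induction_le [Smooth (Y ↘ Spec (CommRingCat.of K))] (V : Y.Opens)
    {p : ∀ U : X.Opens, U ≤ f ⁻¹ᵁ V → Γ((Scheme.Modules.pullback f).obj M, U) → Prop}
    (hloc : ∀ U hU s, (∀ x ∈ U, ∃ (W : X.Opens) (h : W ≤ U), x ∈ W ∧
      p W (h.trans hU) (res _ h s)) → p U hU s)
    (hadd : ∀ U hU s t, p U hU s → p U hU t → p U hU (s + t))
    (htmul : ∀ (U : X.Opens) (W : Y.Opens) (hW : W ≤ V) (h : U ≤ f ⁻¹ᵁ W) (n : ℕ)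
      (y : Fin n → Γ(Y, W)) (η : Fin n → VectorField K W), IsCoordinates y η →
      ∀ (a : Γ(X, U)) (m : Γ(M, W)), p U (h.trans (preimage_le f hW)) (tmul f M h a m))
    {U : X.Opens} (hU : U ≤ f ⁻¹ᵁ V) (s : Γ((Scheme.Modules.pullback f).obj M, U)) :
    p U hU s := by
  refine pullback_induction (p := fun U s => ∀ hU, p U hU s) ?_ ?_ ?_ U s hU
  · intro U s H hU
    refine hloc U hU s fun x hx => ?_
    obtain ⟨W, h, hxW, hW⟩ := H x hx
    exact ⟨W, h, hxW, hW _⟩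
  · exact fun U s t hs ht hU => hadd U hU s t (hs hU) (ht hU)
  · intro U V' h a m hU
    refine hloc U hU _ fun x hx => ?_
    obtain ⟨W, -, hW, hxW, n, y, η, hy⟩ :=
      exists_coordinates_le (K := K) (X := Y) (U := V ⊓ V') (x := f x) ⟨hU hx, h hx⟩
    have h1 : U ⊓ f ⁻¹ᵁ W ≤ f ⁻¹ᵁ W := inf_le_right
    refine ⟨U ⊓ f ⁻¹ᵁ W, inf_le_left, ⟨hx, hxW⟩, ?_⟩
    rw [res_tmul (K := K), ← tmul_res h1 (hW.trans inf_le_right)]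
    exact htmul _ _ (hW.trans inf_le_left) _ _ _ _ hy _ _

/-- The section `α ⊗ P` of `D_{X → Y}`. -/
def transferTmul {U : X.Opens} {V : Y.Opens} (h : U ≤ f ⁻¹ᵁ V) (a : Γ(X, U)) (P : DOp K V) :
    Γ(Transfer K f, U) := tmul f (DMod K Y) h a P

/-- The map `D_Y(W) → (f^*M)(f⁻¹(V) ∩ f⁻¹(W))`, `Q ↦ 1 ⊗ Q m`, for `m ∈ M(V)`. -/
def evalAux (ρ : DModuleStructure K M) {V : Y.Opens} (m : Γ(M, V)) (W : Y.Opens) :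
    DOp K W →+ Γ((Scheme.Modules.pullback f).obj M, cap (f ⁻¹ᵁ V) (f ⁻¹ᵁ W)) :=
  AddMonoidHom.mk' (fun Q => tmul f M (preimage_inf_le f V W) 1
    (ρ.opS (DOp.res inf_le_right Q) (res M inf_le_left m))) fun P Q => by
      rw [map_add, ρ.opS_add, tmul_add]

lemma evalAux_apply (ρ : DModuleStructure K M) {V : Y.Opens} (m : Γ(M, V)) (W : Y.Opens)
    (Q : DOp K W) : evalAux ρ m W Q = tmul f M (preimage_inf_le f V W) 1
    (ρ.opS (DOp.res inf_le_right Q) (res M inf_le_left m)) := rfl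

lemma evalAux_res (ρ : DModuleStructure K M) {V : Y.Opens} (m : Γ(M, V)) {W W' : Y.Opens}
    (h : W' ≤ W) (Q : DOp K W) : evalAux (f := f) ρ m W' (DOp.res h Q) =
      res _ (cap_mono _ (preimage_le f h)) (evalAux ρ m W Q) := by
  have h1 : ρ.opS (DOp.res inf_le_right (DOp.res h Q)) (res M inf_le_left m) =
      res M (inf_le_inf_left V h) (ρ.opS (DOp.res inf_le_right Q) (res M inf_le_left m)) := by
    rw [ρ.res_opS, res_res]; rfl
  rw [evalAux_apply, evalAux_apply, h1, tmul_res, res_tmul (K := K), map_one]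

lemma evalAux_ofFun_mul (ρ : DModuleStructure K M) {V : Y.Opens} (m : Γ(M, V)) (W : Y.Opens)
    (a : Γ(Y, W)) (Q : DOp K W) : evalAux (f := f) ρ m W (DOp.ofFun a * Q) =
      resO K (cap_le_right (f ⁻¹ᵁ V) (f ⁻¹ᵁ W)) (pullO K f (le_refl (f ⁻¹ᵁ W)) a) •
        evalAux ρ m W Q := by
  rw [evalAux_apply, evalAux_apply, map_mul, DOp.res_ofFun, ρ.opS_mul, ρ.opS_ofFun,
    tmul_smul (K := K), smul_tmul, pullO_resO, resO_pullO, mul_comm]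

variable (f) in
/-- The morphism `D_Y → f_* j_* j^* f^*M`, `Q ↦ 1 ⊗ Q m`, for `m ∈ M(V)` and the inclusion
`j : f⁻¹(V) → X`. -/
def evalPre (ρ : DModuleStructure K M) {V : Y.Opens} (m : Γ(M, V)) : DMod K Y ⟶
    (Scheme.Modules.pushforward f).obj (openExt ((Scheme.Modules.pullback f).obj M) (f ⁻¹ᵁ V)) :=
  homOfApp
    (fun W => (openExtSections ((Scheme.Modules.pullback f).obj M) (f ⁻¹ᵁ V)
      (f ⁻¹ᵁ W)).symm.toAddMonoidHom.comp (evalAux ρ m W))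
    (fun _ _ h Q => evalAux_res ρ m h Q)
    (fun W a Q => by
      refine (evalAux_ofFun_mul ρ m W a Q).trans ?_
      rw [← app_eq_pullO]
      exact (openExtSections_smul K ((Scheme.Modules.pullback f).obj M) (f ⁻¹ᵁ V)
        (f.app W a) _).symm)

/-- The map `D_{X → Y} → f^*M`, `α ⊗ Q ↦ α ⊗ Q m`, on open subsets of `f⁻¹(V)`, for
`m ∈ M(V)`. -/
def rightEval (ρ : DModuleStructure K M) {U : X.Opens} {V : Y.Opens} (h : U ≤ f ⁻¹ᵁ V)
    (m : Γ(M, V)) : Γ(Transfer K f, U) →+ Γ((Scheme.Modules.pullback f).obj M, U) :=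
  (res _ (le_cap h le_rfl)).comp
    ((openExtSections _ (f ⁻¹ᵁ V) U).toAddMonoidHom.comp
      ((pullLift f (evalPre f ρ m)).app U).hom)

lemma rightEval_smul (ρ : DModuleStructure K M) {U : X.Opens} {V : Y.Opens} (h : U ≤ f ⁻¹ᵁ V)
    (m : Γ(M, V)) (a : Γ(X, U)) (n : Γ(Transfer K f, U)) :
    rightEval ρ h m (a • n) = a • rightEval ρ h m n := by
  change res _ _ (openExtSections _ _ _ ((pullLift f (evalPre f ρ m)).app U _)) =
    _ • res _ _ (openExtSections _ _ _ ((pullLift f (evalPre f ρ m)).app U _))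
  refine (congrArg (fun z => res ((Scheme.Modules.pullback f).obj M) (le_cap h le_rfl)
    (openExtSections _ (f ⁻¹ᵁ V) U z))
    (Scheme.Modules.Hom.app_smul (pullLift f (evalPre f ρ m)) a n)).trans ?_
  rw [openExtSections_smul K, res_smul (K := K), resO_resO, resO_self]
  rfl

lemma res_rightEval (ρ : DModuleStructure K M) {U U' : X.Opens} {V : Y.Opens}
    (h : U ≤ f ⁻¹ᵁ V) (h' : U' ≤ U) (m : Γ(M, V)) (n : Γ(Transfer K f, U)) :
    res _ h' (rightEval ρ h m n) = rightEval ρ (h'.trans h) m (res _ h' n) := by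
  change res _ _ (res _ _ (openExtSections _ _ _ ((pullLift f (evalPre f ρ m)).app U n))) =
    res _ _ (openExtSections _ _ _ ((pullLift f (evalPre f ρ m)).app U' (res _ h' n)))
  refine Eq.trans ?_ (congrArg (fun z => res _ (le_cap (h'.trans h) le_rfl)
    (openExtSections _ (f ⁻¹ᵁ V) U' z))
    (app_res (E := Transfer K f) (pullLift f (evalPre f ρ m)) h' n)).symm
  simp only [openExtSections_res, res_res]
  rfl

lemma rightEval_tmul (ρ : DModuleStructure K M) {U : X.Opens} {V W : Y.Opens} (hW : W ≤ V)
    (h : U ≤ f ⁻¹ᵁ W) (m : Γ(M, V)) (a : Γ(X, U)) (Q : DOp K W) :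
    rightEval ρ (h.trans (preimage_le f hW)) m (transferTmul h a Q) =
      tmul f M h a (ρ.opS Q (res M hW m)) := by
  have h1 : (pullLift f (evalPre f ρ m)).app U (res (Transfer K f) h (Transfer.pull f W Q)) =
      res (openExt _ (f ⁻¹ᵁ V)) h ((evalPre f ρ m).app W Q) := by
    rw [← pullLift_pull f (evalPre f ρ m) W Q, ← app_res]
    rfl
  have h2 : rightEval ρ (h.trans (preimage_le f hW)) m
      (res (Transfer K f) h (Transfer.pull f W Q)) = tmul f M h 1 (ρ.opS Q (res M hW m)) := by
    refine (congrArg (fun z => res ((Scheme.Modules.pullback f).obj M)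
      (le_cap (h.trans (preimage_le f hW)) le_rfl) (openExtSections _ (f ⁻¹ᵁ V) U z)) h1).trans ?_
    change res _ _ (res _ (cap_mono _ h) (evalAux ρ m W Q)) = _
    have h3 : ρ.opS (DOp.res inf_le_right Q) (res M inf_le_left m) =
        res M (inf_le_right : V ⊓ W ≤ W) (ρ.opS Q (res M hW m)) := by
      rw [ρ.res_opS, res_res]
    rw [evalAux_apply, h3, tmul_res, res_tmul (K := K), res_tmul (K := K), map_one, map_one]
  have h4 : transferTmul h a Q = a • res (Transfer K f) h (Transfer.pull f W Q) := rfl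
  rw [h4, rightEval_smul, h2, smul_tmul, mul_one]

end Eval

end DConn

end

noncomputable section

namespace DConn

/-! ### Linearity of the evaluation over differential operators -/

section EvalRight

variable {K : Type u} [Field K] {X Y : Scheme.{u}}
  [X.Over (Spec (CommRingCat.of K))] [Y.Over (Spec (CommRingCat.of K))]
  {f : X ⟶ Y} [f.IsOver (Spec (CommRingCat.of K))] {M : Y.Modules}

/-- Right multiplication by `P ∈ D_Y(V)` on the sections of `D_{X → Y}` over open subsets of
`f⁻¹(V)`. -/
def transferMul {U : X.Opens} {V : Y.Opens} (h : U ≤ f ⁻¹ᵁ V) (P : DOp K V) :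
    Γ(Transfer K f, U) →+ Γ(Transfer K f, U) := rightMul f h P

/-- The right multiplication is the evaluation for the left `D_Y`-module `D_Y`. -/
lemma transferMul_eq_rightEval {U : X.Opens} {V : Y.Opens} (h : U ≤ f ⁻¹ᵁ V) (P : DOp K V) :
    transferMul (f := f) h P = rightEval (f := f) (M := DMod K Y) (regular K Y) h P := by
  have h1 : mulRightPre f P = evalPre f (M := DMod K Y) (regular K Y) P := by
    ext W Q
    exact mulRightAux_apply f P W Q
  unfold transferMul rightMul rightEval
  rw [h1]
  rfl

lemma res_transferMul {U U' : X.Opens} {V : Y.Opens} (h : U ≤ f ⁻¹ᵁ V) (h' : U' ≤ U)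
    (P : DOp K V) (n : Γ(Transfer K f, U)) :
    res (Transfer K f) h' (transferMul h P n) = transferMul (h'.trans h) P (res _ h' n) :=
  rightMul_res f h h' P n

lemma transferMul_tmul {U : X.Opens} {V W : Y.Opens} (hW : W ≤ V) (h : U ≤ f ⁻¹ᵁ W)
    (P : DOp K V) (a : Γ(X, U)) (Q : DOp K W) :
    transferMul (h.trans (preimage_le f hW)) P (transferTmul h a Q) =
      transferTmul h a (Q * DOp.res hW P) := by
  rw [transferMul_eq_rightEval]
  exact rightEval_tmul (M := DMod K Y) (regular K Y) hW h P a Q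

lemma transferMul_smul {U : X.Opens} {V : Y.Opens} (h : U ≤ f ⁻¹ᵁ V) (P : DOp K V) (a : Γ(X, U))
    (n : Γ(Transfer K f, U)) : transferMul h P (a • n) = a • transferMul h P n := by
  rw [transferMul_eq_rightEval]
  exact rightEval_smul (M := DMod K Y) (regular K Y) h P a n

variable [Smooth (Y ↘ Spec (CommRingCat.of K))]

/-- Induction on the sections of `D_{X → Y}` over open subsets of `f⁻¹(V)`. -/
theorem transfer_induction (V : Y.Opens)
    {p : ∀ U : X.Opens, U ≤ f ⁻¹ᵁ V → Γ(Transfer K f, U) → Prop}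
    (hloc : ∀ U hU s, (∀ x ∈ U, ∃ (W : X.Opens) (h : W ≤ U), x ∈ W ∧
      p W (h.trans hU) (res _ h s)) → p U hU s)
    (hadd : ∀ U hU s t, p U hU s → p U hU t → p U hU (s + t))
    (htmul : ∀ (U : X.Opens) (W : Y.Opens) (hW : W ≤ V) (h : U ≤ f ⁻¹ᵁ W) (n : ℕ)
      (y : Fin n → Γ(Y, W)) (η : Fin n → VectorField K W), IsCoordinates y η →
      ∀ (a : Γ(X, U)) (Q : DOp K W), p U (h.trans (preimage_le f hW)) (transferTmul h a Q))
    {U : X.Opens} (hU : U ≤ f ⁻¹ᵁ V) (s : Γ(Transfer K f, U)) : p U hU s :=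
  pullback_induction_le (M := DMod K Y) V hloc hadd htmul hU s

lemma rightEval_res (ρ : DModuleStructure K M) {U : X.Opens} {V V' : Y.Opens}
    (h : U ≤ f ⁻¹ᵁ V') (hV : V' ≤ V) (m : Γ(M, V)) (n : Γ(Transfer K f, U)) :
    rightEval ρ h (res M hV m) n = rightEval ρ (h.trans (preimage_le f hV)) m n := by
  refine transfer_induction V' (p := fun U h n => rightEval ρ h (res M hV m) n =
    rightEval ρ (h.trans (preimage_le f hV)) m n) ?_ ?_ ?_ h n
  · intro U hU s H
    refine eq_of_locally _ fun x hx => ?_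
    obtain ⟨W, h, hxW, hW⟩ := H x hx
    refine ⟨W, h, hxW, ?_⟩
    rw [res_rightEval, res_rightEval, hW]
  · intro U hU s t hs ht
    rw [map_add, map_add, hs, ht]
  · intro U W hW h n y η hy a Q
    rw [rightEval_tmul ρ hW h, rightEval_tmul ρ (hW.trans hV) h, res_res]

lemma rightEval_add_right (ρ : DModuleStructure K M) {U : X.Opens} {V : Y.Opens}
    (h : U ≤ f ⁻¹ᵁ V) (m m' : Γ(M, V)) (n : Γ(Transfer K f, U)) :
    rightEval ρ h (m + m') n = rightEval ρ h m n + rightEval ρ h m' n := by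
  refine transfer_induction V (p := fun U h n => rightEval ρ h (m + m') n =
    rightEval ρ h m n + rightEval ρ h m' n) ?_ ?_ ?_ h n
  · intro U hU s H
    refine eq_of_locally _ fun x hx => ?_
    obtain ⟨W, h, hxW, hW⟩ := H x hx
    refine ⟨W, h, hxW, ?_⟩
    rw [map_add, res_rightEval, res_rightEval, res_rightEval, hW]
  · intro U hU s t hs ht
    rw [map_add, map_add, map_add, hs, ht]
    abel
  · intro U W hW h n y η hy a Q
    rw [rightEval_tmul ρ hW h, rightEval_tmul ρ hW h, rightEval_tmul ρ hW h, map_add, map_add,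
      tmul_add]

lemma rightEval_transferMul (ρ : DModuleStructure K M) {U : X.Opens} {V : Y.Opens}
    (h : U ≤ f ⁻¹ᵁ V) (P : DOp K V) (m : Γ(M, V)) (n : Γ(Transfer K f, U)) :
    rightEval ρ h m (transferMul h P n) = rightEval ρ h (ρ.opS P m) n := by
  refine transfer_induction V (p := fun U h n => rightEval ρ h m (transferMul h P n) =
    rightEval ρ h (ρ.opS P m) n) ?_ ?_ ?_ h n
  · intro U hU s H
    refine eq_of_locally _ fun x hx => ?_
    obtain ⟨W, h, hxW, hW⟩ := H x hx
    refine ⟨W, h, hxW, ?_⟩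
    rw [res_rightEval, res_rightEval, res_transferMul, hW]
  · intro U hU s t hs ht
    rw [map_add, map_add, map_add, hs, ht]
  · intro U W hW h n y η hy a Q
    rw [transferMul_tmul hW h, rightEval_tmul ρ hW h, rightEval_tmul ρ hW h, ρ.opS_mul,
      ρ.res_opS]

end EvalRight

section EvalLeft

variable {K : Type u} [Field K] [CharZero K] {X Y : Scheme.{u}}
  [X.Over (Spec (CommRingCat.of K))] [Y.Over (Spec (CommRingCat.of K))]
  [Smooth (X ↘ Spec (CommRingCat.of K))] [Smooth (Y ↘ Spec (CommRingCat.of K))]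
  (f : X ⟶ Y) [f.IsOver (Spec (CommRingCat.of K))] {M : Y.Modules}

/-- The `D_X`-module `D_{X → Y}`. -/
def transferModule : DModuleStructure K (Transfer K f) :=
  DModuleStructure.inverseImage (M := DMod K Y) f (regular K Y)

variable {f}

lemma der_transferModule_tmul {U : X.Opens} {V : Y.Opens} (h : U ≤ f ⁻¹ᵁ V) {n : ℕ}
    {y : Fin n → Γ(Y, V)} {η : Fin n → VectorField K V} (hy : IsCoordinates y η)
    (d : VectorField K U) (a : Γ(X, U)) (Q : DOp K V) :
    (transferModule f).der d (transferTmul h a Q) = transferTmul h (d.apply a) Q +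
      a • ∑ i, transferTmul h (d.apply (pullO K f h (y i))) ((η i).toOp * Q) :=
  DModuleStructure.der_inverseImage_tmul (M := DMod K Y) (regular K Y) h hy d a Q

/-- The evaluation maps `D_{X → Y} → f^*M` are `D_X`-linear. -/
theorem opS_rightEval (ρ : DModuleStructure K M) {U : X.Opens} {V : Y.Opens}
    (h : U ≤ f ⁻¹ᵁ V) (P : DOp K U) (m : Γ(M, V)) (n : Γ(Transfer K f, U)) :
    (ρ.inverseImage f).opS P (rightEval ρ h m n) =
      rightEval ρ h m ((transferModule f).opS P n) := by
  refine DOp.induction (p := fun U P => ∀ (h : U ≤ f ⁻¹ᵁ V) (n : Γ(Transfer K f, U)),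
    (ρ.inverseImage f).opS P (rightEval ρ h m n) =
      rightEval ρ h m ((transferModule f).opS P n)) ?_ ?_ ?_ ?_ ?_ P h n
  · intro U P H h n
    refine eq_of_locally _ fun x hx => ?_
    obtain ⟨W, hW, hxW, H'⟩ := H x hx
    refine ⟨W, hW, hxW, ?_⟩
    rw [DModuleStructure.res_opS, res_rightEval, res_rightEval, DModuleStructure.res_opS, H']
  · intro U a h n
    rw [DModuleStructure.opS_ofFun, DModuleStructure.opS_ofFun, rightEval_smul]
  · intro U d h n
    refine transfer_induction V (p := fun U h n => ∀ d : VectorField K U,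
      (ρ.inverseImage f).der d (rightEval ρ h m n) =
        rightEval ρ h m ((transferModule f).der d n)) ?_ ?_ ?_ h n d
    · intro U hU s H d
      refine eq_of_locally _ fun x hx => ?_
      obtain ⟨W, h, hxW, hW⟩ := H x hx
      refine ⟨W, h, hxW, ?_⟩
      rw [DModuleStructure.der_res, res_rightEval, res_rightEval, DModuleStructure.der_res, hW]
    · intro U hU s t hs ht d
      rw [map_add, map_add, map_add, map_add, hs, ht]
    · intro U W hW h n y η hy a Q d
      rw [der_transferModule_tmul h hy, rightEval_tmul ρ hW h, ρ.der_inverseImage_tmul h hy,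
        map_add, rightEval_smul, map_sum, rightEval_tmul ρ hW h]
      simp only [rightEval_tmul ρ hW h, ρ.opS_mul]
      rfl
  · intro U P Q hP hQ h n
    rw [DModuleStructure.opS_add, DModuleStructure.opS_add, map_add, hP, hQ]
  · intro U P Q hP hQ h n
    rw [DModuleStructure.opS_mul, DModuleStructure.opS_mul, hQ, hP]

lemma opS_transferMul {U : X.Opens} {V : Y.Opens} (h : U ≤ f ⁻¹ᵁ V) (P : DOp K U) (Q : DOp K V)
    (n : Γ(Transfer K f, U)) : (transferModule f).opS P (transferMul h Q n) =
      transferMul h Q ((transferModule f).opS P n) := by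
  rw [transferMul_eq_rightEval]
  exact opS_rightEval (M := DMod K Y) (regular K Y) h P Q n

end EvalLeft

end DConn

end

noncomputable section

namespace DConn

/-! ### The sheaf `D_{X → Y} ⊗ f⁻¹M` as a sheaf of modules -/

section TensorModule

variable {K : Type u} [Field K] {X Y : Scheme.{u}}
  [X.Over (Spec (CommRingCat.of K))] [Y.Over (Spec (CommRingCat.of K))]
  (f : X ⟶ Y) [f.IsOver (Spec (CommRingCat.of K))] {M : Y.Modules} (ρ : DModuleStructure K M)

/-- The sections of the presheaf `D_{X → Y} ⊗ f⁻¹M`. -/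
def InvSec (U : X.Opens) : Type u :=
  FreeAbelianGroup (InvGen (K := K) f M U) ⧸ invRels f ρ U

instance (U : X.Opens) : AddCommGroup (InvSec f ρ U) :=
  inferInstanceAs (AddCommGroup (FreeAbelianGroup (InvGen (K := K) f M U) ⧸ invRels f ρ U))

variable {f}

/-- The section `n ⊗ m`. -/
def InvSec.tmul {U : X.Opens} {V : Y.Opens} (h : U ≤ f ⁻¹ᵁ V) (n : Γ(Transfer K f, U))
    (m : Γ(M, V)) : InvSec f ρ U :=
  QuotientAddGroup.mk' (invRels f ρ U) (InvGen.mk f h n m)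

variable {ρ}

lemma InvSec.eq_of_rel {U : X.Opens} {x y : FreeAbelianGroup (InvGen (K := K) f M U)}
    (h : InvRel f ρ U (x - y)) :
    QuotientAddGroup.mk' (invRels f ρ U) x = QuotientAddGroup.mk' (invRels f ρ U) y := by
  rw [← sub_eq_zero, ← map_sub]
  exact (QuotientAddGroup.eq_zero_iff _).mpr (AddSubgroup.subset_closure h)

lemma InvSec.add_tmul {U : X.Opens} {V : Y.Opens} (h : U ≤ f ⁻¹ᵁ V) (n n' : Γ(Transfer K f, U))
    (m : Γ(M, V)) : tmul ρ h (n + n') m = tmul ρ h n m + tmul ρ h n' m :=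
  (InvSec.eq_of_rel (InvRel.add_left V h n n' m)).trans (map_add _ _ _)

lemma InvSec.zero_tmul {U : X.Opens} {V : Y.Opens} (h : U ≤ f ⁻¹ᵁ V) (m : Γ(M, V)) :
    tmul ρ h 0 m = 0 := by
  have h0 : tmul ρ h 0 m + tmul ρ h 0 m = tmul ρ h 0 m := by
    rw [← InvSec.add_tmul, add_zero]
  exact left_eq_add.mp h0.symm

lemma InvSec.tmul_add {U : X.Opens} {V : Y.Opens} (h : U ≤ f ⁻¹ᵁ V) (n : Γ(Transfer K f, U))
    (m m' : Γ(M, V)) : tmul ρ h n (m + m') = tmul ρ h n m + tmul ρ h n m' :=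
  (InvSec.eq_of_rel (InvRel.add_right V h n m m')).trans (map_add _ _ _)

lemma InvSec.tmul_res {U : X.Opens} {V V' : Y.Opens} (h : U ≤ f ⁻¹ᵁ V') (h' : V' ≤ V)
    (n : Γ(Transfer K f, U)) (m : Γ(M, V)) :
    tmul ρ h n (DConn.res M h' m) = tmul ρ (h.trans (preimage_le f h')) n m :=
  (InvSec.eq_of_rel (InvRel.res V V' h h' n m)).symm

lemma InvSec.transferMul_tmul {U : X.Opens} {V : Y.Opens} (h : U ≤ f ⁻¹ᵁ V)
    (n : Γ(Transfer K f, U)) (P : DOp K V) (m : Γ(M, V)) :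
    tmul ρ h (transferMul h P n) m = tmul ρ h n (ρ.opS P m) :=
  InvSec.eq_of_rel (InvRel.balanced V h n P m)

/-- Additive maps out of the presheaf tensor product. -/
def InvSec.lift {U : X.Opens} {G : Type u} [AddCommGroup G]
    (φ : ∀ (V : Y.Opens) (_ : U ≤ f ⁻¹ᵁ V), Γ(Transfer K f, U) → Γ(M, V) → G)
    (hadd_left : ∀ V h n n' m, φ V h (n + n') m = φ V h n m + φ V h n' m)
    (hadd_right : ∀ V h n m m', φ V h n (m + m') = φ V h n m + φ V h n m')
    (hres : ∀ (V V' : Y.Opens) (h : U ≤ f ⁻¹ᵁ V') (h' : V' ≤ V) n m,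
      φ V' h n (DConn.res M h' m) = φ V (h.trans (preimage_le f h')) n m)
    (hmul : ∀ (V : Y.Opens) (h : U ≤ f ⁻¹ᵁ V) (n : Γ(Transfer K f, U)) (P : DOp K V)
      (m : Γ(M, V)), φ V h (transferMul h P n) m = φ V h n (ρ.opS P m)) :
    InvSec f ρ U →+ G :=
  QuotientAddGroup.lift (invRels f ρ U)
    (FreeAbelianGroup.lift fun g : InvGen (K := K) f M U => φ g.1.1 g.1.2 g.2.1 g.2.2) (by
      have hof : ∀ (V : Y.Opens) (h : U ≤ f ⁻¹ᵁ V) n m,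
          FreeAbelianGroup.lift (fun g : InvGen (K := K) f M U => φ g.1.1 g.1.2 g.2.1 g.2.2)
            (InvGen.mk f h n m) = φ V h n m := fun V h n m => FreeAbelianGroup.lift_apply_of _ _
      rw [invRels, AddSubgroup.closure_le]
      rintro z (⟨V, hV, n, n', m⟩ | ⟨V, hV, n, m, m'⟩ | ⟨V, V', hV, hV', n, m⟩ | ⟨V, hV, n, P, m⟩)
        <;> refine (AddMonoidHom.mem_ker).mpr ?_ <;> simp only [map_sub, map_add, hof, sub_eq_zero]
      · exact hadd_left _ _ _ _ _
      · exact hadd_right _ _ _ _ _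
      · exact (hres _ _ _ _ _ _).symm
      · exact hmul _ _ _ _ _)

lemma InvSec.induction {U : X.Opens} {p : InvSec f ρ U → Prop}
    (htmul : ∀ (V : Y.Opens) (h : U ≤ f ⁻¹ᵁ V) n m, p (tmul ρ h n m))
    (hadd : ∀ x y, p x → p y → p (x + y)) (x : InvSec f ρ U) : p x := by
  obtain ⟨z, rfl⟩ := QuotientAddGroup.mk'_surjective (invRels f ρ U) x
  have hneg : ∀ (V : Y.Opens) (h : U ≤ f ⁻¹ᵁ V) n m, -tmul ρ h n m = tmul ρ h (-n) m := by
    intro V h n m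
    rw [neg_eq_iff_add_eq_zero, ← InvSec.add_tmul, add_neg_cancel, InvSec.zero_tmul]
  induction z using FreeAbelianGroup.induction_on with
  | zero =>
    have h0 := hadd _ _ (htmul ⊤ (fun _ _ => trivial) 0 0)
      ((congrArg p (hneg ⊤ (fun _ _ => trivial) 0 0)).mpr (htmul ⊤ _ _ 0))
    rwa [add_neg_cancel] at h0
  | of g => exact htmul g.1.1 g.1.2 g.2.1 g.2.2
  | neg g _ => exact (congrArg p (hneg g.1.1 g.1.2 g.2.1 g.2.2)).mpr (htmul _ _ _ _)
  | add x y hx hy => exact hadd _ _ hx hy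

lemma InvSec.hom_ext {U : X.Opens} {G : Type*} [AddCommGroup G] {φ ψ : InvSec f ρ U →+ G}
    (h : ∀ (V : Y.Opens) (h : U ≤ f ⁻¹ᵁ V) n m, φ (tmul ρ h n m) = ψ (tmul ρ h n m)) : φ = ψ :=
  AddMonoidHom.ext fun x => InvSec.induction (p := fun x => φ x = ψ x) h
    (fun x y hx hy => by rw [map_add, map_add, hx, hy]) x

variable (ρ) in
/-- Restriction of the sections of the presheaf tensor product. -/
def InvSec.res {U V : X.Opens} (h : V ≤ U) : InvSec f ρ U →+ InvSec f ρ V :=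
  QuotientAddGroup.map _ _ (InvGen.res f M h) (invRels_le f ρ h)

lemma InvSec.res_tmul {U U' : X.Opens} {V : Y.Opens} (h' : U' ≤ U) (h : U ≤ f ⁻¹ᵁ V)
    (n : Γ(Transfer K f, U)) (m : Γ(M, V)) :
    InvSec.res ρ h' (tmul ρ h n m) = tmul ρ (h'.trans h) (DConn.res _ h' n) m :=
  congrArg (QuotientAddGroup.mk' (invRels f ρ U')) (InvGen.res_mk f h' h n m)

/-- Multiplication by a function, `a (n ⊗ m) = (a n) ⊗ m`. -/
def InvSec.smulHom {U : X.Opens} (a : Γ(X, U)) : InvSec f ρ U →+ InvSec f ρ U :=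
  InvSec.lift (fun V h n m => tmul ρ h (a • n) m)
    (fun V h n n' m => by rw [smul_add, InvSec.add_tmul])
    (fun V h n m m' => InvSec.tmul_add _ _ _ _)
    (fun V V' h h' n m => InvSec.tmul_res _ _ _ _)
    (fun V h n P m => by rw [← transferMul_smul, InvSec.transferMul_tmul])

lemma InvSec.smulHom_tmul {U : X.Opens} {V : Y.Opens} (h : U ≤ f ⁻¹ᵁ V) (a : Γ(X, U))
    (n : Γ(Transfer K f, U)) (m : Γ(M, V)) :
    InvSec.smulHom a (tmul ρ h n m) = tmul ρ h (a • n) m :=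
  FreeAbelianGroup.lift_apply_of _ _

instance (U : X.Opens) : Module Γ(X, U) (InvSec f ρ U) :=
  Module.compHom (InvSec f ρ U)
    ({ toFun := InvSec.smulHom
       map_one' := InvSec.hom_ext fun V h n m => by rw [InvSec.smulHom_tmul, one_smul]; rfl
       map_mul' := fun a b => InvSec.hom_ext fun V h n m => by
         rw [InvSec.smulHom_tmul, mul_smul, ← InvSec.smulHom_tmul, ← InvSec.smulHom_tmul]; rfl
       map_zero' := InvSec.hom_ext fun V h n m => by
         rw [InvSec.smulHom_tmul, zero_smul, InvSec.zero_tmul]; rfl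
       map_add' := fun a b => InvSec.hom_ext fun V h n m => by
         rw [InvSec.smulHom_tmul, add_smul, InvSec.add_tmul, ← InvSec.smulHom_tmul,
           ← InvSec.smulHom_tmul]; rfl } : Γ(X, U) →+* AddMonoid.End (InvSec f ρ U))

lemma InvSec.smul_tmul {U : X.Opens} {V : Y.Opens} (h : U ≤ f ⁻¹ᵁ V) (a : Γ(X, U))
    (n : Γ(Transfer K f, U)) (m : Γ(M, V)) : a • tmul ρ h n m = tmul ρ h (a • n) m :=
  InvSec.smulHom_tmul h a n m

variable (f ρ) in
/-- The presheaf of modules `D_{X → Y} ⊗ f⁻¹M`. The abelian sheaf underlying its associated sheaf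
is, by definition, `InvD f ρ`. -/
def invMod : PreMod X where
  obj := InvSec f ρ
  res := InvSec.res ρ
  res_self h x := by
    induction x using InvSec.induction with
    | htmul V h' n m => rw [InvSec.res_tmul, res_self]
    | hadd x y hx hy => rw [map_add, hx, hy]
  res_res h h' x := by
    induction x using InvSec.induction with
    | htmul V h' n m => rw [InvSec.res_tmul, InvSec.res_tmul, InvSec.res_tmul, res_res]
    | hadd x y hx hy => rw [map_add, map_add, map_add, hx, hy]
  res_smul h a x := by
    induction x using InvSec.induction with
    | htmul V h' n m =>
      rw [InvSec.smul_tmul, InvSec.res_tmul, InvSec.res_tmul, res_smul (K := K)]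
      exact (InvSec.smul_tmul _ _ _ _).symm
    | hadd x y hx hy => rw [smul_add, map_add, map_add, smul_add, hx, hy]

end TensorModule

end DConn

end

noncomputable section

namespace DConn

/-! ### The comparison isomorphism -/

section Comparison

variable {K : Type u} [Field K] {X Y : Scheme.{u}}
  [X.Over (Spec (CommRingCat.of K))] [Y.Over (Spec (CommRingCat.of K))]
  [Smooth (Y ↘ Spec (CommRingCat.of K))]
  (f : X ⟶ Y) [f.IsOver (Spec (CommRingCat.of K))] {M : Y.Modules} (ρ : DModuleStructure K M)

variable {ρ} in
lemma toSheaf_tmul_res {U U' : X.Opens} {V : Y.Opens} (h : U ≤ f ⁻¹ᵁ V) (h' : U' ≤ U)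
    (n : Γ(Transfer K f, U)) (m : Γ(M, V)) :
    res (invMod f ρ).sheaf h' ((invMod f ρ).toSheaf U (InvSec.tmul ρ h n m)) =
      (invMod f ρ).toSheaf U' (InvSec.tmul ρ (h'.trans h) (res _ h' n) m) :=
  ((invMod f ρ).toSheaf_res h' _).symm.trans
    (congrArg ((invMod f ρ).toSheaf U') (InvSec.res_tmul h' h n m))

/-- The morphism `M → f_*(D_{X → Y} ⊗ f⁻¹M)`, `m ↦ (1 ⊗ 1) ⊗ m`. -/
def toTensorPre : M ⟶ (Scheme.Modules.pushforward f).obj (invMod f ρ).sheaf :=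
  homOfApp
    (fun V => AddMonoidHom.mk' (fun m => (invMod f ρ).toSheaf (f ⁻¹ᵁ V)
      (InvSec.tmul ρ le_rfl (transferTmul le_rfl 1 1) m)) fun m m' => by
        rw [InvSec.tmul_add]; exact map_add _ _ _)
    (fun V W h m => by
      refine Eq.trans ?_ (toSheaf_tmul_res f (U' := f ⁻¹ᵁ W) le_rfl (preimage_le f h)
        (transferTmul le_rfl 1 1) m).symm
      refine congrArg ((invMod f ρ).toSheaf (f ⁻¹ᵁ W)) ((InvSec.tmul_res _ h _ m).trans ?_)
      congr 1
      refine Eq.trans ?_ (res_tmul (K := K) (M := DMod K Y) (f := f) (le_refl (f ⁻¹ᵁ V))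
        (preimage_le f h) 1 (1 : DOp K V)).symm
      rw [map_one]
      exact tmul_res (M := DMod K Y) (f := f) (le_refl (f ⁻¹ᵁ W)) h 1 (1 : DOp K V))
    (fun V b m => by
      have h1 : transferMul (le_refl (f ⁻¹ᵁ V)) (DOp.ofFun b) (transferTmul le_rfl 1 1) =
          pullO K f (le_refl (f ⁻¹ᵁ V)) b • transferTmul le_rfl 1 (1 : DOp K V) := by
        rw [transferMul_tmul (f := f) (le_refl V) (le_refl (f ⁻¹ᵁ V)), one_mul, DOp.res_self,
          ← mul_one (DOp.ofFun b)]
        refine (tmul_smul (K := K) (M := DMod K Y) (f := f) (le_refl (f ⁻¹ᵁ V)) 1 b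
          (1 : DOp K V)).trans ?_
        rw [one_mul]
        exact (congrArg (fun a => tmul f (DMod K Y) (le_refl (f ⁻¹ᵁ V)) a (1 : DOp K V))
          (mul_one _).symm).trans (smul_tmul (M := DMod K Y) (f := f) (le_refl (f ⁻¹ᵁ V)) _ 1
            (1 : DOp K V)).symm
      have h2 : InvSec.tmul ρ (le_refl (f ⁻¹ᵁ V)) (transferTmul le_rfl 1 1) (b • m) =
          f.app V b • InvSec.tmul ρ (le_refl (f ⁻¹ᵁ V)) (transferTmul le_rfl 1 1) m := by
        rw [app_eq_pullO (K := K), InvSec.smul_tmul, ← h1, InvSec.transferMul_tmul, ρ.opS_ofFun]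
      exact (congrArg ((invMod f ρ).toSheaf (f ⁻¹ᵁ V)) h2).trans (map_smul _ _ _))

/-- The morphism `f^*M → D_{X → Y} ⊗ f⁻¹M`, `α ⊗ m ↦ (α ⊗ 1) ⊗ m`. -/
def toTensor : (Scheme.Modules.pullback f).obj M ⟶ (invMod f ρ).sheaf :=
  pullLift f (toTensorPre f ρ)

variable {f} in
/-- The map `n ⊗ m ↦ n m`, where `(α ⊗ Q) m = α ⊗ Q m`. -/
def evalSec (U : X.Opens) : InvSec f ρ U →+ Γ((Scheme.Modules.pullback f).obj M, U) :=
  InvSec.lift (fun _ h n m => rightEval ρ h m n)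
    (fun _ _ _ _ _ => map_add _ _ _)
    (fun _ h n m m' => rightEval_add_right ρ h m m' n)
    (fun _ _ h h' n m => rightEval_res ρ h h' m n)
    (fun _ h n P m => rightEval_transferMul ρ h P m n)

variable {f} in
lemma evalSec_tmul {U : X.Opens} {V : Y.Opens} (h : U ≤ f ⁻¹ᵁ V) (n : Γ(Transfer K f, U))
    (m : Γ(M, V)) : evalSec ρ U (InvSec.tmul ρ h n m) = rightEval ρ h m n :=
  FreeAbelianGroup.lift_apply_of _ _

variable {f} in
lemma evalSec_res {U V : X.Opens} (h : V ≤ U) (x : InvSec f ρ U) :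
    evalSec ρ V (InvSec.res ρ h x) = res _ h (evalSec ρ U x) := by
  induction x using InvSec.induction with
  | htmul V' h' n m => rw [InvSec.res_tmul, evalSec_tmul, evalSec_tmul, res_rightEval]
  | hadd x y hx hy => rw [map_add, map_add, map_add, map_add, hx, hy]

variable {f} in
lemma evalSec_smul {U : X.Opens} (a : Γ(X, U)) (x : InvSec f ρ U) :
    evalSec ρ U (a • x) = a • evalSec ρ U x := by
  induction x using InvSec.induction with
  | htmul V' h' n m => rw [InvSec.smul_tmul, evalSec_tmul, evalSec_tmul, rightEval_smul]
  | hadd x y hx hy => rw [smul_add, map_add, map_add, smul_add, hx, hy]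

/-- The morphism `D_{X → Y} ⊗ f⁻¹M → f^*M`, `(α ⊗ Q) ⊗ m ↦ α ⊗ Q m`. -/
def ofTensor : (invMod f ρ).sheaf ⟶ (Scheme.Modules.pullback f).obj M :=
  (invMod f ρ).lift _ (evalSec ρ) (fun _ _ h x => evalSec_res ρ h x)
    (fun _ a x => evalSec_smul ρ a x)

variable {f}

lemma toTensor_tmul {U : X.Opens} {V : Y.Opens} (h : U ≤ f ⁻¹ᵁ V) (a : Γ(X, U)) (m : Γ(M, V)) :
    (toTensor f ρ).app U (tmul f M h a m) =
      (invMod f ρ).toSheaf U (InvSec.tmul ρ h (transferTmul h a 1) m) := by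
  have h1 : (toTensor f ρ).app (f ⁻¹ᵁ V) (pull f M V m) =
      (invMod f ρ).toSheaf (f ⁻¹ᵁ V) (InvSec.tmul ρ le_rfl (transferTmul le_rfl 1 1) m) :=
    pullLift_pull f (toTensorPre f ρ) V m
  rw [tmul, Scheme.Modules.Hom.app_smul, app_res, h1, toSheaf_tmul_res]
  refine (map_smul ((invMod f ρ).toSheaf U) a _).symm.trans
    (congrArg ((invMod f ρ).toSheaf U) ((InvSec.smul_tmul h a _ m).trans ?_))
  congr 1
  refine (congrArg (a • ·) (res_tmul (K := K) (M := DMod K Y) (f := f) (le_refl (f ⁻¹ᵁ V)) h 1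
    (1 : DOp K V))).trans ?_
  rw [map_one]
  refine (smul_tmul (M := DMod K Y) (f := f) h a 1 (1 : DOp K V)).trans ?_
  rw [mul_one]
  rfl

lemma ofTensor_toSheaf {U : X.Opens} {V : Y.Opens} (h : U ≤ f ⁻¹ᵁ V) (n : Γ(Transfer K f, U))
    (m : Γ(M, V)) : (ofTensor f ρ).app U ((invMod f ρ).toSheaf U (InvSec.tmul ρ h n m)) =
      rightEval ρ h m n :=
  ((invMod f ρ).lift_toSheaf _ _ _ _ U _).trans (evalSec_tmul ρ h n m)

lemma toTensor_rightEval {U : X.Opens} {V : Y.Opens} (h : U ≤ f ⁻¹ᵁ V) (n : Γ(Transfer K f, U))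
    (m : Γ(M, V)) : (toTensor f ρ).app U (rightEval ρ h m n) =
      (invMod f ρ).toSheaf U (InvSec.tmul ρ h n m) := by
  refine transfer_induction V (p := fun U h n => (toTensor f ρ).app U (rightEval ρ h m n) =
      (invMod f ρ).toSheaf U (InvSec.tmul ρ h n m)) ?_ ?_ ?_ h n
  · intro U hU s H
    refine eq_of_locally _ fun x hx => ?_
    obtain ⟨W, h, hxW, hW⟩ := H x hx
    refine ⟨W, h, hxW, ?_⟩
    rw [← app_res, res_rightEval, hW, toSheaf_tmul_res]
  · intro U hU s t hs ht
    rw [map_add, map_add, hs, ht, InvSec.add_tmul]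
    exact (map_add ((invMod f ρ).toSheaf U) _ _).symm
  · intro U W hW h n y η hy a Q
    rw [rightEval_tmul ρ hW h, toTensor_tmul, ← InvSec.transferMul_tmul, InvSec.tmul_res,
      transferMul_tmul (le_refl W) h, one_mul, DOp.res_self]

variable (f) in
/-- The comparison isomorphism. -/
def tensorIso : (Scheme.Modules.pullback f).obj M ≅ (invMod f ρ).sheaf where
  hom := toTensor f ρ
  inv := ofTensor f ρ
  hom_inv_id := pullback_hom_ext f fun V m => by
    have h1 : (toTensor f ρ).app (f ⁻¹ᵁ V) (pull f M V m) =
        (invMod f ρ).toSheaf (f ⁻¹ᵁ V) (InvSec.tmul ρ le_rfl (transferTmul le_rfl 1 1) m) :=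
      pullLift_pull f (toTensorPre f ρ) V m
    change (ofTensor f ρ).app _ ((toTensor f ρ).app _ (pull f M V m)) = pull f M V m
    rw [h1, ofTensor_toSheaf, rightEval_tmul ρ (le_refl V) (le_refl (f ⁻¹ᵁ V)), ρ.opS_one,
      one_tmul, res_self, res_self]
  inv_hom_id := PreMod.sheaf_hom_ext fun U x => by
    change (toTensor f ρ).app U ((ofTensor f ρ).app U ((invMod f ρ).toSheaf U x)) =
      (invMod f ρ).toSheaf U x
    induction x using InvSec.induction with
    | htmul V h n m => rw [ofTensor_toSheaf, toTensor_rightEval]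
    | hadd x y hx hy =>
      have h1 := map_add ((invMod f ρ).toSheaf U) x y
      refine (congrArg (fun z => (toTensor f ρ).app U ((ofTensor f ρ).app U z)) h1).trans ?_
      rw [map_add, map_add]
      exact (congrArg₂ (· + ·) hx hy).trans h1.symm

lemma ofTensor_toTensor {U : X.Opens} (s : Γ((Scheme.Modules.pullback f).obj M, U)) :
    (ofTensor f ρ).app U ((toTensor f ρ).app U s) = s :=
  CategoryTheory.congr_fun (congrArg (fun φ => Scheme.Modules.Hom.app φ U)
    (tensorIso f ρ).hom_inv_id) s

lemma toTensor_ofTensor {U : X.Opens} (s : Γ((invMod f ρ).sheaf, U)) :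
    (toTensor f ρ).app U ((ofTensor f ρ).app U s) = s :=
  CategoryTheory.congr_fun (congrArg (fun φ => Scheme.Modules.Hom.app φ U)
    (tensorIso f ρ).inv_hom_id) s

end Comparison

section Action

variable {K : Type u} [Field K] [CharZero K] {X Y : Scheme.{u}}
  [X.Over (Spec (CommRingCat.of K))] [Y.Over (Spec (CommRingCat.of K))]
  [Smooth (X ↘ Spec (CommRingCat.of K))] [Smooth (Y ↘ Spec (CommRingCat.of K))]
  (f : X ⟶ Y) [f.IsOver (Spec (CommRingCat.of K))] {M : Y.Modules} (ρ : DModuleStructure K M)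

/-- The action of `D_X` on `D_{X → Y} ⊗ f⁻¹M`, transported from `f^*M`. -/
def tensorAction : DModuleStructure K (invMod f ρ).sheaf where
  act U :=
    { toFun := fun P => ((toTensor f ρ).app U).hom.comp
        (((ρ.inverseImage f).opS (P : DOp K U)).comp ((ofTensor f ρ).app U).hom)
      map_one' := AddMonoidHom.ext fun s =>
        (congrArg ((toTensor f ρ).app U) ((ρ.inverseImage f).opS_one _)).trans
          (toTensor_ofTensor ρ s)
      map_mul' := fun P Q => AddMonoidHom.ext fun s =>
        congrArg ((toTensor f ρ).app U) (((ρ.inverseImage f).opS_mul _ _ _).trans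
          (congrArg ((ρ.inverseImage f).opS (P : DOp K U)) (ofTensor_toTensor ρ _).symm))
      map_zero' := AddMonoidHom.ext fun s =>
        (congrArg ((toTensor f ρ).app U) (congrArg (fun T : AddMonoid.End _ => T _)
          (map_zero ((ρ.inverseImage f).toDAction.op U)))).trans (map_zero ((toTensor f ρ).app U).hom)
      map_add' := fun P Q => AddMonoidHom.ext fun s =>
        (congrArg ((toTensor f ρ).app U) ((ρ.inverseImage f).opS_add _ _ _)).trans
          (map_add ((toTensor f ρ).app U).hom _ _) }
  act_res U V h P s := by
    have key : ∀ P : DOp K U, res (invMod f ρ).sheaf h ((toTensor f ρ).app U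
        ((ρ.inverseImage f).opS P ((ofTensor f ρ).app U s))) =
          (toTensor f ρ).app V ((ρ.inverseImage f).opS (DOp.res h P)
            ((ofTensor f ρ).app V (res (invMod f ρ).sheaf h s))) := fun P => by
      rw [← app_res, DModuleStructure.res_opS, ← app_res]
    exact key P
  act_ofFun U a e := by
    change (toTensor f ρ).app U ((ρ.inverseImage f).opS (DOp.ofFun a) ((ofTensor f ρ).app U e)) = _
    rw [DModuleStructure.opS_ofFun, Scheme.Modules.Hom.app_smul, toTensor_ofTensor]

lemma tensorAction_opS {U : X.Opens} (P : DOp K U) (s : Γ((invMod f ρ).sheaf, U)) :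
    (tensorAction f ρ).opS P s =
      (toTensor f ρ).app U ((ρ.inverseImage f).opS P ((ofTensor f ρ).app U s)) := rfl

variable {f}

lemma tensorAction_tmul {U : X.Opens} {V : Y.Opens} (h : U ≤ f ⁻¹ᵁ V) (P : DOp K U)
    (n : Γ(Transfer K f, U)) (m : Γ(M, V)) :
    (tensorAction f ρ).opS P ((invMod f ρ).toSheaf U (InvSec.tmul ρ h n m)) =
      (invMod f ρ).toSheaf U (InvSec.tmul ρ h ((transferModule f).opS P n) m) := by
  rw [tensorAction_opS, ofTensor_toSheaf, opS_rightEval, toTensor_rightEval]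

variable {ρ} in
/-- An action on `D_{X → Y} ⊗ f⁻¹M` is determined by its values on the sections `n ⊗ m`. -/
lemma tensorAction_ext {θ θ' : DAction K (InvD f ρ)}
    (H : ∀ (U : X.Opens) (V : Y.Opens) (h : U ≤ f ⁻¹ᵁ V) (P : DOp K U)
      (n : Γ(Transfer K f, U)) (m : Γ(M, V)),
      θ.op U P (InvD.tmul f ρ h n m) = θ'.op U P (InvD.tmul f ρ h n m)) : θ = θ' := by
  refine DAction.ext_op fun U P s => ?_
  have key : ∀ (V : X.Opens) (Q : DOp K V) (x : InvSec f ρ V),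
      θ.op V Q ((invMod f ρ).toSheaf V x) = θ'.op V Q ((invMod f ρ).toSheaf V x) := by
    intro V Q x
    induction x using InvSec.induction with
    | htmul W h n m => exact H V W h Q n m
    | hadd x y hx hy =>
      have h1 := map_add ((invMod f ρ).toSheaf V) x y
      refine (congrArg (θ.op V Q) h1).trans (Eq.trans ?_ (congrArg (θ'.op V Q) h1).symm)
      exact (map_add (θ.op V Q) _ _).trans
        ((congrArg₂ (· + ·) hx hy).trans (map_add (θ'.op V Q) _ _).symm)
  refine eq_of_locally_ab (F := InvD f ρ) (invMod f ρ).sheaf.isSheaf fun x hx => ?_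
  obtain ⟨V, hV, hxV, y, hy⟩ := (invMod f ρ).exists_toSheaf_eq s hx
  have hy' : (invMod f ρ).toSheaf V y = resAb (InvD f ρ) hV s := hy
  refine ⟨V, hV, hxV, ?_⟩
  rw [θ.res_op, θ'.res_op, ← hy']
  exact key V _ y

end Action

end DConn

end

theorem mainTheorem6 {K : Type u} [Field K] [CharZero K] {X Y : Scheme.{u}}
    [X.Over (Spec (CommRingCat.of K))] [Y.Over (Spec (CommRingCat.of K))]
    [Smooth (X ↘ Spec (CommRingCat.of K))] [Smooth (Y ↘ Spec (CommRingCat.of K))]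
    (f : X ⟶ Y) [f.IsOver (Spec (CommRingCat.of K))] (M : Y.Modules) :
    -- integrable connections on `M` and structures of `D_Y`-module on `M` correspond bijectively
    (∀ ρ : DModuleStructure K M, ∃! c : Connection K M, c.Integrable ∧ c.Corresponds ρ) ∧
    (∀ c : Connection K M, c.Integrable → ∃! ρ : DModuleStructure K M, c.Corresponds ρ) ∧
    -- for a `D_Y`-module `(M, ρ)` with corresponding connection `c = ∇`
    ∀ (c : Connection K M) (ρ : DModuleStructure K M), c.Integrable → c.Corresponds ρ →
      -- the inverse image connection `c' = f^*∇ = f^*δ - c_X` exists, is unique and integrable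
      ∃ c' : Connection K ((Scheme.Modules.pullback f).obj M),
        (∀ c'' : Connection K ((Scheme.Modules.pullback f).obj M),
          c.IsInverseImage f c'' ↔ c'' = c') ∧
        c'.Integrable ∧
        -- `(f^*∇)(α ⊗ m) = α f^*(∇(m)) + dα ⊗ m`
        (∀ (U : X.Opens) (V : Y.Opens) (h : U ≤ f ⁻¹ᵁ V) (a : Γ(X, U)) (m : Γ(M, V)),
          c'.apply (tmul f M h a m) =
            a • res (Omega K ((Scheme.Modules.pullback f).obj M)) h
                ((omegaPull f M).app V (c.apply m)) +
              dTmul a (tmul f M h 1 m)) ∧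
        -- `(f^*Δ)_∂ (α ⊗ m) = α ∑ᵢ ∂(yᵢ) ⊗ Δ_{ηᵢ}(m) + ∂(α) ⊗ m`
        (∀ (U : X.Opens) (V : Y.Opens) (h : U ≤ f ⁻¹ᵁ V) (n : ℕ) (y : Fin n → Γ(Y, V))
          (η : Fin n → VectorField K V), IsCoordinates y η →
          ∀ (d : VectorField K U) (a : Γ(X, U)) (m : Γ(M, V)),
            c'.along d (tmul f M h a m) =
              a • ∑ i, tmul f M h (d.apply (pullO K f h (y i))) (c.along (η i) m) +
                tmul f M h (d.apply a) m) ∧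
        -- the `D_X`-module structure `σ` induced by `f^*∇` is the inverse image of `ρ`
        ∃ σ : DModuleStructure K ((Scheme.Modules.pullback f).obj M),
          (∀ σ' : DModuleStructure K ((Scheme.Modules.pullback f).obj M),
            c'.Corresponds σ' ↔ σ' = σ) ∧
          (∀ σ' : DModuleStructure K ((Scheme.Modules.pullback f).obj M),
            ρ.IsInverseImage f σ' ↔ σ' = σ) ∧
          -- the left `D_X`-module structure `τ` of `D_{X → Y} = f^* D_Y`, which commutes with the
          -- right multiplication by the sections of `D_Y`
          ∃ τ : DModuleStructure K (Transfer K f),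
            (∀ τ' : DModuleStructure K (Transfer K f),
              (regular K Y).IsInverseImage f τ' ↔ τ' = τ) ∧
            (∀ (U : X.Opens) (V : Y.Opens) (h : U ≤ f ⁻¹ᵁ V) (P : D (X := X) K U)
              (Q : D (X := Y) K V) (n : Γ(Transfer K f, U)),
              τ.act U P (rightMul f h Q n) = rightMul f h Q (τ.act U P n)) ∧
            -- the left `D_X`-module structure `θ` of `D_{X → Y} ⊗ f⁻¹M` (over `f⁻¹D_Y`)
            ∃ θ : DAction K (InvD f ρ),
              (∀ θ' : DAction K (InvD f ρ),
                (∀ (U : X.Opens) (V : Y.Opens) (h : U ≤ f ⁻¹ᵁ V) (P : D (X := X) K U)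
                  (n : Γ(Transfer K f, U)) (m : Γ(M, V)),
                  θ'.act U P (InvD.tmul f ρ h n m) = InvD.tmul f ρ h (τ.act U P n) m) ↔ θ' = θ) ∧
              -- the comparison isomorphism, `α ⊗ m ↦ (α ⊗ 1) ⊗ m`, is `D_X`-linear
              ∃ Φ : ((Scheme.Modules.pullback f).obj M).presheaf ≅ InvD f ρ,
                (∀ (U : X.Opens) (V : Y.Opens) (h : U ≤ f ⁻¹ᵁ V) (a : Γ(X, U)) (m : Γ(M, V)),
                  Φ.hom.app (op U) (tmul f M h a m) =
                    InvD.tmul f ρ h (Transfer.tmul K f h a 1) m) ∧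
                ∀ (U : X.Opens) (P : D (X := X) K U)
                  (s : Γ((Scheme.Modules.pullback f).obj M, U)),
                  Φ.hom.app (op U) (σ.act U P s) = θ.act U P (Φ.hom.app (op U) s) := by 
  refine ⟨fun ρ => ρ.existsUnique_connection, fun c hc => Connection.existsUnique_dModule hc,
    fun c ρ hc hρ => ?_⟩
  obtain rfl : c = ρ.toConnection := ρ.existsUnique_connection.unique ⟨hc, hρ⟩
    ⟨ρ.corresponds_toConnection.integrable, ρ.corresponds_toConnection⟩
  refine ⟨ρ.toConnection.inverseImage f, Connection.isInverseImage_iff _, hc.inverseImage,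
    fun U V h a m => Connection.inverseImage_tmul _ h a m,
    fun U V h n y η hy d a m => Connection.along_inverseImage_tmul _ h hy d a m,
    ρ.inverseImage f, Connection.corresponds_iff _, ρ.isInverseImage_iff,
    transferModule f, DModuleStructure.isInverseImage_iff (M := DMod K Y) (regular K Y),
    fun U V h P Q n => opS_transferMul h P Q n, (tensorAction f ρ).toDAction,
    fun θ' => ⟨fun hθ => tensorAction_ext fun U V h P n m =>
      (hθ U V h P n m).trans (tensorAction_tmul ρ h P n m).symm, ?_⟩,
    (Scheme.Modules.toPresheaf X).mapIso (tensorIso f ρ),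
    fun U V h a m => toTensor_tmul ρ h a m, fun U P s => ?_⟩
  · rintro rfl U V h P n m
    exact tensorAction_tmul ρ h P n m
  · exact congrArg (fun t => (toTensor f ρ).app U ((ρ.inverseImage f).opS (P : DOp K U) t))
      (ofTensor_toTensor ρ s).symm
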